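/- Let $\Gamma=\mathbb Z+\mathbb Z\tau$ with $\operatorname{Im}\tau>0$, let $\mathcal E=\mathbb C/\Gamma$, let $n,k$ be coprime integers with $1\le k<n$, and let $\eta\in\mathbb C$ with $n\eta\notin\Gamma$. Put $$\theta(z)=\sum_{\alpha\in\mathbb Z}(-1)^\alpha e^{2\pi i(\alpha z+\frac{\alpha(\alpha-1)}2\tau)},\qquad \theta_\alpha(z)=\prod_{j=0}^{n-1}\theta\Bigl(z+\frac jn+\frac\alpha n\tau\Bigr)\,e^{2\pi i(\alpha z+\frac{\alpha(\alpha-n)}{2n}\tau+\frac{\alpha}{2n})}\quad(\alpha\in\mathbb Z/n\mathbb Z).$$ Let $Q_{n,k}(\mathcal E,\eta)$ be the associative $\mathbb C$-algebra with generators $x_i$, $i\in\mathbb Z/n\mathbb Z$, and relations $$\sum_{r\in\mathbb Z/n\mathbb Z}\frac{\theta_{j-i+r(k-1)}(0)}{\theta_{kr}(\eta)\,\theta_{j-i-r}(-\eta)}\,x_{j-r}x_{i+r}=0\qquad(i,j\in\mathbb Z/n\mathbb Z).$$ For $q\ge1$ and $\mu,\mu_1,\dots,\mu_q\in\mathbb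 C$ let $Y_q(\mathcal E,\mu;\mu_1,\dots,\mu_q)$ be the associative $\mathbb C$-algebra with generators $e(u_1,\dots,u_q)$, $u_1,\dots,u_q\in\mathbb C$, and relations $$\begin{aligned} &\frac{\theta(v_1-u_1+\mu)}{\theta(v_1-u_1)}\,e(u_1,\dots,u_q)\,e(v_1+\mu_1,\dots,v_q+\mu_q)\\ &=\sum_{1\le t<q}\frac{\theta(\mu)\,\theta(v_t-u_t+u_{t+1}-v_{t+1})}{\theta(v_t-u_t)\,\theta(u_{t+1}-v_{t+1})}\,e(v_1,\dots,v_t,u_{t+1},\dots,u_q)\,e(u_1+\mu_1,\dots,u_t+\mu_t,v_{t+1}+\mu_{t+1},\dots,v_q+\mu_q)\\ &\quad+\frac{\theta(v_q-u_q+\mu)}{\theta(v_q-u_q)}\,e(v_1,\dots,v_q)\,e(u_1+\mu_1,\dots,u_q+\mu_q) \end{aligned}$$ for all $u,v\in\mathbb C^q$ at which no denominator vanishes. Let $\frac n{n-k}=n_1'-\frac1{n_2'-\ldots-\frac1{n_{q'}'}}$ be the continued fraction with all $n_\alpha'\ge2$. Let $d(m_1,\dots,m_t)$ be the determinant of the tridiagonal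 $t\times t$ matrix with diagonal entries $m_1,\dots,m_t$ and entries $-1$ next to the diagonal ($d(\varnothing)=1$), and put $$\mu=n\eta,\qquad \mu_\alpha=\bigl(d(n_1',\dots,n_{\alpha-1}')-d(n_{\alpha+1}',\dots,n_{q'}')\bigr)\eta .$$ Let $\Theta_{n/(n-k)}(\Gamma)$ be the space of entire functions $f$ of $q'$ variables that have period $1$ in each variable and satisfy, for $1\le\alpha\le q'$ and with $z_0=z_{q'+1}=0$, $$f(z_1,\dots,z_\alpha+\tau,\dots,z_{q'})=(-1)^{n_\alpha'}e^{-2\pi i(n_\alpha'z_\alpha-z_{\alpha-1}-z_{\alpha+1}-(\delta_{1,\alpha}-1)\tau)}f(z_1,\dots,z_{q'}).$$ With $r_\alpha=d(n_{\alpha+1}',\dots,n_{q'}')/n$ and $\phi\in\mathbb C$ let $(T_{\frac1n}f)(z)=f(z+r)$ and $(T_{\frac1n\tau}f)(z)=e^{2\pi i(z_1+\phi)}f(z+r\tau)$. Then for some $\phi$ the space $\Theta_{n/(n-k)}(\Gamma)$ has a basis $\{w_\alpha;\alpha\in\mathbb Z/n\mathbb Z\}$ with $$T_{\frac1n}w_\alpha=e^{2\pi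 i\frac{n-k}n\alpha}w_\alpha,\qquad T_{\frac1n\tau}w_\alpha=w_{\alpha+1}\qquad(\alpha\in\mathbb Z/n\mathbb Z),$$ and for every $\phi$ and every such basis there is an algebra homomorphism $$\psi\colon Y_{q'}(\mathcal E,\mu;\mu_1,\dots,\mu_{q'})\to Q_{n,k}(\mathcal E,\eta),\qquad \psi\bigl(e(u_1,\dots,u_{q'})\bigr)=\sum_{\alpha\in\mathbb Z/n\mathbb Z}w_\alpha(u_1,\dots,u_{q'})\,x_{1-\alpha}\quad\text{for all }u\in\mathbb C^{q'}.$$ -/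

import Mathlib

namespace EllipticAlg

noncomputable section

/-- `e(x) = exp(2πi x)`. -/
def e (x : ℂ) : ℂ := Complex.exp (2 * (Real.pi : ℂ) * Complex.I * x)

/-- The lattice `Γ = ℤ + ℤ τ`. -/
def lattice (τ : ℂ) : AddSubgroup ℂ := AddSubgroup.closure {1, τ}

/-- `θ(z) = ∑_{a ∈ ℤ} (-1)^a exp(2πi (a z + a(a-1)/2 · τ))`. -/
def theta (τ z : ℂ) : ℂ :=
  ∑' a : ℤ, (-1 : ℂ) ^ a * e ((a : ℂ) * z + (a : ℂ) * ((a : ℂ) - 1) / 2 * τ)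

/-- The basis functions of order `n` in one variable: for `a ∈ ℤ/n`,
`θ_a(z) = θ(z + aτ/n) θ(z + 1/n + aτ/n) ⋯ θ(z + (n-1)/n + aτ/n)
  · exp(2πi (a z + a(a-n)/(2n) τ + a/(2n)))`,
written with the representative `0 ≤ a < n` (the formula is `n`-periodic in `a`). -/
def thetaOrder (τ : ℂ) (n : ℕ) (a : ZMod n) (z : ℂ) : ℂ :=
  (∏ j ∈ Finset.range n, theta τ (z + (j : ℂ) / (n : ℂ) + (a.val : ℂ) / (n : ℂ) * τ)) *
    e ((a.val : ℂ) * z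
      + (a.val : ℂ) * ((a.val : ℂ) - (n : ℂ)) / (2 * (n : ℂ)) * τ
      + (a.val : ℂ) / (2 * (n : ℂ)))

/-! ### Continued fractions and continuants -/

/-- The tridiagonal matrix with diagonal `l` and `-1` next to the diagonal. -/
def tridiag (l : List ℕ) : Matrix (Fin l.length) (Fin l.length) ℤ :=
  Matrix.of fun i j =>
    if i = j then (l.get i : ℤ)
    else if i.val + 1 = j.val ∨ j.val + 1 = i.val then -1
    else 0

/-- `d(m_1, …, m_t)`, the determinant of the tridiagonal matrix; `d(∅) = 1`. -/
def d (l : List ℕ) : ℤ := (tridiag l).det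

/-- The value `m_1 - 1/(m_2 - ⋯ - 1/m_t)` of a continued fraction (`0` for the empty list). -/
def cfValue : List ℕ → ℚ
  | [] => 0
  | [a] => (a : ℚ)
  | a :: b :: l => (a : ℚ) - 1 / cfValue (b :: l)

/-- `m_1, …, m_{p+1}` are the terms, all at least `2`, of the continued fraction
`x = m_1 - 1/(m_2 - ⋯ - 1/m_{p+1})`. -/
def IsCFExpansion (x : ℚ) {p : ℕ} (m : Fin (p + 1) → ℕ) : Prop :=
  (∀ i, 2 ≤ m i) ∧ cfValue (List.ofFn m) = x

/-- The continuant `d` of the terms before position `i`. -/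
def dBefore {p : ℕ} (m : Fin (p + 1) → ℕ) (i : Fin (p + 1)) : ℤ :=
  d ((List.ofFn m).take i.val)

/-- The continuant `d` of the terms after position `i`. -/
def dAfter {p : ℕ} (m : Fin (p + 1) → ℕ) (i : Fin (p + 1)) : ℤ :=
  d ((List.ofFn m).drop (i.val + 1))

/-! ### Theta functions of several variables -/

/-- One-based coordinates of `z = (z_1, …, z_{p+1})`, extended by `z_0 = z_{p+2} = 0`. -/
def coord {p : ℕ} (z : Fin (p + 1) → ℂ) : ℕ → ℂ
  | 0 => 0
  | j + 1 => if h : j < p + 1 then z ⟨j, h⟩ else 0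

/-- The factor `(-1)^{m_a} exp(-2πi (m_a z_a - z_{a-1} - z_{a+1} - (δ_{1,a} - 1) τ))`, where
`i : Fin (p + 1)` is the index `a = i + 1`. -/
def thetaFactor (τ : ℂ) {p : ℕ} (m : Fin (p + 1) → ℕ) (i : Fin (p + 1))
    (z : Fin (p + 1) → ℂ) : ℂ :=
  (-1 : ℂ) ^ (m i) *
    e (-((m i : ℂ) * z i - coord z i.val - coord z (i.val + 2)
      - ((if i = 0 then 1 else 0) - 1) * τ))

/-- The space `Θ_{n/k}(Γ)`, where `m` is the continued fraction of `n/k`: entire functions of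
`p + 1` variables with period `1` and quasi-period `τ` in each variable. -/
def thetaSpace (τ : ℂ) {p : ℕ} (m : Fin (p + 1) → ℕ) :
    Submodule ℂ ((Fin (p + 1) → ℂ) → ℂ) where
  carrier := {f | Differentiable ℂ f ∧
    (∀ i z, f (Function.update z i (z i + 1)) = f z) ∧
    (∀ i z, f (Function.update z i (z i + τ)) = thetaFactor τ m i z * f z)}
  zero_mem' := ⟨differentiable_const 0, fun _ _ => rfl, fun _ _ => by simp⟩
  add_mem' := by
    rintro f g ⟨hf, hf1, hf2⟩ ⟨hg, hg1, hg2⟩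
    refine ⟨hf.add hg, fun i z => ?_, fun i z => ?_⟩
    · simp only [Pi.add_apply, hf1, hg1]
    · simp only [Pi.add_apply, hf2, hg2, mul_add]
  smul_mem' := by
    rintro c f ⟨hf, hf1, hf2⟩
    refine ⟨hf.const_smul c, fun i z => ?_, fun i z => ?_⟩
    · simp only [Pi.smul_apply, hf1]
    · simp only [Pi.smul_apply, hf2, smul_eq_mul]
      ring

/-- The shift vector `r_a = d(m_{a+1}, …) / n`. -/
def shiftVec (n : ℕ) {p : ℕ} (m : Fin (p + 1) → ℕ) (i : Fin (p + 1)) : ℂ :=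
  (dAfter m i : ℂ) / (n : ℂ)

/-- `(T_{1/n} f)(z) = f(z + r)`. -/
def opT (n : ℕ) {p : ℕ} (m : Fin (p + 1) → ℕ) (f : (Fin (p + 1) → ℂ) → ℂ) :
    (Fin (p + 1) → ℂ) → ℂ :=
  fun z => f (fun i => z i + shiftVec n m i)

/-- `(T_{τ/n} f)(z) = exp(2πi (z_1 + φ)) f(z + r τ)`. -/
def opTτ (τ : ℂ) (n : ℕ) {p : ℕ} (m : Fin (p + 1) → ℕ) (φ : ℂ)
    (f : (Fin (p + 1) → ℂ) → ℂ) : (Fin (p + 1) → ℂ) → ℂ :=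
  fun z => e (z 0 + φ) * f (fun i => z i + shiftVec n m i * τ)

/-- `w_a`, `a ∈ ℤ/n`, is the distinguished basis of `Θ_{n/k}(Γ)` (`m` being the continued
fraction of `n/k`), relative to the constant `φ` in `T_{τ/n}`:
`T_{1/n} w_a = exp(2πi k a/n) w_a` and `T_{τ/n} w_a = w_{a+1}`. As `a` runs through `ℤ/n`, the
last condition contains the normalization `T_{τ/n}^n = 1` of `φ`. -/
structure IsThetaBasis (τ : ℂ) (n k : ℕ) {p : ℕ} (m : Fin (p + 1) → ℕ) (φ : ℂ)
    (w : ZMod n → (Fin (p + 1) → ℂ) → ℂ) : Prop where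
  linearIndependent : LinearIndependent ℂ w
  span_eq : Submodule.span ℂ (Set.range w) = thetaSpace τ m
  opT_eq : ∀ a, opT n m (w a) = e ((k : ℂ) / (n : ℂ) * (a.val : ℂ)) • w a
  opTτ_eq : ∀ a, opTτ τ n m φ (w a) = w (a + 1)

/-! ### The elliptic algebra `Q_{n,k}(𝓔, η)` -/

/-- The left-hand sides of the relations, one for each pair `i, j ∈ ℤ/n`:
`∑_r θ_{j-i+r(k-1)}(0) / (θ_{kr}(η) θ_{j-i-r}(-η)) x_{j-r} x_{i+r}`. -/
def ellipticRelator (τ : ℂ) (n k : ℕ) [NeZero n] (η : ℂ) (i j : ZMod n) :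
    FreeAlgebra ℂ (ZMod n) :=
  ∑ r : ZMod n,
    (thetaOrder τ n (j - i + r * ((k : ZMod n) - 1)) 0 /
      (thetaOrder τ n ((k : ZMod n) * r) η * thetaOrder τ n (j - i - r) (-η))) •
      (FreeAlgebra.ι ℂ (j - r) * FreeAlgebra.ι ℂ (i + r))

inductive EllipticRel (τ : ℂ) (n k : ℕ) [NeZero n] (η : ℂ) :
    FreeAlgebra ℂ (ZMod n) → FreeAlgebra ℂ (ZMod n) → Prop
  | rel (i j : ZMod n) : EllipticRel τ n k η (ellipticRelator τ n k η i j) 0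

/-- `Q_{n,k}(𝓔, η)` with `𝓔 = ℂ/Γ`. -/
abbrev EllipticAlgebra (τ : ℂ) (n k : ℕ) [NeZero n] (η : ℂ) : Type :=
  RingQuot (EllipticRel τ n k η)

/-- The generator `x_i` of `Q_{n,k}(𝓔, η)`. -/
def ellipticGen (τ : ℂ) (n k : ℕ) [NeZero n] (η : ℂ) (i : ZMod n) :
    EllipticAlgebra τ n k η :=
  RingQuot.mkAlgHom ℂ (EllipticRel τ n k η) (FreeAlgebra.ι ℂ i)

/-! ### The exchange algebra `Y_q(𝓔, μ; μ_1, …, μ_q)`, `q = p + 1` -/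

/-- The point `(x_1, …, x_t, y_{t+1}, …, y_q)`, where `s : Fin p` is the cut `t = s + 1`. -/
def splice {p : ℕ} (s : Fin p) (x y : Fin (p + 1) → ℂ) : Fin (p + 1) → ℂ :=
  fun i => if i ≤ s.castSucc then x i else y i

/-- The generator `e(u)` in the free algebra. -/
def eFree {p : ℕ} (u : Fin (p + 1) → ℂ) : FreeAlgebra ℂ (Fin (p + 1) → ℂ) :=
  FreeAlgebra.ι ℂ u

/-- `θ(v_1-u_1+μ) / θ(v_1-u_1) · e(u) e(v + μ)`. -/
def exchangeLHS (τ : ℂ) {p : ℕ} (μ : ℂ) (μs u v : Fin (p + 1) → ℂ) :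
    FreeAlgebra ℂ (Fin (p + 1) → ℂ) :=
  (theta τ (v 0 - u 0 + μ) / theta τ (v 0 - u 0)) • (eFree u * eFree (v + μs))

/-- The right-hand side of the exchange relation; the summand with index `s : Fin p` is the one
with `t = s + 1`, `1 ≤ t < q`. -/
def exchangeRHS (τ : ℂ) {p : ℕ} (μ : ℂ) (μs u v : Fin (p + 1) → ℂ) :
    FreeAlgebra ℂ (Fin (p + 1) → ℂ) :=
  (∑ s : Fin p,
    (theta τ μ * theta τ (v s.castSucc - u s.castSucc + u s.succ - v s.succ) /
      (theta τ (v s.castSucc - u s.castSucc) * theta τ (u s.succ - v s.succ))) •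
      (eFree (splice s v u) * eFree (splice s (u + μs) (v + μs))))
  + (theta τ (v (Fin.last p) - u (Fin.last p) + μ) / theta τ (v (Fin.last p) - u (Fin.last p))) •
      (eFree v * eFree (u + μs))

/-- The exchange relations, one for all `u, v` at which the coefficients are defined, that is,
at which no denominator `θ(v_t - u_t)` vanishes (`θ(u_t - v_t)` then does not vanish either). -/
inductive ExchangeRel (τ : ℂ) {p : ℕ} (μ : ℂ) (μs : Fin (p + 1) → ℂ) :
    FreeAlgebra ℂ (Fin (p + 1) → ℂ) → FreeAlgebra ℂ (Fin (p + 1) → ℂ) → Prop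
  | rel (u v : Fin (p + 1) → ℂ) (h : ∀ t, theta τ (v t - u t) ≠ 0) :
      ExchangeRel τ μ μs (exchangeLHS τ μ μs u v) (exchangeRHS τ μ μs u v)

/-- `Y_q(𝓔, μ; μ_1, …, μ_q)` with `q = p + 1` and `𝓔 = ℂ/Γ`. -/
abbrev ExchangeAlgebra (τ : ℂ) {p : ℕ} (μ : ℂ) (μs : Fin (p + 1) → ℂ) : Type :=
  RingQuot (ExchangeRel τ μ μs)

/-- The generator `e(u_1, …, u_q)` of the exchange algebra. -/
def exchangeGen (τ : ℂ) {p : ℕ} (μ : ℂ) (μs : Fin (p + 1) → ℂ) (u : Fin (p + 1) → ℂ) :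
    ExchangeAlgebra τ μ μs :=
  RingQuot.mkAlgHom ℂ (ExchangeRel τ μ μs) (eFree u)

/-- The shifts `μ_a = (d(m_1, …, m_{a-1}) - d(m_{a+1}, …, m_q)) η`. -/
def exchangeShift {p : ℕ} (m : Fin (p + 1) → ℕ) (η : ℂ) (i : Fin (p + 1)) : ℂ :=
  ((dBefore m i : ℂ) - (dAfter m i : ℂ)) * η

end

end EllipticAlg

open Filter Topology Matrix

namespace EllipticAlg

/-! ### The exponential and the lattice -/

/-! Write A_j and B_j for the continuants of the final and initial segments of the continued
fraction (`contAfter`, `contBefore`), M for its tridiagonal matrix, A and B for the vectors (A_1,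
…), (B_1, …). Both sequences solve the recursion of M, their Casoratian is A_0 = n, and A_1 = n - k.
Hence r = A/n is the first column of M⁻¹, and this makes the two operators act on Θ as a Heisenberg
group.

Existence of the basis. Quasi-periodicity ties together the Fourier coefficients of a theta function
along the cosets of M ℤ^{q'}. The quotient by M ℤ^{q'} is generated by one vector killed by n, so
dim Θ ≤ n. A product of one-variable thetas, suitably translated, shows Θ ≠ 0. An eigenvector of
T_{1/n} then has an n-th root of unity as eigenvalue, and T_{τ/n} moves it through all n distinct
eigenvalues; the dimension bound turns these n independent vectors into a basis
(`exists_isThetaBasis`).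

The homomorphism. Fix basis elements w_a, w_b and insert a spectral parameter z into the exchange
relation. Its summands become products of a Kronecker function θ(x+y)/(θ(x)θ(y)) with w_a(left
point) w_b(right point) (`exchangeTerm`). On the other side stands a combination of products w_c(U)
w_d(V) with coefficients θ_{α+β}(η-z)/(θ_β(η) θ_α(-z)) (`relSum`). Both sides have period 1 and
multiplier e(nη) under z ↦ z + τ. The poles agree: those at intermediate coordinates cancel between
neighbouring summands (`exists_tendsto_exchangeTerm`), while those at Γ/n occur only in the first
summand and in `relSum`, where the Heisenberg action identifies the residues
(`IsThetaBasis.tendsto_exchangeTerm_zero`, `tendsto_relSum`). The difference is therefore entire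
with multipliers 1 and e(nη), and it vanishes because nη ∉ Γ (`meromorphic_eq_zero_of_periodic`).
The argument needs simple, separated poles; the remaining parameters follow by continuity
(`IsThetaBasis.sum_exchangeTerm`).

At z = η the left side is the exchange relation evaluated on w_a ⊗ w_b, up to the factor -θ(nη), and
the coefficients on the right are those of the defining relations of Q_{n,k}. Multiplying by x_{1-a}
x_{1-b} and summing over a, b therefore gives zero in the target. -/

lemma e_add (x y : ℂ) : e (x + y) = e x * e y := by
  simp only [e, mul_add, Complex.exp_add]

@[simp] lemma e_zero : e 0 = 1 := by simp [e]

@[simp] lemma e_ne_zero (x : ℂ) : e x ≠ 0 := Complex.exp_ne_zero _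

lemma e_neg (x : ℂ) : e (-x) = (e x)⁻¹ := by
  simp only [e, mul_neg, Complex.exp_neg]

lemma e_sub (x y : ℂ) : e (x - y) = e x / e y := by
  rw [sub_eq_add_neg, e_add, e_neg, div_eq_mul_inv]

lemma e_eq_one_iff {x : ℂ} : e x = 1 ↔ ∃ j : ℤ, x = j := by
  have h : (2 * (Real.pi : ℂ) * Complex.I) ≠ 0 := Complex.two_pi_I_ne_zero
  rw [e, Complex.exp_eq_one_iff]
  refine exists_congr fun j => ⟨fun hx => ?_, fun hx => by rw [hx]; ring⟩
  exact mul_left_cancel₀ h (by rw [hx]; ring)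

@[simp] lemma e_int (j : ℤ) : e j = 1 := e_eq_one_iff.2 ⟨j, rfl⟩

@[simp] lemma e_one : e 1 = 1 := by simpa using e_int 1

lemma e_half : e (1 / 2) = -1 := by
  rw [e, show 2 * (Real.pi : ℂ) * Complex.I * (1 / 2) = Real.pi * Complex.I by ring,
    Complex.exp_pi_mul_I]

lemma e_add_int (x : ℂ) (j : ℤ) : e (x + j) = e x := by simp [e_add]

lemma e_congr {x y : ℂ} (j : ℤ) (h : x = y + j) : e x = e y := by rw [h, e_add_int]

lemma e_int_mul (x : ℂ) (j : ℤ) : e (j * x) = e x ^ j := by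
  rw [e, e, ← Complex.exp_int_mul]; ring_nf

lemma e_nat_mul (x : ℂ) (j : ℕ) : e (j * x) = e x ^ j := by
  exact_mod_cast e_int_mul x j

lemma e_eq_iff {x y : ℂ} : e x = e y ↔ ∃ j : ℤ, x = y + j := by
  rw [← div_eq_one_iff_eq (e_ne_zero y), ← e_sub, e_eq_one_iff]
  exact exists_congr fun j => ⟨fun h => by rw [← h]; ring, fun h => by rw [h]; ring⟩

lemma norm_e (x : ℂ) : ‖e x‖ = Real.exp (-(2 * Real.pi * x.im)) := by
  rw [e, Complex.norm_exp]
  congr 1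
  simp

lemma exists_e_eq {x : ℂ} (hx : x ≠ 0) : ∃ y, e y = x := by
  refine ⟨Complex.log x / (2 * Real.pi * Complex.I), ?_⟩
  rw [e, mul_div_cancel₀ _ Complex.two_pi_I_ne_zero, Complex.exp_log hx]

@[fun_prop] lemma differentiable_e : Differentiable ℂ e := by
  unfold e; fun_prop

@[fun_prop] lemma continuous_e : Continuous e := differentiable_e.continuous

lemma hasDerivAt_e (x : ℂ) : HasDerivAt e (2 * Real.pi * Complex.I * e x) x := by
  have := ((hasDerivAt_id x).const_mul (2 * (Real.pi : ℂ) * Complex.I)).cexp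
  simp only [mul_one, id] at this
  rw [mul_comm]
  exact this

lemma neg_one_zpow_eq_e (j : ℤ) : (-1 : ℂ) ^ j = e (j / 2) := by
  rw [← e_half, ← e_int_mul]; ring_nf

lemma neg_one_pow_eq_e (j : ℕ) : (-1 : ℂ) ^ j = e (j / 2) := by
  simpa using neg_one_zpow_eq_e j

lemma mem_lattice {τ z : ℂ} : z ∈ lattice τ ↔ ∃ i j : ℤ, z = i + j * τ := by
  rw [lattice, AddSubgroup.mem_closure_pair]
  refine exists_congr fun i => exists_congr fun j => ?_
  simp [eq_comm]

/-! ### A Liouville theorem for multiplicatively periodic functions -/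

/-- A meromorphic function without poles agrees with an entire function off its singularities. -/
lemma exists_entire_of_meromorphic {f : ℂ → ℂ} (hf : ∀ z, MeromorphicAt f z)
    (hlim : ∀ z₀, Tendsto (fun z => (z - z₀) * f z) (𝓝[≠] z₀) (𝓝 0)) :
    ∃ g : ℂ → ℂ, Differentiable ℂ g ∧ (∀ z₀, f =ᶠ[𝓝[≠] z₀] g) := by
  have hf' : MeromorphicOn f Set.univ := fun z _ => hf z
  refine ⟨toMeromorphicNFOn f Set.univ, fun z => ?_, fun z =>
    (hf'.toMeromorphicNFOn_eq_self_on_nhdsNE (Set.mem_univ z)).symm⟩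
  have hNF := meromorphicNFOn_toMeromorphicNFOn f Set.univ (Set.mem_univ z)
  refine (hNF.meromorphicOrderAt_nonneg_iff_analyticAt.1 ?_).differentiableAt
  rw [meromorphicOrderAt_toMeromorphicNFOn hf' (Set.mem_univ z)]
  have hid : MeromorphicAt (fun w : ℂ => w - z) z := by fun_prop
  have h1 : meromorphicOrderAt (fun w : ℂ => w - z) z = 1 := by
    refine (meromorphicOrderAt_eq_int_iff (n := 1) hid).2
      ⟨fun _ => 1, analyticAt_const, one_ne_zero, ?_⟩
    exact Eventually.of_forall fun w => by simp
  have h2 := (tendsto_zero_iff_meromorphicOrderAt_pos (hid.mul (hf z))).1 (hlim z)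
  rw [meromorphicOrderAt_mul hid (hf z), h1] at h2
  cases h : meromorphicOrderAt f z with
  | top => exact le_top
  | coe m =>
    rw [h] at h2
    have h3 : (0 : ℤ) < 1 + m := by exact_mod_cast h2
    have h4 : (0 : ℤ) ≤ m := by omega
    exact_mod_cast h4

lemma exists_decomp {τ : ℂ} (hτ : 0 < τ.im) (z : ℂ) :
    ∃ x y : ℝ, z = x + y * τ := by
  refine ⟨z.re - z.im / τ.im * τ.re, z.im / τ.im, Complex.ext ?_ ?_⟩ <;> simp
  field_simp

lemma norm_bounded_of_periodic {τ : ℂ} (hτ : 0 < τ.im) {g : ℂ → ℂ} (hg : Continuous g)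
    (h1 : ∀ z, ‖g (z + 1)‖ = ‖g z‖) (h2 : ∀ z, ‖g (z + τ)‖ = ‖g z‖) :
    ∃ C, ∀ z, ‖g z‖ ≤ C := by
  have h1' : ∀ (j : ℤ) z, ‖g (z + j)‖ = ‖g z‖ := by
    intro j
    induction j using Int.induction_on with
    | zero => simp
    | succ j ih =>
      intro z; rw [← ih z, ← h1 (z + (j : ℤ))]; push_cast; ring_nf
    | pred j ih =>
      intro z; rw [← ih z, ← h1 (z + _)]; push_cast; ring_nf
  have h2' : ∀ (j : ℤ) z, ‖g (z + j * τ)‖ = ‖g z‖ := by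
    intro j
    induction j using Int.induction_on with
    | zero => simp
    | succ j ih =>
      intro z; rw [← ih z, ← h2 (z + (j : ℤ) * τ)]; push_cast; ring_nf
    | pred j ih =>
      intro z; rw [← ih z, ← h2 (z + _)]; push_cast; ring_nf
  have hK : IsCompact ((fun p : ℝ × ℝ => ((p.1 : ℂ) + p.2 * τ)) ''
      (Set.Icc (0 : ℝ) 1 ×ˢ Set.Icc (0 : ℝ) 1)) :=
    (isCompact_Icc.prod isCompact_Icc).image (by fun_prop)
  obtain ⟨C, hC⟩ := hK.exists_bound_of_continuousOn hg.continuousOn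
  refine ⟨C, fun z => ?_⟩
  obtain ⟨x, y, rfl⟩ := exists_decomp hτ z
  have := hC ((Int.fract x : ℝ) + (Int.fract y : ℝ) * τ) ⟨(Int.fract x, Int.fract y),
    ⟨⟨Int.fract_nonneg _, (Int.fract_lt_one _).le⟩, ⟨Int.fract_nonneg _, (Int.fract_lt_one _).le⟩⟩,
    rfl⟩
  rw [← h1' ⌊x⌋, ← h2' ⌊y⌋] at this
  convert this using 3
  have hx : (x : ℂ) = (⌊x⌋ : ℂ) + (Int.fract x : ℝ) := by exact_mod_cast (Int.floor_add_fract x).symm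
  have hy : (y : ℂ) = (⌊y⌋ : ℂ) + (Int.fract y : ℝ) := by exact_mod_cast (Int.floor_add_fract y).symm
  rw [hx, hy]; ring

/-- Writing ζ = x + sτ with x, s real, the factor e(-sz) has constant modulus along 1 and offsets
the modulus of e(ζ) along τ. The product then has doubly periodic modulus, hence is bounded, and
Liouville applies. -/
lemma entire_eq_exp_of_periodic {τ : ℂ} (hτ : 0 < τ.im) {ζ : ℂ} {g : ℂ → ℂ}
    (hg : Differentiable ℂ g) (h1 : ∀ z, g (z + 1) = g z) (h2 : ∀ z, g (z + τ) = e ζ * g z) :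
    ∃ (C : ℂ) (s : ℝ), ∀ z, g z = C * e (s * z) := by
  obtain ⟨x, s, hζ⟩ := exists_decomp hτ ζ
  have hb : ∃ C, ∀ z, ‖g z * e (-(s * z))‖ ≤ C := by
    refine norm_bounded_of_periodic hτ (by have := hg.continuous; fun_prop)
      (fun z => ?_) (fun z => ?_)
    · rw [h1, norm_mul, norm_mul, norm_e, norm_e]; simp
    · rw [h2, norm_mul, norm_mul, norm_mul, norm_e, norm_e, norm_e, hζ,
        mul_comm (Real.exp _), mul_assoc, ← Real.exp_add]
      congr 2
      simp; ring
  obtain ⟨C, hC⟩ := hb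
  have hd : Differentiable ℂ fun z => g z * e (-(s * z)) := by fun_prop
  refine ⟨g 0 * e (-(s * 0)), s, fun z => ?_⟩
  have := hd.apply_eq_apply_of_bounded
    (isBounded_iff_forall_norm_le.2 ⟨C, by rintro _ ⟨z, rfl⟩; exact hC z⟩) z 0
  rw [← this, mul_assoc, ← e_add]
  simp

/-- The entire extension g inherits the functional equations by taking limits through punctured
neighbourhoods. The values of f are recovered only at points of continuity, since at a removable
singularity f carries the value produced by division by zero. -/
lemma meromorphic_eq_exp_of_periodic {τ : ℂ} (hτ : 0 < τ.im) {ζ : ℂ} {f : ℂ → ℂ}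
    (hf : ∀ z, MeromorphicAt f z)
    (hlim : ∀ z₀, Tendsto (fun z => (z - z₀) * f z) (𝓝[≠] z₀) (𝓝 0))
    (h1 : ∀ z, f (z + 1) = f z) (h2 : ∀ z, f (z + τ) = e ζ * f z) :
    ∃ (C : ℂ) (s : ℝ), ((∀ z, C * e (s * (z + 1)) = C * e (s * z)) ∧
      (∀ z, C * e (s * (z + τ)) = e ζ * (C * e (s * z)))) ∧
      ∀ z, ContinuousAt f z → f z = C * e (s * z) := by
  obtain ⟨g, hg, hfg⟩ := exists_entire_of_meromorphic hf hlim
  have shift : ∀ (c a z : ℂ), (∀ w, f (w + a) = c * f w) → g (z + a) = c * g z := by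
    intro c a z h
    have hA : Tendsto (fun w => g (w + a)) (𝓝[≠] z) (𝓝 (g (z + a))) :=
      ((hg.continuous.comp (continuous_add_const a)).tendsto z).mono_left nhdsWithin_le_nhds
    have hB : Tendsto (fun w => c * g w) (𝓝[≠] z) (𝓝 (c * g z)) :=
      ((hg.continuous.const_smul c).tendsto z).mono_left nhdsWithin_le_nhds
    refine tendsto_nhds_unique (hA.congr' ?_) hB
    have hmap : Tendsto (fun w : ℂ => w + a) (𝓝[≠] z) (𝓝[≠] (z + a)) := by
      refine tendsto_nhdsWithin_iff.2 ⟨((continuous_add_const a).tendsto z).mono_left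
        nhdsWithin_le_nhds, ?_⟩
      filter_upwards [self_mem_nhdsWithin] with w hw
      simpa using hw
    filter_upwards [hfg z, hmap.eventually (hfg (z + a))] with w hw1 hw2
    rw [← hw1, ← hw2, h]
  have g1 : ∀ z, g (z + 1) = g z := fun z => by
    simpa using shift 1 1 z (by simpa using h1)
  have g2 : ∀ z, g (z + τ) = e ζ * g z := fun z => shift (e ζ) τ z h2
  obtain ⟨C, s, hC⟩ := entire_eq_exp_of_periodic hτ hg g1 g2
  refine ⟨C, s, ⟨fun z => ?_, fun z => ?_⟩, fun z hz => ?_⟩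
  · rw [← hC, ← hC, g1]
  · rw [← hC, ← hC, g2]
  · rw [← hC]
    exact tendsto_nhds_unique (hz.mono_left nhdsWithin_le_nhds)
      (((hg.continuous.tendsto z).mono_left nhdsWithin_le_nhds).congr'
        ((hfg z).mono fun w hw => hw.symm))

/-- A pole-free meromorphic function with multipliers `1` and `e(ζ)`, `ζ ∉ Γ`, vanishes. -/
lemma meromorphic_eq_zero_of_periodic {τ : ℂ} (hτ : 0 < τ.im) {ζ : ℂ} (hζ : ζ ∉ lattice τ)
    {f : ℂ → ℂ} (hf : ∀ z, MeromorphicAt f z)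
    (hlim : ∀ z₀, Tendsto (fun z => (z - z₀) * f z) (𝓝[≠] z₀) (𝓝 0))
    (h1 : ∀ z, f (z + 1) = f z) (h2 : ∀ z, f (z + τ) = e ζ * f z)
    {z : ℂ} (hz : ContinuousAt f z) : f z = 0 := by
  obtain ⟨C, s, ⟨hC1, hC2⟩, hC⟩ := meromorphic_eq_exp_of_periodic hτ hf hlim h1 h2
  rw [hC z hz]
  by_contra hne
  have hC0 : C ≠ 0 := left_ne_zero_of_mul hne
  have h3 : e s = 1 := by simpa [hC0] using hC1 0
  have h4 : e (s * τ) = e ζ := by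
    have := hC2 0
    simp only [zero_add, mul_zero, e_zero, mul_one] at this
    exact mul_left_cancel₀ hC0 (by rw [this, mul_comm])
  obtain ⟨j, hj⟩ := e_eq_one_iff.1 h3
  obtain ⟨i, hi⟩ := e_eq_iff.1 h4.symm
  exact hζ (mem_lattice.2 ⟨i, j, by rw [hi, hj]; ring⟩)

/-! ### The function `θ`: quasi-periodicity -/

section Theta

variable {τ : ℂ}

/-- The sign is absorbed by the shift 1/2 and the linear part -aτ/2 of the exponent by the shift
-τ/2. Through `jacobiTheta₂`, θ inherits holomorphy and its quasi-periods. -/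
lemma theta_term_eq (τ z : ℂ) (a : ℤ) :
    (-1 : ℂ) ^ a * e ((a : ℂ) * z + (a : ℂ) * ((a : ℂ) - 1) / 2 * τ) =
      jacobiTheta₂_term a (z - τ / 2 + 1 / 2) τ := by
  rw [neg_one_zpow_eq_e, ← e_add, e, jacobiTheta₂_term]
  congr 1
  ring

lemma theta_eq_jacobiTheta₂ (τ z : ℂ) : theta τ z = jacobiTheta₂ (z - τ / 2 + 1 / 2) τ :=
  tsum_congr fun a => theta_term_eq τ z a

lemma differentiable_theta (hτ : 0 < τ.im) : Differentiable ℂ (theta τ) := by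
  intro z
  have h : theta τ = (fun w => jacobiTheta₂ w τ) ∘ fun z => z - τ / 2 + 1 / 2 :=
    funext fun z => theta_eq_jacobiTheta₂ τ z
  rw [h]
  exact (differentiableAt_jacobiTheta₂_fst _ hτ).comp z (by fun_prop)

lemma continuous_theta (hτ : 0 < τ.im) : Continuous (theta τ) :=
  (differentiable_theta hτ).continuous

lemma theta_add_one (τ z : ℂ) : theta τ (z + 1) = theta τ z := by
  rw [theta_eq_jacobiTheta₂, theta_eq_jacobiTheta₂, ← jacobiTheta₂_add_left (z - _ + _)]
  ring_nf

lemma theta_add_tau (τ z : ℂ) : theta τ (z + τ) = -e (-z) * theta τ z := by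
  rw [theta_eq_jacobiTheta₂, theta_eq_jacobiTheta₂,
    show z + τ - τ / 2 + 1 / 2 = (z - τ / 2 + 1 / 2) + τ by ring, jacobiTheta₂_add_left']
  congr 1
  rw [neg_eq_neg_one_mul (e _), ← e_half, ← e_add, ← e_add_int (1 / 2 + -z) (-1), e]
  congr 1
  push_cast
  ring

lemma theta_neg (τ z : ℂ) : theta τ (-z) = -e (-z) * theta τ z := by
  rw [← theta_add_tau, theta_eq_jacobiTheta₂, theta_eq_jacobiTheta₂, ← jacobiTheta₂_neg_left,
    ← jacobiTheta₂_add_left]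
  ring_nf

lemma theta_zero (τ : ℂ) : theta τ 0 = 0 := by
  have h := theta_neg τ 0
  simp only [neg_zero, e_zero] at h
  linear_combination h / 2

lemma theta_add_int (τ z : ℂ) (j : ℤ) : theta τ (z + j) = theta τ z := by
  induction j using Int.induction_on generalizing z with
  | zero => simp
  | succ j ih => rw [← ih z, ← theta_add_one τ (z + (j : ℤ))]; push_cast; ring_nf
  | pred j ih => rw [← ih z, ← theta_add_one τ (z + _)]; push_cast; ring_nf

lemma theta_add_int_mul_tau (τ z : ℂ) (j : ℤ) :
    theta τ (z + j * τ) = e (j / 2 - j * z - j * (j - 1) / 2 * τ) * theta τ z := by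
  have key : ∀ z, theta τ (z + τ) = e (1 / 2 - z) * theta τ z := fun z => by
    rw [theta_add_tau, sub_eq_add_neg, e_add, e_half]; ring
  induction j using Int.induction_on with
  | zero => simp
  | succ j ih =>
    have := key (z + (j : ℤ) * τ)
    rw [ih, ← mul_assoc, ← e_add] at this
    rw [show z + (((j : ℤ) + 1 : ℤ) : ℂ) * τ = z + (j : ℤ) * τ + τ by push_cast; ring, this]
    congr 2
    push_cast
    ring
  | pred j ih =>
    have := key (z + ((-(j : ℤ) - 1 : ℤ) : ℂ) * τ)
    rw [show z + ((-(j : ℤ) - 1 : ℤ) : ℂ) * τ + τ = z + ((-(j : ℤ) : ℤ) : ℂ) * τ by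
      push_cast; ring, ih] at this
    rw [← mul_right_inj' (e_ne_zero (1 / 2 - (z + ((-(j : ℤ) - 1 : ℤ) : ℂ) * τ))), ← this,
      ← mul_assoc, ← e_add]
    congr 2
    push_cast
    ring

lemma theta_eq_zero_of_mem {z : ℂ} (hz : z ∈ lattice τ) : theta τ z = 0 := by
  obtain ⟨i, j, rfl⟩ := mem_lattice.1 hz
  rw [theta_add_int_mul_tau, show (i : ℂ) = 0 + i by ring, theta_add_int, theta_zero, mul_zero]

/-! ### The zeros of `θ` -/

lemma integral_e_int_mul {a : ℤ} (ha : a ≠ 0) : ∫ x : ℝ in (0 : ℝ)..1, e (a * x) = 0 := by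
  have h : (2 * (Real.pi : ℂ) * Complex.I * a) ≠ 0 :=
    mul_ne_zero Complex.two_pi_I_ne_zero (by exact_mod_cast ha)
  have := integral_exp_mul_complex (a := 0) (b := 1) h
  simp only [e]
  simp only [← mul_assoc]
  rw [this]
  have h1 := e_int a
  rw [e] at h1
  simp [h1]

/-- Integrating the absolutely convergent series term by term over [0, 1] leaves only the term a =
0, which equals 1. -/
lemma exists_theta_ne_zero (hτ : 0 < τ.im) : ∃ z, theta τ z ≠ 0 := by
  by_contra! h0
  let F : ℤ → ℝ → ℂ := fun a x =>
    (-1 : ℂ) ^ a * e ((a : ℂ) * x + (a : ℂ) * ((a : ℂ) - 1) / 2 * τ)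
  have hcont : ∀ a, Continuous (F a) := fun a => by fun_prop
  have hnorm : ∀ a x, ‖F a x‖ = ‖F a 0‖ := fun a x => by
    simp only [F, norm_mul, norm_e]; simp
  have hsum : Summable fun a => ‖F a 0‖ := by
    refine Summable.congr ((summable_jacobiTheta₂_term_iff (0 - τ / 2 + 1 / 2) τ).2 hτ).norm
      fun a => ?_
    rw [← theta_term_eq]; simp [F]
  have H := MeasureTheory.hasSum_integral_of_summable_integral_norm
    (μ := MeasureTheory.volume.restrict (Set.Ioc (0 : ℝ) 1)) (F := F)
    (fun a => ((hcont a).integrableOn_Icc.mono_set Set.Ioc_subset_Icc_self))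
    (by simpa [hnorm] using hsum)
  have hz : ∀ x : ℝ, ∑' a, F a x = 0 := fun x => h0 x
  simp only [hz, MeasureTheory.integral_zero] at H
  have hval : ∀ a, ∫ x in Set.Ioc (0 : ℝ) 1, F a x = if a = 0 then 1 else 0 := fun a => by
    rw [← intervalIntegral.integral_of_le zero_le_one]
    split_ifs with ha
    · simp [F, ha]
    · simp only [F, e_add, ← mul_assoc, intervalIntegral.integral_mul_const,
        intervalIntegral.integral_const_mul, integral_e_int_mul ha, mul_zero, zero_mul]
  simp only [hval] at H
  exact zero_ne_one (H.unique (hasSum_ite_eq 0 1))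

/-- The product `∏_{m ≥ 0} (1 - e(z + m τ))`. -/
noncomputable def halfProd (τ z : ℂ) : ℂ := ∏' m : ℕ, (1 + -e (z + m * τ))

lemma norm_e_tau_lt_one (hτ : 0 < τ.im) : ‖e τ‖ < 1 := by
  rw [norm_e, Real.exp_lt_one_iff]
  have := mul_pos Real.two_pi_pos hτ
  linarith

lemma norm_e_add_nat_mul (z : ℂ) (m : ℕ) : ‖e (z + m * τ)‖ = ‖e z‖ * ‖e τ‖ ^ m := by
  rw [e_add, norm_mul, e_nat_mul, norm_pow]

lemma summable_halfProd (hτ : 0 < τ.im) (z : ℂ) : Summable fun m : ℕ => ‖-e (z + m * τ)‖ := by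
  simp only [norm_neg, norm_e_add_nat_mul]
  exact (summable_geometric_of_lt_one (norm_nonneg _) (norm_e_tau_lt_one hτ)).mul_left _

lemma differentiable_halfProd (hτ : 0 < τ.im) : Differentiable ℂ (halfProd τ) := by
  have h : HasProdLocallyUniformlyOn (fun (m : ℕ) z => 1 + -e (z + m * τ)) (halfProd τ)
      Set.univ := by
    apply hasProdLocallyUniformlyOn_of_forall_compact isOpen_univ
    intro K _ hK
    obtain ⟨C, hC⟩ := hK.exists_bound_of_continuousOn (f := e) continuous_e.continuousOn
    refine Summable.hasProdUniformlyOn_nat_one_add hK (u := fun m => C * ‖e τ‖ ^ m)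
      ((summable_geometric_of_lt_one (norm_nonneg _) (norm_e_tau_lt_one hτ)).mul_left _)
      (.of_forall fun m z hz => ?_) (fun m => by fun_prop)
    rw [norm_neg, norm_e_add_nat_mul]
    exact mul_le_mul_of_nonneg_right (hC z hz) (by positivity)
  have := h.differentiableOn (.of_forall fun s => ?_) isOpen_univ
  · exact fun z => (this z (Set.mem_univ z)).differentiableAt Filter.univ_mem
  · exact DifferentiableOn.fun_finsetProd fun _ _ => by fun_prop

lemma halfProd_add_one (τ z : ℂ) : halfProd τ (z + 1) = halfProd τ z :=
  tprod_congr fun m => by rw [add_right_comm, e_add _ 1, e_one, mul_one]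

lemma halfProd_eq (hτ : 0 < τ.im) (z : ℂ) :
    halfProd τ z = (1 - e z) * halfProd τ (z + τ) := by
  have h : Multipliable fun m : ℕ => 1 + -e (z + (m + 1 : ℕ) * τ) := by
    refine (multipliable_one_add_of_summable (summable_halfProd hτ (z + τ))).congr fun m => ?_
    push_cast
    ring_nf
  have h0 : halfProd τ z = (1 + -e (z + (0 : ℕ) * τ)) *
      ∏' m : ℕ, (1 + -e (z + (m + 1 : ℕ) * τ)) :=
    tprod_eq_zero_mul' (f := fun m : ℕ => 1 + -e (z + m * τ)) h
  have h1 : ∏' m : ℕ, (1 + -e (z + (m + 1 : ℕ) * τ)) = halfProd τ (z + τ) :=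
    tprod_congr fun m => by push_cast; ring_nf
  rw [h0, h1]
  simp [sub_eq_add_neg]

lemma halfProd_eq_zero_iff (hτ : 0 < τ.im) {z : ℂ} :
    halfProd τ z = 0 ↔ ∃ m : ℕ, e (z + m * τ) = 1 := by
  constructor
  · intro h
    by_contra! hne
    exact tprod_one_add_ne_zero_of_summable (f := fun m : ℕ => -e (z + m * τ))
      (fun m => by rw [← sub_eq_add_neg]; exact sub_ne_zero.2 (hne m).symm)
      (summable_halfProd hτ z) h
  · rintro ⟨m, hm⟩
    exact tprod_of_exists_eq_zero ⟨m, by rw [hm]; ring⟩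

/-- The product `∏_{m ≥ 0} (1 - e(z + m τ)) (1 - e(-z + (m + 1) τ))`. -/
noncomputable def thetaProd (τ z : ℂ) : ℂ := halfProd τ z * halfProd τ (τ - z)

lemma differentiable_thetaProd (hτ : 0 < τ.im) : Differentiable ℂ (thetaProd τ) := by
  have := differentiable_halfProd hτ
  unfold thetaProd
  fun_prop

lemma thetaProd_add_one (τ z : ℂ) : thetaProd τ (z + 1) = thetaProd τ z := by
  rw [thetaProd, thetaProd, halfProd_add_one, ← halfProd_add_one τ (τ - (z + 1))]
  ring_nf

lemma thetaProd_eq (hτ : 0 < τ.im) (z : ℂ) :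
    thetaProd τ z = (1 - e z) * (halfProd τ (z + τ) * halfProd τ (τ - z)) := by
  rw [thetaProd, halfProd_eq hτ, mul_assoc]

lemma thetaProd_add_tau (hτ : 0 < τ.im) (z : ℂ) :
    thetaProd τ (z + τ) = -e (-z) * thetaProd τ z := by
  rw [thetaProd_eq hτ z, thetaProd, show τ - (z + τ) = -z by ring, halfProd_eq hτ (-z),
    show -z + τ = τ - z by ring]
  have : e (-z) * e z = 1 := by rw [← e_add]; simp
  linear_combination (-halfProd τ (z + τ) * halfProd τ (τ - z)) * this

lemma thetaProd_eq_zero_iff (hτ : 0 < τ.im) {z : ℂ} : thetaProd τ z = 0 ↔ z ∈ lattice τ := by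
  rw [thetaProd, mul_eq_zero, halfProd_eq_zero_iff hτ, halfProd_eq_zero_iff hτ, mem_lattice]
  simp only [e_eq_one_iff]
  constructor
  · rintro (⟨m, i, h⟩ | ⟨m, i, h⟩)
    · exact ⟨i, -m, by push_cast; linear_combination h⟩
    · exact ⟨-i, m + 1, by push_cast; linear_combination -h⟩
  · rintro ⟨i, j, rfl⟩
    rcases le_or_gt j 0 with hj | hj
    · refine Or.inl ⟨(-j).toNat, i, ?_⟩
      have : (((-j).toNat : ℤ) : ℂ) = -j := by rw [Int.toNat_of_nonneg (by omega)]; push_cast; rfl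
      rw [← Int.cast_natCast, this]; ring
    · refine Or.inr ⟨(j - 1).toNat, -i, ?_⟩
      have : (((j - 1).toNat : ℤ) : ℂ) = j - 1 := by
        rw [Int.toNat_of_nonneg (by omega)]; push_cast; rfl
      rw [← Int.cast_natCast, this]; push_cast; ring

lemma halfProd_tau_ne_zero (hτ : 0 < τ.im) : halfProd τ τ ≠ 0 := by
  rw [Ne, halfProd_eq_zero_iff hτ]
  rintro ⟨m, hm⟩
  obtain ⟨i, hi⟩ := e_eq_one_iff.1 hm
  have := congrArg Complex.im hi
  simp at this
  have h2 : (1 + (m : ℝ)) * τ.im = 0 := by linarith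
  exact (mul_pos (by positivity) hτ).ne' h2

lemma exists_hasDerivAt_thetaProd (hτ : 0 < τ.im) :
    ∃ c : ℂ, c ≠ 0 ∧ HasDerivAt (thetaProd τ) c 0 := by
  have hd := differentiable_halfProd hτ
  let R : ℂ → ℂ := fun z => halfProd τ (z + τ) * halfProd τ (τ - z)
  have hR : Differentiable ℂ R := by fun_prop
  have h := ((hasDerivAt_e 0).const_sub 1).mul (hR 0).hasDerivAt
  have hfun : thetaProd τ = (fun z => 1 - e z) * R := funext fun z => thetaProd_eq hτ z
  rw [← hfun] at h
  refine ⟨_, ?_, h⟩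
  have := halfProd_tau_ne_zero hτ
  simp [R, this, Complex.I_ne_zero, Real.pi_ne_zero]

/-- The Jacobi triple product up to a constant, needed for the exact zero set of θ and for θ'(0) ≠
0. The quotient Q is doubly periodic; the product has simple zeros exactly on Γ, where θ vanishes
too, so Q has only removable singularities. -/
lemma exists_theta_eq_mul_thetaProd (hτ : 0 < τ.im) :
    ∃ C : ℂ, C ≠ 0 ∧ ∀ z, theta τ z = C * thetaProd τ z := by
  have hdθ := differentiable_theta hτ
  have hdP := differentiable_thetaProd hτ
  let Q : ℂ → ℂ := fun z => theta τ z / thetaProd τ z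
  have hQ1 : ∀ z, Q (z + 1) = Q z := fun z => by simp only [Q, theta_add_one, thetaProd_add_one]
  have hQ2 : ∀ z, Q (z + τ) = Q z := fun z => by
    simp only [Q, theta_add_tau, thetaProd_add_tau hτ]
    rw [mul_div_mul_left _ _ (neg_ne_zero.2 (e_ne_zero _))]
  have hQ1' : ∀ (i : ℤ) z, Q (z + i) = Q z := by
    intro i z
    simpa using (show Function.Periodic Q 1 from hQ1).int_mul i z
  have hQ2' : ∀ (j : ℤ) z, Q (z + j * τ) = Q z := fun j z =>
    (show Function.Periodic Q τ from hQ2).int_mul j z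
  have h0 : Tendsto (fun z => z * Q z) (𝓝[≠] 0) (𝓝 0) := by
    obtain ⟨c, hc, hd⟩ := exists_hasDerivAt_thetaProd hτ
    have h1 := hd.tendsto_slope_zero
    have hP0 : thetaProd τ 0 = 0 := (thetaProd_eq_zero_iff hτ).2 (zero_mem _)
    simp only [zero_add, hP0, sub_zero, smul_eq_mul] at h1
    have h2 : Tendsto (theta τ) (𝓝[≠] 0) (𝓝 0) := by
      simpa [theta_zero] using (hdθ.continuous.tendsto 0).mono_left nhdsWithin_le_nhds
    have h3 := h2.mul (h1.inv₀ hc)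
    rw [zero_mul] at h3
    refine h3.congr fun z => ?_
    simp only [Q, mul_inv, inv_inv]
    ring
  obtain ⟨C, s, ⟨hC1, hC2⟩, hC⟩ := meromorphic_eq_exp_of_periodic (ζ := 0) hτ (f := Q)
    (fun z => (hdθ.analyticAt z).meromorphicAt.div (hdP.analyticAt z).meromorphicAt)
    (fun z₀ => by
      by_cases hz : thetaProd τ z₀ = 0
      · obtain ⟨i, j, rfl⟩ := mem_lattice.1 ((thetaProd_eq_zero_iff hτ).1 hz)
        have hmap : Tendsto (fun w : ℂ => w - (i + j * τ)) (𝓝[≠] ((i : ℂ) + j * τ)) (𝓝[≠] 0) := by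
          refine tendsto_nhdsWithin_iff.2 ⟨?_, ?_⟩
          · have : ContinuousAt (fun w : ℂ => w - (i + j * τ)) ((i : ℂ) + j * τ) := by fun_prop
            simpa [ContinuousAt] using this.mono_left nhdsWithin_le_nhds
          · filter_upwards [self_mem_nhdsWithin] with w hw
            simpa [sub_eq_zero] using hw
        refine (h0.comp hmap).congr fun w => ?_
        simp only [Function.comp]
        rw [← hQ1' i, ← hQ2' j, show w - (i + j * τ) + i + j * τ = w by ring]
      · have : ContinuousAt (fun z => (z - z₀) * Q z) z₀ :=
          (by fun_prop : ContinuousAt (fun z => z - z₀) z₀).mul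
            ((hdθ z₀).continuousAt.div (hdP z₀).continuousAt hz)
        simpa [ContinuousAt] using this.mono_left nhdsWithin_le_nhds)
    hQ1 (fun z => by rw [hQ2, e_zero, one_mul])
  have hθ : ∀ z, theta τ z = C * e (s * z) * thetaProd τ z := fun z => by
    by_cases hz : thetaProd τ z = 0
    · rw [hz, mul_zero, theta_eq_zero_of_mem ((thetaProd_eq_zero_iff hτ).1 hz)]
    · rw [← hC z ((hdθ z).continuousAt.div (hdP z).continuousAt hz), div_mul_cancel₀ _ hz]
  have hC0 : C ≠ 0 := by
    rintro rfl
    obtain ⟨z, hz⟩ := exists_theta_ne_zero hτ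
    exact hz (by rw [hθ]; simp)
  -- Since s is real, |e(sτ)| = 1 forces s · Im τ = 0.
  have hs : s = 0 := by
    have h1 := hC2 0
    simp only [zero_add, mul_zero, e_zero, mul_one, one_mul] at h1
    have h2 : e (s * τ) = 1 := mul_left_cancel₀ hC0 (by rw [h1, mul_one])
    have h3 := norm_e (s * τ)
    rw [h2, norm_one, eq_comm, Real.exp_eq_one_iff] at h3
    have h4 : 2 * Real.pi * (s * τ.im) = 0 := by simpa using h3
    rcases mul_eq_zero.1 h4 with h5 | h5
    · exact absurd h5 Real.two_pi_pos.ne'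
    · exact (mul_eq_zero.1 h5).resolve_right hτ.ne'
  exact ⟨C, hC0, fun z => by rw [hθ z, hs]; simp⟩

lemma theta_eq_zero_iff (hτ : 0 < τ.im) {z : ℂ} : theta τ z = 0 ↔ z ∈ lattice τ := by
  obtain ⟨C, hC, h⟩ := exists_theta_eq_mul_thetaProd hτ
  rw [h, mul_eq_zero, or_iff_right hC, thetaProd_eq_zero_iff hτ]

lemma deriv_theta_zero_ne_zero (hτ : 0 < τ.im) : deriv (theta τ) 0 ≠ 0 := by
  obtain ⟨C, hC, h⟩ := exists_theta_eq_mul_thetaProd hτ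
  obtain ⟨c, hc, hd⟩ := exists_hasDerivAt_thetaProd hτ
  rw [show theta τ = fun z => C * thetaProd τ z from funext h, (hd.const_mul C).deriv]
  exact mul_ne_zero hC hc

end Theta

/-! ### Continuants -/

section Continuant

/-- The tridiagonal matrix with diagonal `f` and `-1` next to the diagonal. -/
def triMatrix {N : ℕ} (f : Fin N → ℤ) : Matrix (Fin N) (Fin N) ℤ :=
  Matrix.of fun i j =>
    if i = j then f i else if i.val + 1 = j.val ∨ j.val + 1 = i.val then -1 else 0

lemma triMatrix_submatrix_succ {N : ℕ} (f : Fin (N + 1) → ℤ) :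
    (triMatrix f).submatrix Fin.succ Fin.succ = triMatrix fun i => f i.succ := by
  ext i j
  simp [triMatrix]

/-- Expansion along the first row: only columns 0 and 1 contribute, and the first column of the
second minor has a single nonzero entry -1. -/
lemma det_triMatrix_succ_succ {N : ℕ} (f : Fin (N + 2) → ℤ) :
    (triMatrix f).det = f 0 * (triMatrix fun i => f i.succ).det
      - (triMatrix fun i => f i.succ.succ).det := by
  rw [Matrix.det_succ_row_zero, Fin.sum_univ_succ, Fin.sum_univ_succ, Finset.sum_eq_zero]
  · have h1 : (triMatrix f).submatrix Fin.succ (Fin.succAbove 0) =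
        triMatrix fun i => f i.succ := by
      rw [Fin.succAbove_zero, triMatrix_submatrix_succ]
    have h2 : ((triMatrix f).submatrix Fin.succ (Fin.succAbove (Fin.succ 0))).det =
        -(triMatrix fun i => f i.succ.succ).det := by
      rw [Matrix.det_succ_column_zero, Fin.sum_univ_succ, Finset.sum_eq_zero]
      · have h3 : ((triMatrix f).submatrix Fin.succ (Fin.succAbove (Fin.succ 0))).submatrix
            (Fin.succAbove 0) Fin.succ = triMatrix fun i => f i.succ.succ := by
          ext i j
          simp [triMatrix, Matrix.submatrix_apply, Fin.succAbove, Fin.lt_def]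
        rw [h3]
        simp [triMatrix, Fin.succAbove, Fin.ext_iff]
      · intro i _
        simp [triMatrix, Fin.succAbove, Fin.ext_iff]
    rw [h1, h2]
    simp [triMatrix, Fin.ext_iff]
    ring
  · intro j _
    simp [triMatrix, Fin.ext_iff]

lemma d_nil : d [] = 1 := by simp [d]

lemma d_singleton (a : ℕ) : d [a] = a := by
  have : (tridiag [a]).det = tridiag [a] (0 : Fin 1) (0 : Fin 1) := Matrix.det_fin_one (tridiag [a])
  rw [d, this]
  simp [tridiag]

lemma d_cons_cons (a b : ℕ) (l : List ℕ) : d (a :: b :: l) = a * d (b :: l) - d l :=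
  det_triMatrix_succ_succ fun i => ((a :: b :: l).get i : ℤ)

/-- The recursion read from the right end. The recursion on the left is of second order, hence the
two base cases. -/
lemma d_append_pair (b a : ℕ) : ∀ l : List ℕ, d (l ++ [b, a]) = a * d (l ++ [b]) - d l
  | [] => by simp [d_cons_cons, d_singleton, d_nil]; ring
  | [c] => by simp [d_cons_cons, d_singleton, d_nil]; ring
  | c :: c' :: l => by
    have h1 := d_append_pair b a (c' :: l)
    have h2 := d_append_pair b a l
    simp only [List.cons_append] at h1 ⊢
    rw [d_cons_cons, d_cons_cons, d_cons_cons, h1, h2]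
    ring

/-- Monotonicity keeps the induction going: for a ≥ 2 and d(l) ≤ d(b, l), one has a·d(b, l) - d(l) ≥
d(b, l) > 0. -/
lemma d_pos_and_lt : ∀ l : List ℕ, (∀ x ∈ l, 2 ≤ x) → 0 < d l ∧ d l.tail ≤ d l
  | [], _ => by simp [d_nil]
  | [a], h => by
    have : (2 : ℤ) ≤ a := by exact_mod_cast h a (by simp)
    simp only [d_singleton, List.tail_cons, d_nil]
    omega
  | a :: b :: l, h => by
    obtain ⟨h1, h2⟩ := d_pos_and_lt (b :: l) fun x hx => h x (List.mem_cons_of_mem _ hx)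
    have ha : (2 : ℤ) ≤ a := by exact_mod_cast h a (by simp)
    simp only [List.tail_cons, d_cons_cons] at h2 ⊢
    constructor <;> nlinarith

lemma d_pos {l : List ℕ} (h : ∀ x ∈ l, 2 ≤ x) : 0 < d l := (d_pos_and_lt l h).1

lemma isCoprime_d : ∀ l : List ℕ, l ≠ [] → IsCoprime (d l) (d l.tail)
  | [], h => absurd rfl h
  | [a], _ => by simpa [d_nil] using isCoprime_one_right
  | a :: b :: l, _ => by
    obtain ⟨x, y, h⟩ := isCoprime_d (b :: l) (by simp)
    refine ⟨-y, x + a * y, ?_⟩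
    simp only [List.tail_cons, d_cons_cons] at h ⊢
    linear_combination h

lemma cfValue_eq : ∀ l : List ℕ, l ≠ [] → (∀ x ∈ l, 2 ≤ x) →
    cfValue l = (d l : ℚ) / (d l.tail : ℚ)
  | [], h, _ => absurd rfl h
  | [a], _, _ => by simp [cfValue, d_singleton, d_nil]
  | a :: b :: l, _, h => by
    have hb : ∀ x ∈ b :: l, 2 ≤ x := fun x hx => h x (List.mem_cons_of_mem _ hx)
    have h1 : (d (b :: l) : ℚ) ≠ 0 := by exact_mod_cast (d_pos hb).ne'
    rw [cfValue, cfValue_eq (b :: l) (by simp) hb]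
    simp only [List.tail_cons, d_cons_cons]
    push_cast
    rw [one_div_div]
    field_simp

end Continuant

/-! ### The two solutions of the tridiagonal recursion -/

section Sequences

variable {p : ℕ} (m : Fin (p + 1) → ℕ)

/-- The continuants of the final segments, extended by `0`. -/
noncomputable def contAfter (j : ℕ) : ℤ := if j ≤ p + 1 then d ((List.ofFn m).drop j) else 0

/-- The continuants of the initial segments, preceded by `0`. -/
noncomputable def contBefore : ℕ → ℤ
  | 0 => 0
  | j + 1 => d ((List.ofFn m).take j)

lemma dAfter_eq (i : Fin (p + 1)) : dAfter m i = contAfter m (i + 1) := by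
  rw [contAfter, if_pos (by omega), dAfter]

lemma dBefore_eq (i : Fin (p + 1)) : dBefore m i = contBefore m (i + 1) := rfl

lemma contAfter_last : contAfter m (p + 1) = 1 := by
  rw [contAfter, if_pos le_rfl, List.drop_eq_nil_of_le (by simp), d_nil]

lemma contAfter_last_succ : contAfter m (p + 2) = 0 := by
  rw [contAfter, if_neg (by omega)]

lemma contBefore_one : contBefore m 1 = 1 := by simp [contBefore, d_nil]

lemma drop_ofFn (i : Fin (p + 1)) :
    (List.ofFn m).drop i = m i :: (List.ofFn m).drop (i + 1) := by
  rw [List.drop_eq_getElem_cons (by rw [List.length_ofFn]; exact i.2), List.getElem_ofFn]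

lemma contAfter_rec (i : Fin (p + 1)) :
    contAfter m i = m i * contAfter m (i + 1) - contAfter m (i + 2) := by
  by_cases hi : i.val = p
  · have h1 : contAfter m (i + 1) = 1 := by rw [hi, contAfter_last]
    have h2 : contAfter m (i + 2) = 0 := by rw [hi, contAfter_last_succ]
    rw [h1, h2, contAfter, if_pos (by omega), drop_ofFn, List.drop_eq_nil_of_le (by simp; omega),
      d_singleton]
    ring
  · have hlt : i.val + 1 < p + 1 := by omega
    have h := drop_ofFn m ⟨i + 1, hlt⟩
    simp only at h
    rw [contAfter, contAfter, contAfter, if_pos (by omega), if_pos (by omega), if_pos (by omega),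
      drop_ofFn, h, d_cons_cons]

lemma take_ofFn (i : Fin (p + 1)) :
    (List.ofFn m).take (i + 1) = (List.ofFn m).take i ++ [m i] := by
  rw [List.take_succ_eq_append_getElem (by rw [List.length_ofFn]; exact i.2), List.getElem_ofFn]

lemma contBefore_rec (i : Fin (p + 1)) :
    contBefore m (i + 2) = m i * contBefore m (i + 1) - contBefore m i := by
  obtain ⟨i, hi⟩ := i
  cases i with
  | zero =>
    have h := take_ofFn m ⟨0, hi⟩
    simp only at h
    simp only [contBefore, h, List.take_zero, List.nil_append, d_singleton, d_nil]
    simp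
  | succ i =>
    have h1 := take_ofFn m ⟨i + 1, hi⟩
    have h2 := take_ofFn m ⟨i, by omega⟩
    simp only at h1 h2
    simp only [contBefore]
    rw [h1, h2, List.append_assoc]
    exact d_append_pair _ _ _

/-- The Casoratian of the two solutions is constant. -/
lemma casoratian (j : ℕ) (hj : j ≤ p + 1) :
    contAfter m j * contBefore m (j + 1) - contAfter m (j + 1) * contBefore m j =
      contAfter m 0 := by
  induction j with
  | zero => simp [contBefore, d_nil]
  | succ j ih =>
    have h1 := contAfter_rec m ⟨j, by omega⟩
    have h2 := contBefore_rec m ⟨j, by omega⟩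
    simp only at h1 h2
    rw [← ih (by omega), h1, h2]
    ring

variable {m}

lemma contAfter_pos (hm : ∀ i, 2 ≤ m i) {j : ℕ} (hj : j ≤ p + 1) : 0 < contAfter m j := by
  rw [contAfter, if_pos hj]
  refine d_pos fun x hx => ?_
  obtain ⟨i, rfl⟩ := (List.mem_ofFn' m x).1 (List.mem_of_mem_drop hx)
  exact hm i

/-- The continued fraction has value A_0/A_1. This fraction and n/(n-k) are both reduced with
positive terms, so numerators and denominators agree. -/
lemma contAfter_eq_of_isCFExpansion {n k : ℕ} (hkn : k < n) (hcop : Nat.Coprime n k)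
    (hm : IsCFExpansion ((n : ℚ) / ((n : ℚ) - (k : ℚ))) m) :
    contAfter m 0 = n ∧ contAfter m 1 = (n - k : ℕ) := by
  have h0 := contAfter_pos hm.1 (Nat.zero_le (p + 1))
  have h1 := contAfter_pos hm.1 (show 1 ≤ p + 1 by omega)
  have hne : List.ofFn m ≠ [] := by simp
  have h2 : ∀ x ∈ List.ofFn m, 2 ≤ x := fun x hx => by
    obtain ⟨i, rfl⟩ := (List.mem_ofFn' m x).1 hx
    exact hm.1 i
  have hcf := hm.2
  rw [cfValue_eq _ hne h2] at hcf
  have hc := isCoprime_d _ hne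
  have e0 : contAfter m 0 = d (List.ofFn m) := by rw [contAfter, if_pos (by omega), List.drop_zero]
  have e1 : contAfter m 1 = d (List.ofFn m).tail := by
    rw [contAfter, if_pos (by omega), List.drop_one]
  rw [← e0, ← e1] at hcf hc
  rw [← Nat.cast_sub hkn.le] at hcf
  have hnk : 0 < n - k := by omega
  have hc2 : IsCoprime ((n : ℤ)) ((n - k : ℕ) : ℤ) := by
    rw [Nat.isCoprime_iff_coprime]
    exact ((Nat.coprime_self_sub_right hkn.le).2 hcop)
  rw [div_eq_div_iff (by exact_mod_cast h1.ne') (by exact_mod_cast hnk.ne')] at hcf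
  have hmul : contAfter m 0 * ((n - k : ℕ) : ℤ) = n * contAfter m 1 := by exact_mod_cast hcf
  have hA : contAfter m 0 ∣ n := hc.dvd_of_dvd_mul_right ⟨_, hmul.symm⟩
  have hB : (n : ℤ) ∣ contAfter m 0 := hc2.dvd_of_dvd_mul_right ⟨_, hmul⟩
  have hC : contAfter m 0 = n := Int.dvd_antisymm h0.le (by positivity) hA hB
  refine ⟨hC, ?_⟩
  rw [hC] at hmul
  exact (mul_left_cancel₀ (by have : 0 < n := by omega
                              exact_mod_cast this.ne') hmul).symm

end Sequences

/-! ### Automorphy of theta functions of several variables -/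

section Automorphic

variable {ι : Type*}

/-- An integer vector as a complex vector. -/
def icast (l : ι → ℤ) : ι → ℂ := fun i => (l i : ℂ)

@[simp] lemma icast_zero : icast (0 : ι → ℤ) = 0 := by ext; simp [icast]

@[simp] lemma icast_add (l l' : ι → ℤ) : icast (l + l') = icast l + icast l' := by
  ext; simp [icast]

@[simp] lemma icast_neg (l : ι → ℤ) : icast (-l) = -icast l := by ext; simp [icast]

lemma icast_single [DecidableEq ι] (i : ι) : icast (Pi.single i 1 : ι → ℤ) = Pi.single i 1 := by
  ext j; by_cases h : j = i
  · subst h; simp [icast]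
  · simp [icast, h]

lemma exists_int_dotProduct_icast [Fintype ι] (l l' : ι → ℤ) : ∃ j : ℤ, icast l ⬝ᵥ icast l' = j :=
  ⟨l ⬝ᵥ l', by simp [dotProduct, icast]⟩

/-- The exponent in the quasi-periodicity of a theta function with quadratic form `S`. -/
noncomputable def autExp [Fintype ι] (τ : ℂ) (S : Matrix ι ι ℂ) (γ : ι → ℂ) (l : ι → ℤ) (z : ι → ℂ) : ℂ :=
  icast l ⬝ᵥ γ - icast l ⬝ᵥ (S *ᵥ z) - τ / 2 * (icast l ⬝ᵥ (S *ᵥ icast l))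

/-- Periodicity under `ℤ^ι` and quasi-periodicity under `τ ℤ^ι`. -/
structure IsAutomorphic [Fintype ι] (τ : ℂ) (S : Matrix ι ι ℂ) (γ : ι → ℂ) (f : (ι → ℂ) → ℂ) : Prop where
  add_int : ∀ l z, f (z + icast l) = f z
  add_tau : ∀ l z, f (z + τ • icast l) = e (autExp τ S γ l z) * f z

/-- The cocycle identity; symmetry of S merges the two cross terms into one τ l'·Sl. -/
lemma autExp_add [Fintype ι] {S : Matrix ι ι ℂ} (hS : S.IsSymm) (τ : ℂ) (γ : ι → ℂ) (l l' : ι → ℤ)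
    (z : ι → ℂ) :
    autExp τ S γ (l + l') z = autExp τ S γ l' (z + τ • icast l) + autExp τ S γ l z := by
  have h : icast l ⬝ᵥ (S *ᵥ icast l') = icast l' ⬝ᵥ (S *ᵥ icast l) := by
    rw [dotProduct_mulVec, dotProduct_comm, ← mulVec_transpose, hS.eq]
  simp only [autExp, icast_add, mulVec_add, mulVec_smul, dotProduct_add, add_dotProduct,
    dotProduct_smul, smul_eq_mul, h]
  ring

/-- The integer vectors satisfying either law form a subgroup of ℤ^ι, by the cocycle identity in the
case of τ, and a subgroup containing the unit vectors is everything. -/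
lemma IsAutomorphic.of_single [Fintype ι] [DecidableEq ι] {τ : ℂ} {S : Matrix ι ι ℂ} (hS : S.IsSymm) {γ : ι → ℂ}
    {f : (ι → ℂ) → ℂ} (h1 : ∀ i z, f (z + Pi.single i 1) = f z)
    (h2 : ∀ i z, f (z + τ • Pi.single i 1) = e (γ i - (S *ᵥ z) i - τ / 2 * S i i) * f z) :
    IsAutomorphic τ S γ f := by
  let H₁ : AddSubgroup (ι → ℤ) :=
    { carrier := {l | ∀ z, f (z + icast l) = f z}
      zero_mem' := fun z => by simp
      add_mem' := fun {l l'} hl hl' z => by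
        rw [icast_add, ← add_assoc, hl', hl]
      neg_mem' := fun {l} hl z => by
        rw [← hl]; simp }
  let H₂ : AddSubgroup (ι → ℤ) :=
    { carrier := {l | ∀ z, f (z + τ • icast l) = e (autExp τ S γ l z) * f z}
      zero_mem' := fun z => by simp [autExp]
      add_mem' := fun {l l'} hl hl' z => by
        rw [icast_add, smul_add, ← add_assoc, hl', hl, autExp_add hS, e_add, mul_assoc]
      neg_mem' := fun {l} hl z => by
        have h := hl (z + τ • icast (-l))
        have h3 := autExp_add hS τ γ (-l) l z
        rw [neg_add_cancel, show autExp τ S γ 0 z = 0 by simp [autExp]] at h3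
        rw [show z + τ • icast (-l) + τ • icast l = z by simp] at h
        rw [h, ← mul_assoc, ← e_add, add_comm (autExp _ _ _ _ _), ← h3, e_zero, one_mul] }
  have top : ∀ H : AddSubgroup (ι → ℤ), (∀ i, Pi.single i 1 ∈ H) → ∀ l, l ∈ H := by
    intro H hH l
    rw [← Finset.univ_sum_single l]
    refine H.sum_mem fun i _ => ?_
    have := H.zsmul_mem (hH i) (l i)
    rwa [← Pi.single_smul, smul_eq_mul, mul_one] at this
  refine ⟨fun l z => top H₁ (fun i z => ?_) l z, fun l z => top H₂ (fun i z => ?_) l z⟩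
  · rw [icast_single, h1]
  · rw [icast_single, h2]
    congr 2
    simp [autExp, icast_single]

lemma IsAutomorphic.mul [Fintype ι] {τ : ℂ} {S S' : Matrix ι ι ℂ} {γ γ' : ι → ℂ} {f f' : (ι → ℂ) → ℂ}
    (h : IsAutomorphic τ S γ f) (h' : IsAutomorphic τ S' γ' f') :
    IsAutomorphic τ (S + S') (γ + γ') fun z => f z * f' z := by
  refine ⟨fun l z => by rw [h.add_int, h'.add_int], fun l z => ?_⟩
  rw [h.add_tau, h'.add_tau, mul_mul_mul_comm, ← e_add]
  congr 2
  simp only [autExp, add_mulVec, dotProduct_add]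
  ring

lemma IsAutomorphic.one [Fintype ι] (τ : ℂ) : IsAutomorphic τ (0 : Matrix ι ι ℂ) 0 fun _ => 1 :=
  ⟨fun _ _ => rfl, fun l z => by simp [autExp]⟩

lemma IsAutomorphic.prod [Fintype ι] {κ : Type*} {τ : ℂ} (s : Finset κ) {S : κ → Matrix ι ι ℂ}
    {γ : κ → ι → ℂ} {f : κ → (ι → ℂ) → ℂ} (h : ∀ a ∈ s, IsAutomorphic τ (S a) (γ a) (f a)) :
    IsAutomorphic τ (∑ a ∈ s, S a) (∑ a ∈ s, γ a) fun z => ∏ a ∈ s, f a z := by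
  classical
  induction s using Finset.induction_on with
  | empty => simpa using IsAutomorphic.one τ
  | insert a s ha ih =>
    simp only [Finset.sum_insert ha, Finset.prod_insert ha]
    exact (h a (Finset.mem_insert_self a s)).mul
      (ih fun b hb => h b (Finset.mem_insert_of_mem hb))

lemma IsAutomorphic.pow [Fintype ι] {τ : ℂ} {S : Matrix ι ι ℂ} {γ : ι → ℂ} {f : (ι → ℂ) → ℂ}
    (h : IsAutomorphic τ S γ f) (N : ℕ) :
    IsAutomorphic τ (N • S) (N • γ) fun z => f z ^ N := by
  simpa using IsAutomorphic.prod (Finset.range N) (fun _ _ => h)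

lemma IsAutomorphic.translate [Fintype ι] {τ : ℂ} {S : Matrix ι ι ℂ} {γ : ι → ℂ} {f : (ι → ℂ) → ℂ}
    (h : IsAutomorphic τ S γ f) (s : ι → ℂ) :
    IsAutomorphic τ S (γ - S *ᵥ s) fun z => f (z + s) := by
  refine ⟨fun l z => by rw [add_right_comm, h.add_int], fun l z => ?_⟩
  rw [add_right_comm, h.add_tau]
  congr 2
  simp only [autExp, mulVec_add, dotProduct_add, dotProduct_sub]
  ring

/-- `θ` of an integral linear form. -/
lemma isAutomorphic_theta [Fintype ι] (τ : ℂ) (c : ι → ℤ) :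
    IsAutomorphic τ (vecMulVec (icast c) (icast c)) (((1 + τ) / 2) • icast c)
      fun z => theta τ (icast c ⬝ᵥ z) := by
  refine ⟨fun l z => ?_, fun l z => ?_⟩
  · obtain ⟨j, hj⟩ := exists_int_dotProduct_icast c l
    rw [dotProduct_add, hj, theta_add_int]
  · obtain ⟨j, hj⟩ := exists_int_dotProduct_icast c l
    have hj' : icast l ⬝ᵥ icast c = j := by rw [dotProduct_comm, hj]
    rw [dotProduct_add, dotProduct_smul, hj, smul_eq_mul, mul_comm τ, theta_add_int_mul_tau]
    congr 2
    simp only [autExp, vecMulVec_mulVec, dotProduct_smul, hj, hj', smul_eq_mul, op_smul_eq_mul]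
    ring

end Automorphic

/-! ### The space `Θ` -/

section ThetaSpace

variable {p : ℕ} (m : Fin (p + 1) → ℕ) (τ : ℂ)

/-- The tridiagonal matrix as a complex matrix. -/
def cfMatrix : Matrix (Fin (p + 1)) (Fin (p + 1)) ℂ :=
  Matrix.of fun i j =>
    if i = j then (m i : ℂ) else if i.val + 1 = j.val ∨ j.val + 1 = i.val then -1 else 0

lemma cfMatrix_isSymm : (cfMatrix m).IsSymm := by
  ext i j
  simp only [cfMatrix, transpose_apply, of_apply]
  by_cases h : i = j
  · subst h; rfl
  · rw [if_neg h, if_neg (Ne.symm h)]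
    simp only [or_comm]

lemma coord_eq_sum (z : Fin (p + 1) → ℂ) (j : ℕ) :
    coord z j = ∑ t : Fin (p + 1), if t.val + 1 = j then z t else 0 := by
  cases j with
  | zero => simp [coord]
  | succ j =>
    simp only [coord, add_left_inj]
    by_cases h : j < p + 1
    · rw [dif_pos h, Finset.sum_eq_single ⟨j, h⟩]
      · simp
      · intro b _ hb
        rw [if_neg fun hc => hb (Fin.ext hc)]
      · simp
    · rw [dif_neg h, Finset.sum_eq_zero]
      intro t _
      rw [if_neg (by have := t.2; omega)]

lemma cfMatrix_mulVec (z : Fin (p + 1) → ℂ) (i : Fin (p + 1)) :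
    (cfMatrix m *ᵥ z) i = m i * z i - coord z i - coord z (i + 2) := by
  rw [coord_eq_sum, coord_eq_sum, show (m i : ℂ) * z i =
    ∑ t : Fin (p + 1), if i = t then m i * z t else 0 by simp, ← Finset.sum_sub_distrib, ← Finset.sum_sub_distrib]
  simp only [mulVec, dotProduct]
  refine Finset.sum_congr rfl fun t _ => ?_
  simp only [cfMatrix, of_apply]
  by_cases h : i = t
  · subst h
    simp
  · have h' : i.val ≠ t.val := fun hc => h (Fin.ext hc)
    rw [if_neg h, if_neg h]
    by_cases h1 : t.val + 1 = i.val
    · rw [if_pos (Or.inr h1), if_pos h1, if_neg (by omega)]; ring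
    · by_cases h2 : i.val + 1 = t.val
      · rw [if_pos (Or.inl h2), if_neg h1, if_pos (by omega)]; ring
      · rw [if_neg (by tauto), if_neg h1, if_neg (by omega)]; ring

/-- The linear part of the exponent of quasi-periodicity of `Θ`. -/
noncomputable def thetaGamma (i : Fin (p + 1)) : ℂ :=
  τ / 2 * m i + m i / 2 + ((if i = 0 then 1 else 0) - 1) * τ

lemma thetaFactor_eq (i : Fin (p + 1)) (z : Fin (p + 1) → ℂ) :
    thetaFactor τ m i z =
      e (thetaGamma m τ i - (cfMatrix m *ᵥ z) i - τ / 2 * cfMatrix m i i) := by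
  rw [thetaFactor, neg_one_pow_eq_e, ← e_add, cfMatrix_mulVec]
  congr 1
  simp only [thetaGamma, cfMatrix, of_apply, if_true]
  ring

lemma update_add_eq {ι : Type*} [DecidableEq ι] (z : ι → ℂ) (i : ι) (c : ℂ) :
    Function.update z i (z i + c) = z + c • Pi.single i 1 := by
  ext j
  by_cases h : j = i
  · subst h; simp
  · simp [h]

lemma mem_thetaSpace_iff {f : (Fin (p + 1) → ℂ) → ℂ} :
    f ∈ thetaSpace τ m ↔
      Differentiable ℂ f ∧ IsAutomorphic τ (cfMatrix m) (thetaGamma m τ) f := by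
  constructor
  · rintro ⟨hd, h1, h2⟩
    refine ⟨hd, IsAutomorphic.of_single (cfMatrix_isSymm m) (fun i z => ?_) fun i z => ?_⟩
    · rw [← h1 i z, update_add_eq, one_smul]
    · rw [← thetaFactor_eq, ← h2 i z, update_add_eq]
  · rintro ⟨hd, h⟩
    refine ⟨hd, fun i z => ?_, fun i z => ?_⟩
    · rw [update_add_eq, one_smul, ← icast_single, h.add_int]
    · rw [update_add_eq, ← icast_single, h.add_tau, thetaFactor_eq]
      congr 2
      simp [autExp, icast_single]

end ThetaSpace

/-! ### Fourier coefficients of automorphic functions -/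

/-- Compactness bounds G near s₀ uniformly in x, Cauchy's estimate bounds its derivative by the same
constant, and dominated differentiation under the integral applies. -/
lemma differentiable_integral_of_compact {X : Type*} [TopologicalSpace X] [CompactSpace X]
    [MeasurableSpace X] [OpensMeasurableSpace X] (μ : MeasureTheory.Measure X)
    [MeasureTheory.IsFiniteMeasure μ] {G : ℂ → X → ℂ} (hc : Continuous fun q : X × ℂ => G q.2 q.1)
    (hd : ∀ x, Differentiable ℂ fun s => G s x) :
    Differentiable ℂ fun s => ∫ x, G s x ∂μ := by
  intro s₀
  have hcs : ∀ s, Continuous (G s) := fun s => hc.comp (by fun_prop : Continuous fun x : X => (x, s))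
  obtain ⟨C, hC⟩ := (isCompact_univ.prod (isCompact_closedBall s₀ 2)).exists_bound_of_continuousOn
    (f := fun q : X × ℂ => G q.2 q.1) hc.continuousOn
  have hmeas := stronglyMeasurable_deriv_with_param (𝕜 := ℂ) (f := fun x s => G s x) hc
  have hb : ∀ x, ∀ s ∈ Metric.ball s₀ 1, ‖deriv (fun s => G s x) s‖ ≤ C := by
    intro x s hs
    have := Complex.norm_deriv_le_of_forall_mem_sphere_norm_le (f := fun s => G s x) (c := s)
      one_pos (hd x).diffContOnCl (C := C) fun w hw => hC (x, w) ⟨Set.mem_univ _, ?_⟩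
    · simpa using this
    · rw [Metric.mem_closedBall]
      rw [Metric.mem_ball] at hs
      rw [mem_sphere_iff_norm, ← dist_eq_norm] at hw
      linarith [dist_triangle w s s₀]
  refine (hasDerivAt_integral_of_dominated_loc_of_deriv_le (F' := fun s x =>
    deriv (fun s => G s x) s) (bound := fun _ => C) (Metric.ball_mem_nhds s₀ one_pos)
    (.of_forall fun s => (hcs s).aestronglyMeasurable) ?_ ?_ (.of_forall hb)
    (MeasureTheory.integrable_const C)
    (.of_forall fun x s _ => (hd x s).hasDerivAt)).2.differentiableAt
  · refine MeasureTheory.Integrable.of_bound (hcs s₀).aestronglyMeasurable C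
      (.of_forall fun x => hC (x, s₀) ⟨Set.mem_univ _, by simp⟩)
  · exact (hmeas.comp_measurable (measurable_prodMk_right (y := s₀))).aestronglyMeasurable

section Fourier

open UnitAddTorus MeasureTheory

noncomputable local instance : MeasureSpace UnitAddCircle := ⟨AddCircle.haarAddCircle⟩

local instance : Measure.IsAddHaarMeasure (volume : Measure UnitAddCircle) :=
  inferInstanceAs (Measure.IsAddHaarMeasure AddCircle.haarAddCircle)

local instance : IsProbabilityMeasure (volume : Measure UnitAddCircle) :=
  inferInstanceAs (IsProbabilityMeasure AddCircle.haarAddCircle)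

variable {ι : Type*}

/-- The function `x ↦ f(z + x)` on the torus, for `f` periodic. -/
noncomputable def torusLift (f : (ι → ℂ) → ℂ) (z : ι → ℂ) (x : UnitAddTorus ι) : ℂ :=
  f (z + fun i => ((Quotient.out (x i) : ℝ) : ℂ))

/-- The image of a real vector in the torus. -/
def toTorus (t : ι → ℝ) : UnitAddTorus ι := fun i => (t i : UnitAddCircle)

lemma exists_toTorus_eq (x : UnitAddTorus ι) : ∃ t : ι → ℝ, toTorus t = x :=
  ⟨fun i => Quotient.out (x i), funext fun i => Quotient.out_eq (x i)⟩

lemma torusLift_toTorus {f : (ι → ℂ) → ℂ} (hf : ∀ l z, f (z + icast l) = f z) (z : ι → ℂ)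
    (t : ι → ℝ) : torusLift f z (toTorus t) = f (z + fun i => (t i : ℂ)) := by
  have h : ∀ i, ∃ j : ℤ, Quotient.out (toTorus t i) = t i + j := by
    intro i
    have : ((Quotient.out (toTorus t i) : ℝ) : UnitAddCircle) = (t i : UnitAddCircle) :=
      Quotient.out_eq (toTorus t i)
    rw [← sub_eq_zero, ← AddCircle.coe_sub, AddCircle.coe_eq_zero_iff] at this
    obtain ⟨j, hj⟩ := this
    refine ⟨j, ?_⟩
    rw [zsmul_eq_mul, mul_one] at hj
    linarith
  choose l hl using h
  rw [torusLift, ← hf l (z + fun i => (t i : ℂ))]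
  congr 1
  ext i
  simp [icast, hl, add_assoc]

/-- Continuity is tested after pulling back along the open quotient map from ℝ^ι × ℂ^ι, where
periodicity makes the choice of representatives disappear. -/
lemma continuous_torusLift {f : (ι → ℂ) → ℂ} (hf : ∀ l z, f (z + icast l) = f z)
    (hc : Continuous f) :
    Continuous fun q : UnitAddTorus ι × (ι → ℂ) => torusLift f q.2 q.1 := by
  have h1 : IsOpenQuotientMap (Pi.map fun (_ : ι) (t : ℝ) => (t : UnitAddCircle)) :=
    .piMap fun _ => QuotientAddGroup.isOpenQuotientMap_mk
  have h2 := h1.prodMap (IsOpenQuotientMap.id (X := ι → ℂ))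
  rw [h2.isQuotientMap.continuous_iff]
  have : ((fun q : UnitAddTorus ι × (ι → ℂ) => torusLift f q.2 q.1) ∘
      Prod.map (Pi.map fun (_ : ι) (t : ℝ) => (t : UnitAddCircle)) id) =
      fun q : (ι → ℝ) × (ι → ℂ) => f (q.2 + fun i => (q.1 i : ℂ)) :=
    funext fun q => torusLift_toTorus hf q.2 q.1
  rw [this]
  fun_prop

lemma mFourier_toTorus [Fintype ι] (k : ι → ℤ) (t : ι → ℝ) :
    mFourier k (toTorus t) = e (icast k ⬝ᵥ fun i => (t i : ℂ)) := by
  have h : ∀ s : Finset ι, ∏ i ∈ s, e ((k i : ℂ) * t i) = e (∑ i ∈ s, (k i : ℂ) * t i) := by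
    classical
    intro s
    induction s using Finset.induction_on with
    | empty => simp
    | insert a s ha ih => rw [Finset.prod_insert ha, Finset.sum_insert ha, ih, e_add]
  rw [dotProduct]
  refine Eq.trans ?_ (h Finset.univ)
  refine Finset.prod_congr rfl fun i _ => ?_
  rw [toTorus, fourier_coe_apply, e]
  simp [mul_assoc]

/-- The Fourier coefficients of `x ↦ f(z + x)`. -/
noncomputable def coeffAt [Fintype ι] (f : (ι → ℂ) → ℂ) (k : ι → ℤ) (z : ι → ℂ) : ℂ :=
  mFourierCoeff (torusLift f z) k

lemma coeffAt_def [Fintype ι] (f : (ι → ℂ) → ℂ) (k : ι → ℤ) (z : ι → ℂ) :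
    coeffAt f k z = ∫ x, mFourier (-k) x * torusLift f z x := rfl

lemma coeffAt_add_real [Fintype ι] {f : (ι → ℂ) → ℂ} (hf : ∀ l z, f (z + icast l) = f z)
    (k : ι → ℤ) (z : ι → ℂ) (t : ι → ℝ) :
    coeffAt f k (z + fun i => (t i : ℂ)) = e (icast k ⬝ᵥ fun i => (t i : ℂ)) * coeffAt f k z := by
  rw [coeffAt_def, coeffAt_def, ← integral_const_mul]
  rw [← integral_add_right_eq_self (fun x => e _ * _) (toTorus t)]
  congr 1
  ext x
  obtain ⟨s, rfl⟩ := exists_toTorus_eq x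
  have h : toTorus s + toTorus t = toTorus (s + t) := rfl
  rw [h, torusLift_toTorus hf, torusLift_toTorus hf, mFourier_toTorus, mFourier_toTorus,
    ← mul_assoc, ← e_add]
  congr 2
  · simp only [dotProduct, icast, Pi.neg_apply, Pi.add_apply, ← Finset.sum_add_distrib]
    refine Finset.sum_congr rfl fun i _ => ?_
    push_cast
    ring
  · ext i
    simp
    ring

lemma differentiable_coeffAt [Fintype ι] {f : (ι → ℂ) → ℂ}
    (hf : ∀ l z, f (z + icast l) = f z) (hd : Differentiable ℂ f) (k : ι → ℤ) (z w : ι → ℂ) :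
    Differentiable ℂ fun s : ℂ => coeffAt f k (z + s • w) := by
  simp only [coeffAt_def]
  refine differentiable_integral_of_compact (G := fun s x =>
    mFourier (-k) x * torusLift f (z + s • w) x) _ ?_ fun x => ?_
  · have := continuous_torusLift hf hd.continuous
    refine Continuous.mul (by fun_prop) ?_
    exact this.comp (by fun_prop : Continuous fun q : UnitAddTorus ι × ℂ => (q.1, z + q.2 • w))
  · unfold torusLift
    fun_prop

/-- For real s this is invariance of Haar measure. The function φ below is entire in s and constant
along real translations, so its derivative vanishes and the law extends to complex s. -/
lemma coeffAt_add_smul [Fintype ι] [DecidableEq ι] {f : (ι → ℂ) → ℂ}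
    (hf : ∀ l z, f (z + icast l) = f z) (hd : Differentiable ℂ f) (k : ι → ℤ) (z : ι → ℂ) (i : ι)
    (s : ℂ) :
    coeffAt f k (z + s • Pi.single i 1) = e (k i * s) * coeffAt f k z := by
  have hreal : ∀ (r : ℝ) (z : ι → ℂ), coeffAt f k (z + (r : ℂ) • Pi.single i 1) =
      e (k i * r) * coeffAt f k z := by
    intro r z
    have h := coeffAt_add_real hf k z (Pi.single i r)
    have h2 : (fun j => ((Pi.single i r : ι → ℝ) j : ℂ)) = (r : ℂ) • Pi.single i 1 := by
      ext j
      by_cases hj : j = i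
      · subst hj; simp
      · simp [hj]
    rw [h2] at h
    rw [h]
    simp [icast, mul_comm]
  let φ : ℂ → ℂ := fun s => e (-(k i * s)) * coeffAt f k (z + s • Pi.single i 1)
  have hφd : Differentiable ℂ φ := by
    have := differentiable_coeffAt hf hd k z (Pi.single i 1)
    fun_prop
  have hφr : ∀ (s : ℂ) (r : ℝ), φ (s + r) = φ s := by
    intro s r
    simp only [φ]
    rw [add_smul, ← add_assoc, hreal, ← mul_assoc, ← e_add]
    congr 2
    ring
  have hφ0 : ∀ s, deriv φ s = 0 := by
    intro s
    have h1 : HasDerivAt (fun r : ℝ => φ (s + r)) (deriv φ s) 0 := by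
      have h2 : HasDerivAt (fun r : ℂ => φ (s + r)) (deriv φ s) ((0 : ℝ) : ℂ) := by
        have h3 := (hφd (s + 0)).hasDerivAt.comp_const_add s 0
        simpa using h3
      exact h2.comp_ofReal
    simp only [hφr] at h1
    exact h1.unique (hasDerivAt_const _ _)
  have := is_const_of_deriv_eq_zero hφd hφ0 s 0
  simp only [φ, mul_zero, neg_zero, e_zero, one_mul, zero_smul, add_zero] at this
  rw [← this, ← mul_assoc, ← e_add]
  simp

lemma coeffAt_add [Fintype ι] [DecidableEq ι] {f : (ι → ℂ) → ℂ}
    (hf : ∀ l z, f (z + icast l) = f z) (hd : Differentiable ℂ f) (k : ι → ℤ) (z w : ι → ℂ) :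
    coeffAt f k (z + w) = e (icast k ⬝ᵥ w) * coeffAt f k z := by
  revert z
  have : w = ∑ i, w i • Pi.single i 1 := by
    ext j
    simp [Finset.sum_apply, Pi.single_apply]
  rw [this]
  refine Finset.sum_induction _ (fun w => ∀ z, coeffAt f k (z + w) =
    e (icast k ⬝ᵥ w) * coeffAt f k z) (fun a b ha hb z => ?_) (fun z => by simp) (fun i _ z => ?_)
  · rw [← add_assoc, hb, ha, dotProduct_add, e_add]; ring
  · rw [coeffAt_add_smul hf hd]
    simp [icast, mul_comm]

lemma eq_zero_of_coeffAt [Fintype ι] [DecidableEq ι] {f : (ι → ℂ) → ℂ}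
    (hf : ∀ l z, f (z + icast l) = f z) (hd : Differentiable ℂ f)
    (h : ∀ k, coeffAt f k 0 = 0) : f = 0 := by
  funext z
  let g : C(UnitAddTorus ι, ℂ) := ⟨torusLift f z,
    (continuous_torusLift hf hd.continuous).comp (by fun_prop : Continuous fun x => (x, z))⟩
  have hg : mFourierCoeff g = 0 := by
    funext k
    have := coeffAt_add hf hd k 0 z
    rw [h, mul_zero, zero_add] at this
    exact this
  have hs := hasSum_mFourier_series_apply_of_summable (f := g) (by rw [hg]; exact summable_zero)
    (toTorus 0)
  simp only [hg, Pi.zero_apply, zero_smul] at hs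
  have h0 := hs.unique hasSum_zero
  have h1 := torusLift_toTorus hf z 0
  rw [show torusLift f z (toTorus 0) = g (toTorus 0) from rfl, h0] at h1
  rw [show z = z + fun i => (((0 : ι → ℝ) i : ℝ) : ℂ) by ext; simp, ← h1]
  rfl

lemma coeffAt_smul [Fintype ι] (c : ℂ) (f : (ι → ℂ) → ℂ) (k : ι → ℤ) (z : ι → ℂ) :
    coeffAt (c • f) k z = c * coeffAt f k z := by
  rw [coeffAt_def, coeffAt_def, ← integral_const_mul]
  congr 1
  ext x
  simp only [torusLift, Pi.smul_apply, smul_eq_mul]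
  ring

lemma coeffAt_add_fun [Fintype ι] {f g : (ι → ℂ) → ℂ} (hf : ∀ l z, f (z + icast l) = f z)
    (hfc : Continuous f) (hg : ∀ l z, g (z + icast l) = g z) (hgc : Continuous g)
    (k : ι → ℤ) (z : ι → ℂ) : coeffAt (f + g) k z = coeffAt f k z + coeffAt g k z := by
  have hint : ∀ {f : (ι → ℂ) → ℂ}, (∀ l z, f (z + icast l) = f z) → Continuous f →
      Integrable fun x => mFourier (-k) x * torusLift f z x := by
    intro f hf hfc
    have h1 : Continuous fun x => mFourier (-k) x * torusLift f z x :=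
      Continuous.mul (by fun_prop) ((continuous_torusLift hf hfc).comp
        (by fun_prop : Continuous fun x => (x, z)))
    exact h1.integrable_of_hasCompactSupport (HasCompactSupport.of_compactSpace _)
  rw [coeffAt_def, coeffAt_def, coeffAt_def, ← integral_add (hint hf hfc) (hint hg hgc)]
  congr 1
  ext x
  simp only [torusLift, Pi.add_apply]
  ring

/-- Quasi-periodicity relates the Fourier coefficients along the lattice `N ℤ^ι`. -/
lemma coeffAt_add_mulVec [Fintype ι] [DecidableEq ι] {τ : ℂ} {N : Matrix ι ι ℤ} (hN : N.IsSymm)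
    {γ : ι → ℂ} {f : (ι → ℂ) → ℂ} (h : IsAutomorphic τ (N.map fun a => (a : ℂ)) γ f)
    (hd : Differentiable ℂ f) (k l : ι → ℤ) :
    ∃ c : ℂ, c ≠ 0 ∧ coeffAt f (k + N *ᵥ l) 0 = c * coeffAt f k 0 := by
  -- The coefficient at base point τl is computed twice: as an exponential times the coefficient at
  -- 0, and by automorphy, whose factor is an exponential in t and so shifts the frequency by Nl.
  have h1 := coeffAt_add h.add_int hd k 0 (τ • icast l)
  have h2 : coeffAt f k (0 + τ • icast l) =
      e (autExp τ (N.map fun a => (a : ℂ)) γ l 0) * coeffAt f (k + N *ᵥ l) 0 := by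
    rw [coeffAt_def, coeffAt_def, ← integral_const_mul]
    congr 1
    ext x
    obtain ⟨t, rfl⟩ := exists_toTorus_eq x
    rw [torusLift_toTorus h.add_int, torusLift_toTorus h.add_int, add_right_comm, h.add_tau,
      mFourier_toTorus, mFourier_toTorus, ← mul_assoc, ← mul_assoc, ← e_add, ← e_add]
    congr 2
    have hM : icast (N *ᵥ l) = (N.map fun a => (a : ℂ)) *ᵥ icast l := by
      ext i
      simp [icast, mulVec, dotProduct]
    have hs : icast l ⬝ᵥ ((N.map fun a => (a : ℂ)) *ᵥ fun i => (t i : ℂ)) =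
        ((N.map fun a => (a : ℂ)) *ᵥ icast l) ⬝ᵥ fun i => (t i : ℂ) := by
      rw [dotProduct_mulVec, ← mulVec_transpose, (hN.map _).eq]
    simp only [autExp, icast_neg, icast_add, neg_add, add_dotProduct, neg_dotProduct, hM, zero_add,
      mulVec_zero, dotProduct_zero, hs]
    ring
  rw [h1] at h2
  refine ⟨e (icast k ⬝ᵥ τ • icast l - autExp τ (N.map fun a => (a : ℂ)) γ l 0), e_ne_zero _, ?_⟩
  rw [e_sub, div_mul_eq_mul_div, h2, mul_div_cancel_left₀ _ (e_ne_zero _)]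

end Fourier

/-! ### The bound dim Θ ≤ n from Fourier coefficients -/

section ThetaBasis

variable {p : ℕ} (m : Fin (p + 1) → ℕ)

/-- The tridiagonal matrix with integer entries. -/
def cfMatrixInt : Matrix (Fin (p + 1)) (Fin (p + 1)) ℤ :=
  Matrix.of fun i j =>
    if i = j then (m i : ℤ) else if i.val + 1 = j.val ∨ j.val + 1 = i.val then -1 else 0

lemma cfMatrixInt_map : (cfMatrixInt m).map (fun a => (a : ℂ)) = cfMatrix m := by
  ext i j
  simp only [cfMatrixInt, cfMatrix, map_apply, of_apply]
  split_ifs <;> simp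

lemma cfMatrixInt_isSymm : (cfMatrixInt m).IsSymm := by
  ext i j
  simp only [cfMatrixInt, transpose_apply, of_apply]
  by_cases h : i = j
  · subst h; rfl
  · rw [if_neg h, if_neg (Ne.symm h)]
    simp only [or_comm]

/-- The unit vector with one-based index `j`, and `0` for `j` out of range. -/
def unitVec (p j : ℕ) : Fin (p + 1) → ℤ := fun t => if t.val + 1 = j then 1 else 0

lemma unitVec_zero : unitVec p 0 = 0 := by ext; simp [unitVec]

lemma unitVec_last_succ : unitVec p (p + 2) = 0 := by
  ext t
  have := t.2
  simp only [unitVec, Pi.zero_apply]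
  rw [if_neg (by omega)]

lemma unitVec_succ (i : Fin (p + 1)) : unitVec p (i + 1) = Pi.single i 1 := by
  ext t
  by_cases h : t = i
  · subst h; simp [unitVec]
  · have : t.val ≠ i.val := fun hc => h (Fin.ext hc)
    simp [unitVec, h, this]

lemma cfMatrixInt_mulVec_unitVec (i : Fin (p + 1)) :
    cfMatrixInt m *ᵥ unitVec p (i + 1) =
      (m i : ℤ) • unitVec p (i + 1) - unitVec p i - unitVec p (i + 2) := by
  rw [unitVec_succ, mulVec_single_one]
  ext t
  simp only [cfMatrixInt, col_apply, of_apply, Pi.sub_apply, Pi.smul_apply, unitVec, smul_eq_mul]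
  by_cases h : t = i
  · subst h
    simp
  · have h' : t.val ≠ i.val := fun hc => h (Fin.ext hc)
    rw [if_neg h, Pi.single_eq_of_ne h]
    by_cases h1 : t.val + 1 = i.val
    · rw [if_pos (Or.inl h1), if_pos h1, if_neg (by omega)]; ring
    · by_cases h2 : i.val + 1 = t.val
      · rw [if_pos (Or.inr h2), if_neg h1, if_pos (by omega)]; ring
      · rw [if_neg (by tauto), if_neg h1, if_neg (by omega)]; ring

/-- Modulo the image of M, the columns of M give e_i ≡ m e_{i+1} - e_{i+2} with m the diagonal entry
of column i+1: the recursion of A. It is run downwards from e_{p+2} = 0 and e_{p+1}, carrying two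
consecutive indices. -/
lemma unitVec_sub_mem_range (j : ℕ) (hj : j ≤ p + 1) :
    unitVec p j - contAfter m j • unitVec p (p + 1) ∈ LinearMap.range (cfMatrixInt m).mulVecLin := by
  have key : ∀ s ≤ p + 1,
      (unitVec p (p + 1 - s) - contAfter m (p + 1 - s) • unitVec p (p + 1) ∈
        LinearMap.range (cfMatrixInt m).mulVecLin) ∧
      (unitVec p (p + 2 - s) - contAfter m (p + 2 - s) • unitVec p (p + 1) ∈
        LinearMap.range (cfMatrixInt m).mulVecLin) := by
    intro s
    induction s with
    | zero =>
      intro _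
      simp only [Nat.sub_zero, contAfter_last, contAfter_last_succ, unitVec_last_succ, one_smul,
        sub_self, zero_smul, zero_mem, and_self]
    | succ s ih =>
      intro hs
      obtain ⟨h1, h2⟩ := ih (by omega)
      obtain ⟨i, hi⟩ : ∃ i : Fin (p + 1), p + 1 - (s + 1) = i.val := ⟨⟨p - s, by omega⟩, by simp⟩
      rw [show p + 1 - s = i.val + 1 by omega] at h1
      rw [show p + 2 - s = i.val + 2 by omega] at h2
      rw [hi, show p + 2 - (s + 1) = i.val + 1 by omega]
      refine ⟨?_, h1⟩
      have h3 : cfMatrixInt m *ᵥ unitVec p (i + 1) ∈ LinearMap.range (cfMatrixInt m).mulVecLin :=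
        ⟨_, rfl⟩
      have h4 := Submodule.sub_mem _
        (Submodule.sub_mem _ (Submodule.smul_mem _ (m i : ℤ) h1) h2) h3
      convert h4 using 1
      rw [cfMatrixInt_mulVec_unitVec, contAfter_rec]
      module
  have := (key (p + 1 - j) (by omega)).1
  rwa [show p + 1 - (p + 1 - j) = j by omega] at this

/-- The quotient of ℤ^{p+1} by the image of M is generated by e_{p+1}. The previous lemma at j = 0,
with e_0 = 0 and A_0 = n, shows that n kills this generator, so a coefficient may be reduced modulo
n. -/
lemma exists_eq_add_mulVec {n : ℕ} [NeZero n] (hn : contAfter m 0 = n) (k : Fin (p + 1) → ℤ) :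
    ∃ (j : Fin n) (x : Fin (p + 1) → ℤ),
      k = (j.val : ℤ) • unitVec p (p + 1) + cfMatrixInt m *ᵥ x := by
  have h1 : k - (∑ i, k i * contAfter m (i + 1)) • unitVec p (p + 1) ∈
      LinearMap.range (cfMatrixInt m).mulVecLin := by
    have : k - (∑ i, k i * contAfter m (i + 1)) • unitVec p (p + 1) =
        ∑ i, k i • (unitVec p (i + 1) - contAfter m (i + 1) • unitVec p (p + 1)) := by
      simp only [smul_sub, Finset.sum_sub_distrib, smul_smul, ← Finset.sum_smul, unitVec_succ]
      congr 1
      ext t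
      simp [Finset.sum_apply, Pi.single_apply]
    rw [this]
    exact Submodule.sum_mem _ fun i _ => Submodule.smul_mem _ _
      (unitVec_sub_mem_range m _ (by omega))
  have h2 := unitVec_sub_mem_range m 0 (by omega)
  rw [unitVec_zero, hn] at h2
  set a := ∑ i, k i * contAfter m (i + 1)
  have hn0 : (0 : ℤ) < n := by exact_mod_cast Nat.pos_of_ne_zero (NeZero.ne n)
  obtain ⟨x, hx⟩ := Submodule.sub_mem _ h1 (Submodule.smul_mem _ (a / n) h2)
  have hr : ((a % n).toNat : ℤ) = a % n := Int.toNat_of_nonneg (Int.emod_nonneg _ hn0.ne')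
  refine ⟨⟨(a % n).toNat, ?_⟩, x, ?_⟩
  · have := Int.emod_lt_of_pos a hn0
    omega
  · have hx' : cfMatrixInt m *ᵥ x = k - a • unitVec p (p + 1) -
        (a / n) • (0 - (n : ℤ) • unitVec p (p + 1)) := hx
    rw [hx', hr]
    have := Int.emod_add_mul_ediv a n
    nth_rewrite 2 [← this]
    module

variable (τ : ℂ)

/-- The Fourier coefficients at representatives of `ℤ^{p+1} / M ℤ^{p+1}`. -/
noncomputable def thetaCoeffs (n : ℕ) : thetaSpace τ m →ₗ[ℂ] (Fin n → ℂ) where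
  toFun f j := coeffAt f.1 ((j.val : ℤ) • unitVec p (p + 1)) 0
  map_add' f g := by
    obtain ⟨hfd, hf⟩ := (mem_thetaSpace_iff m τ).1 f.2
    obtain ⟨hgd, hg⟩ := (mem_thetaSpace_iff m τ).1 g.2
    ext j
    exact coeffAt_add_fun hf.add_int hfd.continuous hg.add_int hgd.continuous _ _
  map_smul' c f := by
    ext j
    exact coeffAt_smul _ _ _ _

lemma thetaCoeffs_injective {n : ℕ} [NeZero n] (hn : contAfter m 0 = n) :
    Function.Injective (thetaCoeffs m τ n) := by
  rw [← LinearMap.ker_eq_bot, LinearMap.ker_eq_bot']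
  rintro ⟨f, hf⟩ h
  obtain ⟨hfd, hfa⟩ := (mem_thetaSpace_iff m τ).1 hf
  refine Subtype.ext (eq_zero_of_coeffAt hfa.add_int hfd fun k => ?_)
  obtain ⟨j, x, rfl⟩ := exists_eq_add_mulVec m hn k
  rw [← cfMatrixInt_map] at hfa
  obtain ⟨c, -, hc⟩ := coeffAt_add_mulVec (cfMatrixInt_isSymm m) hfa hfd
    ((j.val : ℤ) • unitVec p (p + 1)) x
  rw [hc]
  have := congrFun h j
  simp only [thetaCoeffs, LinearMap.coe_mk, AddHom.coe_mk, Pi.zero_apply] at this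
  rw [this, mul_zero]

lemma finiteDimensional_thetaSpace {n : ℕ} [NeZero n] (hn : contAfter m 0 = n) :
    FiniteDimensional ℂ (thetaSpace τ m) :=
  FiniteDimensional.of_injective _ (thetaCoeffs_injective m τ hn)

lemma finrank_thetaSpace_le {n : ℕ} [NeZero n] (hn : contAfter m 0 = n) :
    Module.finrank ℂ (thetaSpace τ m) ≤ n := by
  simpa using LinearMap.finrank_le_finrank_of_injective (thetaCoeffs_injective m τ hn)

/-! ### A nonzero theta function -/

variable {m} {τ}

/-- A kernel vector solves the recursion of B with the same initial value 0 at index 0. Following it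
up to index p + 2 gives s_1 n = 0, which yields invertibility of M. -/
lemma coord_eq_mul_contBefore {s : Fin (p + 1) → ℂ} (hs : cfMatrix m *ᵥ s = 0) (j : ℕ)
    (hj : j ≤ p + 1) :
    coord s j = s 0 * contBefore m j ∧ coord s (j + 1) = s 0 * contBefore m (j + 1) := by
  induction j with
  | zero => simp [coord, contBefore, d_nil]
  | succ j ih =>
    obtain ⟨h1, h2⟩ := ih (by omega)
    refine ⟨h2, ?_⟩
    have h3 := congrFun hs ⟨j, by omega⟩
    rw [cfMatrix_mulVec] at h3
    have h4 := contBefore_rec m ⟨j, by omega⟩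
    have h5 : coord s (j + 1) = s ⟨j, by omega⟩ := by simp [coord, show j < p + 1 by omega]
    simp only [Pi.zero_apply] at h3 h4
    rw [← h5, h1, h2] at h3
    rw [h4]
    push_cast
    linear_combination -h3

lemma cfMatrix_mulVec_surjective (hn : contAfter m 0 ≠ 0) :
    Function.Surjective (cfMatrix m).mulVecLin := by
  rw [← LinearMap.injective_iff_surjective, ← LinearMap.ker_eq_bot, LinearMap.ker_eq_bot']
  intro s hs
  have hs' : cfMatrix m *ᵥ s = 0 := hs
  have h1 := (coord_eq_mul_contBefore hs' (p + 1) le_rfl).2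
  have h2 := casoratian m (p + 1) le_rfl
  rw [contAfter_last, contAfter_last_succ, one_mul, zero_mul, sub_zero] at h2
  rw [h2] at h1
  have h3 : s 0 = 0 := by
    have h4 : coord s (p + 1 + 1) = 0 := by simp [coord]
    rw [h4] at h1
    exact (mul_eq_zero.1 h1.symm).resolve_right (by exact_mod_cast hn)
  ext i
  have h5 := (coord_eq_mul_contBefore hs' i (by omega)).2
  rw [h3, zero_mul] at h5
  simpa [coord, show i.val < p + 1 from i.2] using h5

/-- The quadratic form of M is the sum of the (z_j - z_{j+1})², 0 ≤ j ≤ p + 1, and the (m_i - 2)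
z_i², with zero boundary coordinates. Since m_i ≥ 2, it is the form of an honest product of thetas
in these linear forms. -/
lemma sum_vecMulVec_eq (hm : ∀ i, 2 ≤ m i) :
    ∑ j ∈ Finset.range (p + 2), vecMulVec (icast (unitVec p j - unitVec p (j + 1)))
        (icast (unitVec p j - unitVec p (j + 1))) +
      ∑ i : Fin (p + 1), (m i - 2) • vecMulVec (icast (unitVec p (i + 1)))
        (icast (unitVec p (i + 1))) = cfMatrix m := by
  ext a b
  have ha := a.2
  have hb := b.2
  have h2 : (∑ i : Fin (p + 1), (m i - 2) • vecMulVec (icast (unitVec p (i + 1)))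
      (icast (unitVec p (i + 1)))) a b = if a = b then (m a : ℂ) - 2 else 0 := by
    rw [Matrix.sum_apply]
    simp only [unitVec_succ, icast_single, Matrix.smul_apply, vecMulVec_apply]
    rw [Finset.sum_eq_single a]
    · by_cases hab : a = b
      · subst hab
        simp [Nat.cast_sub (hm a)]
      · simp [hab, Ne.symm hab]
    · intro i _ hi
      simp [Pi.single_eq_of_ne hi.symm]
    · simp
  have h1 : (∑ j ∈ Finset.range (p + 2), vecMulVec (icast (unitVec p j - unitVec p (j + 1)))
      (icast (unitVec p j - unitVec p (j + 1)))) a b =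
      (if a = b then 2 else 0) - (if a.val + 1 = b.val then 1 else 0)
        - (if b.val + 1 = a.val then 1 else 0) := by
    rw [Matrix.sum_apply]
    have : ∀ j ∈ Finset.range (p + 2), vecMulVec (icast (unitVec p j - unitVec p (j + 1)))
        (icast (unitVec p j - unitVec p (j + 1))) a b =
        (if a.val + 1 = j then (if a = b then 1 else 0) else 0)
        - (if a.val + 1 = j then (if a.val + 1 = b.val then 1 else 0) else 0)
        - (if b.val + 1 = j then (if b.val + 1 = a.val then 1 else 0) else 0)
        + (if a.val = j then (if a = b then (1 : ℂ) else 0) else 0) := by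
      intro j _
      simp only [vecMulVec_apply, icast, Pi.sub_apply, unitVec, add_left_inj, Fin.ext_iff]
      split_ifs <;> first | omega | simp
    rw [Finset.sum_congr rfl this, Finset.sum_add_distrib, Finset.sum_sub_distrib,
      Finset.sum_sub_distrib, Finset.sum_ite_eq, Finset.sum_ite_eq, Finset.sum_ite_eq,
      Finset.sum_ite_eq]
    simp only [Finset.mem_range, show a.val + 1 < p + 2 by omega, show b.val + 1 < p + 2 by omega,
      show a.val < p + 2 by omega, if_true]
    split_ifs <;> norm_num
  rw [Matrix.add_apply, h1, h2]
  simp only [cfMatrix, of_apply, Fin.ext_iff]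
  split_ifs <;> first | omega | ring

lemma not_mem_lattice_of_real (hτ : 0 < τ.im) {x : ℝ} (h0 : ∀ i : ℤ, x ≠ i) :
    (x : ℂ) ∉ lattice τ := by
  intro hx
  obtain ⟨i, j, hij⟩ := mem_lattice.1 hx
  have h1 := congrArg Complex.im hij
  have h2 := congrArg Complex.re hij
  simp at h1 h2
  rcases h1 with h1 | h1
  · subst h1
    exact h0 i (by simpa using h2)
  · exact hτ.ne' h1

lemma differentiable_finset_prod {E κ : Type*} [NormedAddCommGroup E] [NormedSpace ℂ E]
    (s : Finset κ) {f : κ → E → ℂ} (h : ∀ a, Differentiable ℂ (f a)) :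
    Differentiable ℂ fun z => ∏ a ∈ s, f a z := by
  classical
  induction s using Finset.induction_on with
  | empty => simp
  | insert a s ha ih =>
    simp only [Finset.prod_insert ha]
    exact (h a).fun_mul ih

lemma exists_ne_zero_mem_thetaSpace (hτ : 0 < τ.im) (hm : ∀ i, 2 ≤ m i)
    (hn : contAfter m 0 ≠ 0) : ∃ f ∈ thetaSpace τ m, f ≠ 0 := by
  let F : (Fin (p + 1) → ℂ) → ℂ := fun z =>
    (∏ j ∈ Finset.range (p + 2), theta τ (icast (unitVec p j - unitVec p (j + 1)) ⬝ᵥ z)) *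
      ∏ i : Fin (p + 1), theta τ (icast (unitVec p (i + 1)) ⬝ᵥ z) ^ (m i - 2)
  have hF := (IsAutomorphic.prod (Finset.range (p + 2)) fun j _ =>
    isAutomorphic_theta τ (unitVec p j - unitVec p (j + 1))).mul
    (IsAutomorphic.prod Finset.univ fun (i : Fin (p + 1)) _ =>
      (isAutomorphic_theta τ (unitVec p (i + 1))).pow (m i - 2))
  rw [sum_vecMulVec_eq hm] at hF
  have hd : Differentiable ℂ F := by
    have := differentiable_theta hτ
    have hdot : ∀ c : Fin (p + 1) → ℤ, Differentiable ℂ fun z => icast c ⬝ᵥ z := fun c => by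
      simp only [dotProduct]; fun_prop
    have hθ : ∀ c : Fin (p + 1) → ℤ, Differentiable ℂ fun z => theta τ (icast c ⬝ᵥ z) :=
      fun c => this.comp (hdot c)
    refine Differentiable.fun_mul ?_ ?_
    · exact differentiable_finset_prod _ fun j => hθ _
    · exact differentiable_finset_prod _ fun i => (hθ _).fun_pow _
  -- The linear part of this product need not be computed: translation by s changes it by -Ms, and M
  -- is invertible.
  generalize (∑ j ∈ Finset.range (p + 2), ((1 + τ) / 2) • icast (unitVec p j - unitVec p (j + 1))) +
    ∑ i : Fin (p + 1), (m i - 2) • ((1 + τ) / 2) • icast (unitVec p (i + 1)) = γ at hF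
  obtain ⟨s, hs⟩ := cfMatrix_mulVec_surjective hn (γ - thetaGamma m τ)
  have hs' : cfMatrix m *ᵥ s = γ - thetaGamma m τ := hs
  have hT := hF.translate s
  rw [hs', sub_sub_cancel] at hT
  refine ⟨fun z => F (z + s), (mem_thetaSpace_iff m τ).2 ⟨by fun_prop, hT⟩, fun h0 => ?_⟩
  -- At this real point every linear form in the product takes a nonintegral real value, so no
  -- factor vanishes.
  let x : Fin (p + 1) → ℂ := fun i => (((i.val + 1 : ℕ) : ℝ) / ((p + 2 : ℕ) : ℝ) : ℝ)
  have hx := congrFun h0 (x - s)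
  simp only [sub_add_cancel, Pi.zero_apply] at hx
  have hfrac : ∀ a : ℤ, 0 < a → a < p + 2 →
      theta τ (((a : ℝ) / ((p + 2 : ℕ) : ℝ) : ℝ) : ℂ) ≠ 0 ∧
      theta τ ((-(a : ℝ) / ((p + 2 : ℕ) : ℝ) : ℝ) : ℂ) ≠ 0 := by
    intro a ha ha'
    have hp : (((p + 2 : ℕ) : ℤ) : ℝ) ≠ 0 := by
      have : ((p + 2 : ℕ) : ℝ) ≠ 0 := by positivity
      exact_mod_cast this
    constructor
    · rw [Ne, theta_eq_zero_iff hτ]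
      refine not_mem_lattice_of_real hτ fun i hi => ?_
      rw [← Int.cast_natCast, div_eq_iff hp] at hi
      have hi' : a = i * ((p + 2 : ℕ) : ℤ) := by exact_mod_cast hi
      push_cast at hi'
      have : 0 < i := by by_contra hc; nlinarith
      nlinarith
    · rw [Ne, theta_eq_zero_iff hτ]
      refine not_mem_lattice_of_real hτ fun i hi => ?_
      rw [← Int.cast_natCast, div_eq_iff hp] at hi
      have hi' : -a = i * ((p + 2 : ℕ) : ℤ) := by exact_mod_cast hi
      push_cast at hi'
      have : i < 0 := by by_contra hc; nlinarith
      nlinarith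
  have hE : ∀ i : Fin (p + 1), icast (unitVec p (i + 1)) ⬝ᵥ x = x i := fun i => by
    rw [unitVec_succ, icast_single, single_one_dotProduct]
  have hne : F x ≠ 0 := by
    refine mul_ne_zero (Finset.prod_ne_zero_iff.2 fun j hj => ?_)
      (Finset.prod_ne_zero_iff.2 fun i _ => pow_ne_zero _ ?_)
    · have hj' := Finset.mem_range.1 hj
      rw [sub_eq_add_neg, icast_add, icast_neg, add_dotProduct, neg_dotProduct, ← sub_eq_add_neg]
      by_cases hl : j = p + 1
      · subst hl
        have h1 := hE (Fin.last p)
        simp only [Fin.val_last] at h1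
        rw [h1, unitVec_last_succ]
        simp only [icast_zero, zero_dotProduct, sub_zero]
        have := (hfrac (p + 1) (by omega) (by omega)).1
        simpa [x] using this
      · have h1 := hE ⟨j, by omega⟩
        simp only at h1
        rw [h1]
        have h3 : icast (unitVec p j) ⬝ᵥ x - x ⟨j, by omega⟩ =
            ((-((1 : ℤ) : ℝ) / ((p + 2 : ℕ) : ℝ) : ℝ) : ℂ) := by
          cases j with
          | zero => simp [unitVec_zero, x]; ring
          | succ j =>
            have h2 := hE ⟨j, by omega⟩
            simp only at h2
            rw [h2]
            simp only [x]
            push_cast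
            ring
        rw [h3]
        exact (hfrac 1 one_pos (by omega)).2
    · rw [hE]
      have := (hfrac (i + 1) (by omega) (by omega)).1
      simpa [x] using this
  exact hne hx

end ThetaBasis

/-! ### The Heisenberg action on Θ and existence of the basis -/

section Heisenberg

variable {p : ℕ} {m : Fin (p + 1) → ℕ} {τ : ℂ} {n : ℕ}

/-- The integer vector `A` of the continuants of the final segments. -/
noncomputable def afterVec (m : Fin (p + 1) → ℕ) : Fin (p + 1) → ℤ := fun i => contAfter m (i + 1)

/-- The integer vector `B` of the continuants of the initial segments. -/
noncomputable def beforeVec (m : Fin (p + 1) → ℕ) : Fin (p + 1) → ℤ := fun i => contBefore m (i + 1)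

lemma coord_succ (z : Fin (p + 1) → ℂ) (i : Fin (p + 1)) : coord z (i + 1) = z i := by
  simp [coord, show i.val < p + 1 from i.2]

lemma coord_zero (z : Fin (p + 1) → ℂ) : coord z 0 = 0 := rfl

lemma coord_last_succ (z : Fin (p + 1) → ℂ) : coord z (p + 2) = 0 := by simp [coord]

lemma coord_afterVec {j : ℕ} (h0 : j ≠ 0) (hj : j ≤ p + 2) :
    coord (icast (afterVec m)) j = contAfter m j := by
  obtain ⟨j, rfl⟩ := Nat.exists_eq_succ_of_ne_zero h0
  by_cases h : j < p + 1
  · exact coord_succ (icast (afterVec m)) ⟨j, h⟩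
  · obtain rfl : j = p + 1 := by omega
    rw [Nat.succ_eq_add_one, coord_last_succ, contAfter_last_succ, Int.cast_zero]

lemma cfMatrix_mulVec_afterVec :
    cfMatrix m *ᵥ icast (afterVec m) = (contAfter m 0 : ℂ) • Pi.single 0 1 := by
  ext i
  rw [cfMatrix_mulVec, coord_afterVec (j := i + 2) (by omega) (by omega)]
  have h := contAfter_rec m i
  simp only [icast, afterVec, Pi.smul_apply, smul_eq_mul]
  by_cases hi : i = 0
  · subst hi
    simp only [Fin.val_zero, zero_add] at h ⊢
    rw [coord_zero, h]
    simp
  · rw [coord_afterVec (j := i) (fun h0 => hi (Fin.ext h0)) (by omega), h, Pi.single_eq_of_ne hi]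
    push_cast
    ring

lemma shiftVec_eq : shiftVec n m = (n : ℂ)⁻¹ • icast (afterVec m) := by
  ext i
  simp only [shiftVec, dAfter_eq, Pi.smul_apply, icast, afterVec, smul_eq_mul]
  rw [div_eq_inv_mul]

lemma nat_smul_shiftVec [NeZero n] : (n : ℂ) • shiftVec n m = icast (afterVec m) := by
  rw [shiftVec_eq, smul_smul, mul_inv_cancel₀ (NeZero.ne _), one_smul]

lemma cfMatrix_mulVec_shiftVec [NeZero n] (hn : contAfter m 0 = n) :
    cfMatrix m *ᵥ shiftVec n m = Pi.single 0 1 := by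
  rw [shiftVec_eq, mulVec_smul, cfMatrix_mulVec_afterVec, hn, smul_smul]
  rw [Int.cast_natCast, inv_mul_cancel₀ (NeZero.ne _), one_smul]

lemma opT_apply (f : (Fin (p + 1) → ℂ) → ℂ) (z) : opT n m f z = f (z + shiftVec n m) := rfl

lemma opTτ_apply (φ : ℂ) (f : (Fin (p + 1) → ℂ) → ℂ) (z) :
    opTτ τ n m φ f z = e (z 0 + φ) * f (z + τ • shiftVec n m) := by
  rw [opTτ]
  congr 2
  ext i
  simp [mul_comm]

/-- The linear part enters only through e(l·γ) with l integral. Translation by r changes it by the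
unit vector Mr, so `opT` preserves Θ. -/
lemma IsAutomorphic.congr_sub_int {ι : Type*} [Fintype ι] {S : Matrix ι ι ℂ} {γ : ι → ℂ}
    {f : (ι → ℂ) → ℂ} (l' : ι → ℤ) (h : IsAutomorphic τ S (γ - icast l') f) :
    IsAutomorphic τ S γ f := by
  refine ⟨h.add_int, fun l z => ?_⟩
  obtain ⟨j, hj⟩ := exists_int_dotProduct_icast l l'
  rw [h.add_tau]
  congr 1
  refine e_congr (-j) ?_
  simp only [autExp, dotProduct_sub, hj]
  push_cast
  ring

lemma opT_mem_thetaSpace [NeZero n] (hn : contAfter m 0 = n) {f : (Fin (p + 1) → ℂ) → ℂ}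
    (hf : f ∈ thetaSpace τ m) : opT n m f ∈ thetaSpace τ m := by
  rw [mem_thetaSpace_iff] at hf ⊢
  have h := hf.2.translate (shiftVec n m)
  rw [cfMatrix_mulVec_shiftVec hn, ← icast_single] at h
  refine ⟨?_, h.congr_sub_int _⟩
  have := hf.1
  show Differentiable ℂ fun z => f (z + shiftVec n m)
  fun_prop

lemma isAutomorphic_e (φ : ℂ) :
    IsAutomorphic τ (0 : Matrix (Fin (p + 1)) (Fin (p + 1)) ℂ) (τ • Pi.single 0 1)
      fun z => e (z 0 + φ) := by
  refine ⟨fun l z => ?_, fun l z => ?_⟩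
  · exact e_congr (l 0) (by simp [icast]; ring)
  · rw [← e_add]
    congr 1
    simp [autExp, icast]
    ring

/-- Translation by rτ changes the linear part by -τMr, a multiple of the first unit vector that the
prefactor e(z_1 + φ) restores exactly. -/
lemma opTτ_mem_thetaSpace [NeZero n] (hn : contAfter m 0 = n) (φ : ℂ)
    {f : (Fin (p + 1) → ℂ) → ℂ} (hf : f ∈ thetaSpace τ m) :
    opTτ τ n m φ f ∈ thetaSpace τ m := by
  rw [mem_thetaSpace_iff] at hf ⊢
  have h := (isAutomorphic_e φ).mul (hf.2.translate (τ • shiftVec n m))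
  rw [mulVec_smul, cfMatrix_mulVec_shiftVec hn, zero_add, add_sub_cancel] at h
  have h2 : opTτ τ n m φ f = fun z => e (z 0 + φ) * f (z + τ • shiftVec n m) :=
    funext fun z => opTτ_apply φ f z
  rw [h2]
  refine ⟨?_, h⟩
  have := hf.1
  fun_prop

lemma opT_opTτ (φ : ℂ) (f : (Fin (p + 1) → ℂ) → ℂ) :
    opT n m (opTτ τ n m φ f) = e (shiftVec n m 0) • opTτ τ n m φ (opT n m f) := by
  ext z
  simp only [opT_apply, opTτ_apply, Pi.smul_apply, smul_eq_mul, Pi.add_apply]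
  rw [← mul_assoc, ← e_add]
  congr 2
  · ring
  · abel

lemma opTτ_smul (φ c : ℂ) (f : (Fin (p + 1) → ℂ) → ℂ) :
    opTτ τ n m φ (c • f) = c • opTτ τ n m φ f := by
  ext z
  simp only [opTτ_apply, Pi.smul_apply, smul_eq_mul]
  ring

lemma opTτ_iterate (φ : ℂ) (f : (Fin (p + 1) → ℂ) → ℂ) (j : ℕ) (z : Fin (p + 1) → ℂ) :
    (opTτ τ n m φ)^[j] f z =
      e (j * (z 0 + φ) + j * (j - 1) / 2 * shiftVec n m 0 * τ) *
        f (z + (j * τ) • shiftVec n m) := by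
  induction j generalizing z with
  | zero => simp
  | succ j ih =>
    rw [Function.iterate_succ_apply', opTτ_apply, ih, ← mul_assoc, ← e_add]
    congr 2
    · simp only [Pi.add_apply, Pi.smul_apply, smul_eq_mul]
      push_cast
      ring
    · push_cast
      module

/-- The value of `φ` for which `T_{τ/n}^n = 1`. -/
noncomputable def normalizedPhase (τ : ℂ) (n : ℕ) (m : Fin (p + 1) → ℕ) : ℂ :=
  -(icast (afterVec m) ⬝ᵥ thetaGamma m τ - τ / 2 * contAfter m 1) / n

/-- The n-th iterate translates by nrτ = τA with A integral. As MA = n e_1, the automorphy factor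
contributes e(-n z_1), which cancels the prefactor; φ is chosen to cancel the constant that remains.
-/
lemma opTτ_iterate_eq_self [NeZero n] (hn : contAfter m 0 = n) {f : (Fin (p + 1) → ℂ) → ℂ}
    (hf : f ∈ thetaSpace τ m) : (opTτ τ n m (normalizedPhase τ n m))^[n] f = f := by
  rw [mem_thetaSpace_iff] at hf
  have hn0 : (n : ℂ) ≠ 0 := NeZero.ne _
  ext z
  have h0 : shiftVec n m 0 = contAfter m 1 / n := by
    rw [shiftVec, dAfter_eq]; rfl
  have h1 : icast (afterVec m) ⬝ᵥ (cfMatrix m *ᵥ z) = n * z 0 := by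
    rw [dotProduct_mulVec, ← mulVec_transpose, (cfMatrix_isSymm m).eq, cfMatrix_mulVec_afterVec, hn]
    simp
  have h2 : icast (afterVec m) ⬝ᵥ (cfMatrix m *ᵥ icast (afterVec m)) = n * contAfter m 1 := by
    rw [cfMatrix_mulVec_afterVec, hn]
    simp [icast, afterVec]
  rw [opTτ_iterate, mul_comm (n : ℂ) τ, mul_smul τ, nat_smul_shiftVec, hf.2.add_tau, ← mul_assoc,
    ← e_add]
  refine (congrArg (· * f z) (e_congr (y := 0) 0 ?_)).trans (by simp)
  rw [autExp, h1, h2, h0, normalizedPhase]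
  field_simp
  push_cast
  ring

lemma opTτ_ne_zero {φ : ℂ} {f : (Fin (p + 1) → ℂ) → ℂ} (hf : f ≠ 0) : opTτ τ n m φ f ≠ 0 := by
  intro h
  refine hf (funext fun z => ?_)
  have h1 := congrFun h (z - τ • shiftVec n m)
  rw [opTτ_apply, sub_add_cancel] at h1
  exact (mul_eq_zero.1 h1).resolve_left (e_ne_zero _)

/-- `T_{1/n}` as a linear map on all functions. -/
noncomputable def opTLin (n : ℕ) (m : Fin (p + 1) → ℕ) : Module.End ℂ ((Fin (p + 1) → ℂ) → ℂ) where
  toFun := opT n m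
  map_add' _ _ := rfl
  map_smul' _ _ := rfl

/-- `T_{1/n}` as a linear map of `Θ`. -/
noncomputable def opTTheta [NeZero n] (hn : contAfter m 0 = n) : Module.End ℂ (thetaSpace τ m) :=
  (opTLin n m).restrict fun _ hf => opT_mem_thetaSpace hn hf

lemma opT_iterate (f : (Fin (p + 1) → ℂ) → ℂ) (j : ℕ) (z : Fin (p + 1) → ℂ) :
    (opT n m)^[j] f z = f (z + (j : ℂ) • shiftVec n m) := by
  induction j generalizing z with
  | zero => simp
  | succ j ih =>
    rw [Function.iterate_succ_apply', opT_apply, ih]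
    congr 1
    push_cast
    module

lemma e_div_mul_congr [NeZero n] (κ : ℕ) {a b : ℤ} (h : (a : ZMod n) = b) :
    e ((κ : ℂ) / n * a) = e ((κ : ℂ) / n * b) := by
  obtain ⟨c, hc⟩ := (ZMod.intCast_eq_intCast_iff_dvd_sub b a n).1 h.symm
  have hn0 : (n : ℂ) ≠ 0 := NeZero.ne _
  refine e_congr (κ * c) ?_
  have : (a : ℂ) = b + n * c := by
    have : a = b + n * c := by linarith
    exact_mod_cast this
  rw [this]
  field_simp
  push_cast
  ring

/-- On a nonzero finite-dimensional space `opT` has an eigenvalue. It is an n-th root of unity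
e(l/n), because nr is integral and f is periodic; inverting κ modulo n puts it in the required form.
-/
lemma exists_eigenvector (hτ : 0 < τ.im) (hm : ∀ i, 2 ≤ m i) [NeZero n]
    (hn : contAfter m 0 = n) {κ : ℕ} (hκ : Nat.Coprime κ n) :
    ∃ f ∈ thetaSpace τ m, f ≠ 0 ∧ ∃ a : ZMod n,
      opT n m f = e ((κ : ℂ) / n * (a.val : ℤ)) • f := by
  have hn0 : (n : ℂ) ≠ 0 := NeZero.ne _
  have hfd := finiteDimensional_thetaSpace m τ hn
  obtain ⟨f₀, hf₀, hne⟩ := exists_ne_zero_mem_thetaSpace (m := m) hτ hm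
    (by rw [hn]; exact_mod_cast NeZero.ne n)
  have : Nontrivial (thetaSpace τ m) := ⟨⟨f₀, hf₀⟩, 0, fun h => hne (congrArg Subtype.val h)⟩
  obtain ⟨c, hc⟩ := Module.End.exists_eigenvalue (opTTheta (τ := τ) hn)
  obtain ⟨⟨f, hf⟩, hfe⟩ := hc.exists_hasEigenvector
  have hf0 : f ≠ 0 := fun h => hfe.2 (Subtype.ext h)
  have hTf : opT n m f = c • f := congrArg Subtype.val hfe.apply_eq_smul
  refine ⟨f, hf, hf0, ?_⟩
  have hpow : ∀ j : ℕ, (opT n m)^[j] f = c ^ j • f := by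
    intro j
    induction j with
    | zero => simp
    | succ j ih =>
      rw [Function.iterate_succ_apply', ih]
      have : opT n m (c ^ j • f) = c ^ j • opT n m f := rfl
      rw [this, hTf, smul_smul, pow_succ]
  have hcn : c ^ n = 1 := by
    obtain ⟨z, hz⟩ := Function.ne_iff.1 hf0
    have h1 := congrFun (hpow n) z
    rw [opT_iterate, nat_smul_shiftVec, ((mem_thetaSpace_iff m τ).1 hf).2.add_int] at h1
    have h2 : f z * c ^ n = f z * 1 := by
      rw [mul_one, mul_comm]; exact h1.symm
    exact mul_left_cancel₀ hz h2
  obtain ⟨y, rfl⟩ := exists_e_eq (x := c) (by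
    rintro rfl
    rw [zero_pow (NeZero.ne n)] at hcn
    exact zero_ne_one hcn)
  rw [← e_nat_mul, e_eq_one_iff] at hcn
  obtain ⟨l, hl⟩ := hcn
  let u := ZMod.unitOfCoprime κ hκ
  refine ⟨(u⁻¹ : (ZMod n)ˣ) * (l : ZMod n), ?_⟩
  rw [hTf]
  congr 1
  set a : ZMod n := (u⁻¹ : (ZMod n)ˣ) * (l : ZMod n)
  have ha : (κ : ZMod n) * a = l := by
    have : (κ : ZMod n) = u := (ZMod.coe_unitOfCoprime κ hκ).symm
    rw [this, ← mul_assoc, Units.mul_inv, one_mul]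
  have hk : ((κ * (a.val : ℤ) : ℤ) : ZMod n) = (l : ℤ) := by
    push_cast
    rw [ZMod.natCast_zmod_val, ha]
  have h3 := e_div_mul_congr (n := n) 1 hk
  have hy : y = ((1 : ℕ) : ℂ) / n * l := by
    rw [← hl]; field_simp; simp
  rw [hy, ← h3]
  congr 1
  push_cast
  ring

lemma e_div_mul_injective [NeZero n] {κ : ℕ} (hκ : Nat.Coprime κ n) {a b : ZMod n}
    (h : e ((κ : ℂ) / n * a.val) = e ((κ : ℂ) / n * b.val)) : a = b := by
  have hn0 : (n : ℂ) ≠ 0 := NeZero.ne _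
  obtain ⟨j, hj⟩ := e_eq_iff.1 h
  have h1 : (κ : ℂ) * a.val = κ * b.val + n * j := by
    field_simp at hj
    linear_combination hj
  have h2 : (κ : ℤ) * a.val = κ * b.val + n * j := by exact_mod_cast h1
  have h3 := congrArg (Int.cast : ℤ → ZMod n) h2
  push_cast at h3
  rw [ZMod.natCast_zmod_val, ZMod.natCast_zmod_val, ZMod.natCast_self, zero_mul, add_zero] at h3
  exact ((ZMod.isUnit_iff_coprime κ n).2 hκ).mul_left_cancel h3

theorem exists_isThetaBasis (hτ : 0 < τ.im) (hm : ∀ i, 2 ≤ m i) [NeZero n] {κ : ℕ}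
    (hn : contAfter m 0 = n) (h1 : contAfter m 1 = κ) (hκ : Nat.Coprime κ n) :
    ∃ (φ : ℂ) (w : ZMod n → (Fin (p + 1) → ℂ) → ℂ), IsThetaBasis τ n κ m φ w := by
  obtain ⟨f, hf, hf0, a₀, ha₀⟩ := exists_eigenvector hτ hm hn hκ
  set φ := normalizedPhase τ n m
  set U := opTτ τ n m φ
  have hper : Function.IsPeriodicPt U n f := opTτ_iterate_eq_self hn hf
  have hr : shiftVec n m 0 = κ / n := by
    rw [shiftVec, dAfter_eq]
    simp [h1]
  have hT : ∀ j : ℕ, opT n m (U^[j] f) = e ((κ : ℂ) / n * ((a₀.val + j : ℤ) : ℂ)) • U^[j] f := by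
    intro j
    induction j with
    | zero => simpa using ha₀
    | succ j ih =>
      rw [Function.iterate_succ_apply', opT_opTτ, ih, opTτ_smul, smul_smul, ← e_add, hr]
      congr 2
      push_cast
      ring
  have hmem : ∀ j : ℕ, U^[j] f ∈ thetaSpace τ m ∧ U^[j] f ≠ 0 := by
    intro j
    induction j with
    | zero => exact ⟨hf, hf0⟩
    | succ j ih =>
      rw [Function.iterate_succ_apply']
      exact ⟨opTτ_mem_thetaSpace hn φ ih.1, opTτ_ne_zero ih.2⟩
  -- Each application of U raises the index of the eigenvalue by 1, so counting iterates from a₀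
  -- gives the labels; U^n f = f makes the labelling cyclic.
  let w : ZMod n → (Fin (p + 1) → ℂ) → ℂ := fun a => U^[(a - a₀).val] f
  have hwT : ∀ a, opT n m (w a) = e ((κ : ℂ) / n * a.val) • w a := by
    intro a
    have h := e_div_mul_congr (n := n) κ (a := (a₀.val : ℤ) + ((a - a₀).val : ℕ)) (b := a.val)
      (by push_cast; simp only [ZMod.natCast_zmod_val]; ring)
    have h2 := hT (a - a₀).val
    rw [h] at h2
    exact_mod_cast h2
  have hwτ : ∀ a, U (w a) = w (a + 1) := by
    intro a
    simp only [w]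
    rw [← Function.iterate_succ_apply' U, ← hper.iterate_mod_apply]
    congr 2
    have : ((((a - a₀).val + 1 : ℕ)) : ZMod n) = a + 1 - a₀ := by
      push_cast
      rw [ZMod.natCast_zmod_val]
      ring
    rw [← this, ZMod.val_natCast]
  have hli : LinearIndependent ℂ w := by
    refine Module.End.eigenvectors_linearIndependent' (opTLin n m)
      (fun a : ZMod n => e ((κ : ℂ) / n * a.val)) (fun a b h => e_div_mul_injective hκ h) w
      fun a => ⟨Module.End.mem_eigenspace_iff.2 (hwT a), (hmem _).2⟩
  have hfd := finiteDimensional_thetaSpace m τ hn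
  refine ⟨φ, w, hli, ?_, hwT, hwτ⟩
  refine Submodule.eq_of_le_of_finrank_le
    (Submodule.span_le.2 (by rintro _ ⟨a, rfl⟩; exact (hmem _).1)) ?_
  rw [finrank_span_eq_card hli, ZMod.card]
  exact finrank_thetaSpace_le m τ hn

end Heisenberg

/-! ### The Kronecker function: quasi-periods and residues -/

section Kronecker

variable {τ : ℂ}

/-- The Kronecker function `θ(x + y) / (θ(x) θ(y))`. -/
noncomputable def kron (τ x y : ℂ) : ℂ := theta τ (x + y) / (theta τ x * theta τ y)

lemma kron_comm (x y : ℂ) : kron τ x y = kron τ y x := by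
  rw [kron, kron, add_comm, mul_comm (theta τ x)]

lemma kron_add_int (x y : ℂ) (a b : ℤ) : kron τ (x + a) (y + b) = kron τ x y := by
  rw [kron, kron, theta_add_int, theta_add_int,
    show x + a + (y + b) = x + y + ((a + b : ℤ) : ℂ) by push_cast; ring, theta_add_int]

lemma kron_add_int_mul_tau (x y : ℂ) (a b : ℤ) :
    kron τ (x + a * τ) (y + b * τ) = e (-(a * y) - b * x - a * b * τ) * kron τ x y := by
  rw [kron, kron, theta_add_int_mul_tau, theta_add_int_mul_tau,
    show x + a * τ + (y + b * τ) = x + y + ((a + b : ℤ) : ℂ) * τ by push_cast; ring,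
    theta_add_int_mul_tau, mul_mul_mul_comm, ← e_add, mul_div_mul_comm, ← e_sub]
  congr 2
  push_cast
  ring

lemma kron_neg (x y : ℂ) : kron τ (-x) (-y) = -kron τ x y := by
  have h : e (-(x + y)) = e (-x) * e (-y) := by rw [← e_add, neg_add]
  rw [kron, kron, ← neg_add, theta_neg, theta_neg, theta_neg, h,
    show -e (-x) * theta τ x * (-e (-y) * theta τ y) =
      e (-x) * e (-y) * (theta τ x * theta τ y) by ring, neg_mul, neg_div,
    mul_div_mul_left _ _ (mul_ne_zero (e_ne_zero _) (e_ne_zero _))]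

lemma kron_eq_of_left (x y : ℂ) (i j : ℤ) :
    kron τ x y = e (-(j * y)) * kron τ (x - (i + j * τ)) y := by
  have h1 := kron_add_int_mul_tau (τ := τ) (x - (i + j * τ)) y j 0
  have h2 := kron_add_int (τ := τ) (x - (i + j * τ) + j * τ) y i 0
  simp only [Int.cast_zero, zero_mul, add_zero, mul_zero, sub_zero] at h1 h2
  rw [← h1, ← h2]
  congr 1
  ring

lemma tendsto_div_theta (hτ : 0 < τ.im) {s : ℂ} (hs : s ≠ 0) (z₀ : ℂ) :
    Tendsto (fun z => (z - z₀) / theta τ (s * (z - z₀))) (𝓝[≠] z₀)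
      (𝓝 (1 / (s * deriv (theta τ) 0))) := by
  have h1 : HasDerivAt (fun z => theta τ (s * (z - z₀))) (deriv (theta τ) 0 * s) z₀ := by
    have h2 : HasDerivAt (fun z => s * (z - z₀)) s z₀ := by
      simpa using ((hasDerivAt_id z₀).sub_const z₀).const_mul s
    have h3 : HasDerivAt (theta τ) (deriv (theta τ) 0) (s * (z₀ - z₀)) := by
      rw [sub_self, mul_zero]
      exact (differentiable_theta hτ 0).hasDerivAt
    exact h3.comp z₀ h2
  have h4 := (hasDerivAt_iff_tendsto_slope.1 h1).inv₀
    (mul_ne_zero (deriv_theta_zero_ne_zero hτ) hs)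
  rw [mul_comm s, one_div]
  refine h4.congr fun z => ?_
  rw [slope_def_field, sub_self, mul_zero, theta_zero, sub_zero, inv_div]

/-- Quasi-periodicity moves the pole at i + jτ to 0, at the price of e(-jy). There θ(x + y)/θ(y)
tends to 1, and θ(x) is asymptotic to s θ'(0) (z - z₀). -/
lemma tendsto_kron_left (hτ : 0 < τ.im) {x y : ℂ → ℂ} {z₀ s : ℂ} {i j : ℤ} (hs : s ≠ 0)
    (hx : ∀ z, x z = i + j * τ + s * (z - z₀)) (hy : ContinuousAt y z₀)
    (hy0 : theta τ (y z₀) ≠ 0) :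
    Tendsto (fun z => (z - z₀) * kron τ (x z) (y z)) (𝓝[≠] z₀)
      (𝓝 (e (-(j * y z₀)) / (s * deriv (theta τ) 0))) := by
  have hθ := continuous_theta hτ
  have h1 := tendsto_div_theta hτ hs z₀
  have h2 : ContinuousAt (fun z => e (-(j * y z)) *
      (theta τ (s * (z - z₀) + y z) / theta τ (y z))) z₀ := by
    refine ContinuousAt.mul ?_ (ContinuousAt.div ?_ ?_ hy0)
    · exact continuous_e.continuousAt.comp (by fun_prop)
    · exact hθ.continuousAt.comp (by fun_prop)
    · exact hθ.continuousAt.comp hy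
  have h3 := (h2.tendsto.mono_left nhdsWithin_le_nhds).mul h1
  rw [sub_self, mul_zero, zero_add, div_self hy0, mul_one, mul_one_div] at h3
  refine h3.congr fun z => ?_
  rw [kron_eq_of_left (x z) (y z) i j, hx, add_sub_cancel_left, kron]
  ring

lemma tendsto_kron_right (hτ : 0 < τ.im) {x y : ℂ → ℂ} {z₀ s : ℂ} {i j : ℤ} (hs : s ≠ 0)
    (hy : ∀ z, y z = i + j * τ + s * (z - z₀)) (hx : ContinuousAt x z₀)
    (hx0 : theta τ (x z₀) ≠ 0) :
    Tendsto (fun z => (z - z₀) * kron τ (x z) (y z)) (𝓝[≠] z₀)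
      (𝓝 (e (-(j * x z₀)) / (s * deriv (theta τ) 0))) := by
  simp only [kron_comm (x _)]
  exact tendsto_kron_left hτ hs hy hx hx0

lemma continuousAt_kron (hτ : 0 < τ.im) {X : Type*} [TopologicalSpace X] {x y : X → ℂ} {z₀ : X}
    (hx : ContinuousAt x z₀) (hy : ContinuousAt y z₀) (hx0 : theta τ (x z₀) ≠ 0)
    (hy0 : theta τ (y z₀) ≠ 0) : ContinuousAt (fun z => kron τ (x z) (y z)) z₀ := by
  have hθ := continuous_theta hτ
  refine ContinuousAt.div (hθ.continuousAt.comp (hx.add hy))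
    ((hθ.continuousAt.comp hx).mul (hθ.continuousAt.comp hy)) (mul_ne_zero hx0 hy0)

lemma tendsto_sub_mul_zero {f : ℂ → ℂ} {z₀ : ℂ} (hf : ContinuousAt f z₀) :
    Tendsto (fun z => (z - z₀) * f z) (𝓝[≠] z₀) (𝓝 0) := by
  have : ContinuousAt (fun z => (z - z₀) * f z) z₀ := by fun_prop
  simpa [ContinuousAt] using this.mono_left nhdsWithin_le_nhds

end Kronecker

/-! ### The functions `θ_a` with integer labels -/

section ThetaInt

variable {τ : ℂ} {n : ℕ}

/-- `θ_j` for an integer label `j`. -/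
noncomputable def thetaInt (τ : ℂ) (n : ℕ) (j : ℤ) (z : ℂ) : ℂ :=
  (∏ l ∈ Finset.range n, theta τ (z + (l : ℂ) / n + (j : ℂ) / n * τ)) *
    e (j * z + j * (j - n) / (2 * n) * τ + j / (2 * n))

lemma prod_e {κ : Type*} (s : Finset κ) (f : κ → ℂ) : ∏ a ∈ s, e (f a) = e (∑ a ∈ s, f a) := by
  classical
  induction s using Finset.induction_on with
  | empty => simp
  | insert a s ha ih => rw [Finset.prod_insert ha, Finset.sum_insert ha, ih, e_add]

lemma sum_range_div (hn : n ≠ 0) : ∑ l ∈ Finset.range n, (l : ℂ) / n = ((n : ℂ) - 1) / 2 := by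
  have h : (∑ l ∈ Finset.range n, (l : ℂ)) * 2 = n * (n - 1) := by
    have := Finset.sum_range_id_mul_two n
    have h2 : (((∑ l ∈ Finset.range n, l) * 2 : ℕ) : ℂ) = ((n * (n - 1) : ℕ) : ℂ) := by rw [this]
    rw [Nat.cast_mul, Nat.cast_mul, Nat.cast_sub (Nat.one_le_iff_ne_zero.2 hn)] at h2
    push_cast at h2
    exact h2
  have hn0 : (n : ℂ) ≠ 0 := by exact_mod_cast hn
  rw [← Finset.sum_div, div_eq_div_iff hn0 two_ne_zero, h]
  ring

lemma thetaInt_add_self [NeZero n] (j : ℤ) (z : ℂ) :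
    thetaInt τ n (j + n) z = thetaInt τ n j z := by
  have hn0 : (n : ℂ) ≠ 0 := NeZero.ne _
  have h1 : ∀ l ∈ Finset.range n,
      theta τ (z + (l : ℂ) / n + ((j + n : ℤ) : ℂ) / n * τ) =
      e (1 / 2 - (z + (l : ℂ) / n + (j : ℂ) / n * τ)) *
        theta τ (z + (l : ℂ) / n + (j : ℂ) / n * τ) := by
    intro l _
    rw [show z + (l : ℂ) / n + ((j + n : ℤ) : ℂ) / n * τ = z + (l : ℂ) / n + (j : ℂ) / n * τ + τ by
      push_cast; field_simp; ring, theta_add_tau, sub_eq_add_neg, e_add, e_half]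
    ring
  rw [thetaInt, thetaInt, Finset.prod_congr rfl h1, Finset.prod_mul_distrib, prod_e]
  rw [mul_right_comm, ← e_add, mul_comm]
  congr 1
  refine e_congr 1 ?_
  simp only [Finset.sum_sub_distrib, Finset.sum_add_distrib, Finset.sum_const, Finset.card_range,
    nsmul_eq_mul, sum_range_div (NeZero.ne n)]
  push_cast
  field_simp
  ring

lemma thetaInt_congr [NeZero n] {j j' : ℤ} (h : (j : ZMod n) = j') (z : ℂ) :
    thetaInt τ n j z = thetaInt τ n j' z := by
  obtain ⟨c, hc⟩ := (ZMod.intCast_eq_intCast_iff_dvd_sub j' j n).1 h.symm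
  obtain rfl : j = j' + n * c := by linarith
  clear hc h
  induction c using Int.induction_on with
  | zero => simp
  | succ c ih => rw [← ih, ← thetaInt_add_self (j' + n * c)]; congr 1; ring
  | pred c ih => rw [← ih, ← thetaInt_add_self (j' + n * (-c - 1))]; congr 1; ring

lemma thetaOrder_eq_thetaInt [NeZero n] {a : ZMod n} {j : ℤ} (h : (j : ZMod n) = a) (z : ℂ) :
    thetaOrder τ n a z = thetaInt τ n j z := by
  rw [thetaInt_congr (j' := (a.val : ℤ)) (by rw [h]; simp)]
  simp [thetaOrder, thetaInt]

lemma thetaInt_add_inv [NeZero n] (j : ℤ) (z : ℂ) :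
    thetaInt τ n j (z + 1 / n) = e (j / n) * thetaInt τ n j z := by
  have hn0 : (n : ℂ) ≠ 0 := NeZero.ne _
  have h1 : ∏ l ∈ Finset.range n, theta τ (z + 1 / n + (l : ℂ) / n + (j : ℂ) / n * τ) =
      ∏ l ∈ Finset.range n, theta τ (z + (l : ℂ) / n + (j : ℂ) / n * τ) := by
    have h2 : ∀ l : ℕ, z + 1 / n + (l : ℂ) / n + (j : ℂ) / n * τ =
        z + ((l + 1 : ℕ) : ℂ) / n + (j : ℂ) / n * τ := fun l => by push_cast; ring
    simp only [h2]
    obtain ⟨N, hN⟩ := Nat.exists_eq_succ_of_ne_zero (NeZero.ne n)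
    have h3 := Finset.prod_range_succ
      (fun l : ℕ => theta τ (z + ((l + 1 : ℕ) : ℂ) / n + (j : ℂ) / n * τ)) N
    have h4 := Finset.prod_range_succ'
      (fun l : ℕ => theta τ (z + (l : ℂ) / n + (j : ℂ) / n * τ)) N
    rw [← Nat.succ_eq_add_one, ← hN] at h3 h4
    rw [h3, h4]
    congr 1
    rw [div_self hn0, Nat.cast_zero, zero_div, add_zero, add_right_comm, theta_add_one]
  rw [thetaInt, thetaInt, h1, mul_left_comm, ← e_add]
  congr 2
  ring

lemma thetaInt_add_tau_div [NeZero n] (j : ℤ) (z : ℂ) :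
    thetaInt τ n j (z + τ / n) =
      e (-z + (n - 1) / (2 * n) * τ - 1 / (2 * n)) * thetaInt τ n (j + 1) z := by
  have hn0 : (n : ℂ) ≠ 0 := NeZero.ne _
  rw [thetaInt, thetaInt, mul_left_comm, ← e_add]
  congr 1
  · refine Finset.prod_congr rfl fun l _ => ?_
    congr 1
    push_cast
    ring
  · congr 1
    push_cast
    field_simp
    ring

lemma thetaInt_ne_zero (hτ : 0 < τ.im) [NeZero n] {j : ℤ} {z : ℂ}
    (h : ∀ i s : ℤ, (s : ZMod n) = -j → n * z ≠ i + s * τ) : thetaInt τ n j z ≠ 0 := by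
  have hn0 : (n : ℂ) ≠ 0 := NeZero.ne _
  refine mul_ne_zero (Finset.prod_ne_zero_iff.2 fun l _ => ?_) (e_ne_zero _)
  rw [Ne, theta_eq_zero_iff hτ, mem_lattice]
  rintro ⟨i, s, hz⟩
  refine h (n * i - l) (n * s - j) (by simp) ?_
  field_simp at hz
  push_cast
  linear_combination hz

lemma thetaInt_ne_zero_of_notMem (hτ : 0 < τ.im) [NeZero n] (j : ℤ) {z : ℂ}
    (h : (n : ℂ) * z ∉ lattice τ) : thetaInt τ n j z ≠ 0 :=
  thetaInt_ne_zero hτ fun i s _ hz => h (mem_lattice.2 ⟨i, s, hz⟩)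

lemma differentiable_thetaInt (hτ : 0 < τ.im) (j : ℤ) : Differentiable ℂ (thetaInt τ n j) := by
  have := differentiable_theta hτ
  have h2 : Differentiable ℂ fun z : ℂ =>
      ∏ l ∈ Finset.range n, theta τ (z + (l : ℂ) / n + (j : ℂ) / n * τ) :=
    differentiable_finset_prod _ fun l => by fun_prop
  unfold thetaInt
  fun_prop

/-! ### The coefficients of the relations as functions of a spectral parameter -/

/-- The coefficient `θ_{α+β}(η-z) / (θ_β(η) θ_α(-z))`. -/
noncomputable def relCoeff (τ : ℂ) (n : ℕ) (η : ℂ) (α β : ℤ) (z : ℂ) : ℂ :=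
  thetaInt τ n (α + β) (η - z) / (thetaInt τ n β η * thetaInt τ n α (-z))

variable {η : ℂ}

lemma relCoeff_congr [NeZero n] {α α' β : ℤ} (h : (α : ZMod n) = α') (z : ℂ) :
    relCoeff τ n η α β z = relCoeff τ n η α' β z := by
  rw [relCoeff, relCoeff, thetaInt_congr h,
    thetaInt_congr (j := α + β) (j' := α' + β) (by push_cast; rw [h])]

lemma relCoeff_add_inv [NeZero n] (α β : ℤ) (z : ℂ) :
    relCoeff τ n η α β (z + 1 / n) = e (-(β / n)) * relCoeff τ n η α β z := by
  have h1 := thetaInt_add_inv (τ := τ) (n := n) (α + β) (η - (z + 1 / n))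
  have h2 := thetaInt_add_inv (τ := τ) (n := n) α (-(z + 1 / n))
  rw [show η - (z + 1 / n) + 1 / n = η - z by ring] at h1
  rw [show -(z + 1 / n) + 1 / n = -z by ring] at h2
  rw [relCoeff, relCoeff, h1, h2, mul_left_comm _ (e _), mul_div_mul_comm, ← e_sub, ← mul_assoc,
    ← e_add]
  rw [show -((β : ℂ) / n) + (((α + β : ℤ) : ℂ) / n - α / n) = 0 by push_cast; ring, e_zero, one_mul]

/-- Together with the shift by 1/n, which acts by a character in β, this transports the residue at 0
to every point of Γ/n, in parallel with the Heisenberg action on the basis. -/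
lemma relCoeff_add_tau_div [NeZero n] (α β : ℤ) (z : ℂ) :
    relCoeff τ n η α β (z + τ / n) = e η * relCoeff τ n η (α - 1) β z := by
  have h1 := thetaInt_add_tau_div (τ := τ) (n := n) (α - 1 + β) (η - (z + τ / n))
  have h2 := thetaInt_add_tau_div (τ := τ) (n := n) (α - 1) (-(z + τ / n))
  rw [show η - (z + τ / n) + τ / n = η - z by ring, show α - 1 + β + 1 = α + β by ring] at h1
  rw [show -(z + τ / n) + τ / n = -z by ring, sub_add_cancel] at h2
  rw [relCoeff, relCoeff, h1, h2, mul_left_comm _ (e _), mul_div_mul_comm, ← e_sub, ← mul_assoc,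
    ← e_add]
  refine (one_mul _).symm.trans (congrArg (· * _) ?_)
  rw [← e_zero]
  congr 1
  ring

lemma relCoeff_add_int_div [NeZero n] (α β : ℤ) (z : ℂ) (i : ℤ) :
    relCoeff τ n η α β (z + i / n) = e (-(i * β / n)) * relCoeff τ n η α β z := by
  induction i using Int.induction_on with
  | zero => simp
  | succ i ih =>
    rw [show z + ((i + 1 : ℤ) : ℂ) / n = z + ((i : ℤ) : ℂ) / n + 1 / n by push_cast; ring,
      relCoeff_add_inv, ih, ← mul_assoc, ← e_add]
    congr 2
    push_cast
    ring
  | pred i ih =>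
    have h := relCoeff_add_inv (τ := τ) (n := n) (η := η) α β (z + ((-i - 1 : ℤ) : ℂ) / n)
    rw [show z + ((-i - 1 : ℤ) : ℂ) / n + 1 / n = z + ((-i : ℤ) : ℂ) / n by push_cast; ring, ih] at h
    rw [← mul_right_inj' (e_ne_zero (-((β : ℂ) / n))), ← h, ← mul_assoc, ← e_add]
    congr 2
    push_cast
    ring

lemma relCoeff_add_int_mul_tau_div [NeZero n] (α β : ℤ) (z : ℂ) (j : ℤ) :
    relCoeff τ n η α β (z + j * τ / n) = e (j * η) * relCoeff τ n η (α - j) β z := by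
  induction j using Int.induction_on generalizing α with
  | zero => simp
  | succ j ih =>
    rw [show z + ((j + 1 : ℤ) : ℂ) * τ / n = z + ((j : ℤ) : ℂ) * τ / n + τ / n by push_cast; ring,
      relCoeff_add_tau_div, ih, ← mul_assoc, ← e_add, show α - (j + 1) = α - 1 - j by ring]
    congr 2
    push_cast
    ring
  | pred j ih =>
    have h := relCoeff_add_tau_div (τ := τ) (n := n) (η := η) (α + 1) β (z + ((-j - 1 : ℤ) : ℂ) * τ / n)
    rw [show z + ((-j - 1 : ℤ) : ℂ) * τ / n + τ / n = z + ((-j : ℤ) : ℂ) * τ / n by push_cast; ring,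
      ih, add_sub_cancel_right] at h
    rw [← mul_right_inj' (e_ne_zero η), ← h, ← mul_assoc, ← e_add,
      show α + 1 - -(j : ℤ) = α - (-j - 1) by ring]
    congr 2
    push_cast
    ring

lemma relCoeff_add_one [NeZero n] (α β : ℤ) (z : ℂ) :
    relCoeff τ n η α β (z + 1) = relCoeff τ n η α β z := by
  have hn0 : (n : ℂ) ≠ 0 := NeZero.ne _
  have h := relCoeff_add_int_div (τ := τ) (n := n) (η := η) α β z n
  rw [Int.cast_natCast, div_self hn0] at h
  rw [h, show -((n : ℂ) * β / n) = ((-β : ℤ) : ℂ) by push_cast; field_simp, e_int, one_mul]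

lemma relCoeff_add_tau [NeZero n] (α β : ℤ) (z : ℂ) :
    relCoeff τ n η α β (z + τ) = e (n * η) * relCoeff τ n η α β z := by
  have hn0 : (n : ℂ) ≠ 0 := NeZero.ne _
  have h := relCoeff_add_int_mul_tau_div (τ := τ) (n := n) (η := η) α β z n
  rw [Int.cast_natCast, mul_div_cancel_left₀ _ hn0] at h
  rw [h, relCoeff_congr (α' := α) (by simp)]

/-- The product `∏_{0 < l < n} θ(l/n)`. -/
noncomputable def torsionProd (τ : ℂ) (n : ℕ) : ℂ :=
  ∏ l ∈ Finset.range (n - 1), theta τ (((l + 1 : ℕ) : ℂ) / n)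

lemma torsionProd_ne_zero (hτ : 0 < τ.im) [NeZero n] : torsionProd τ n ≠ 0 := by
  refine Finset.prod_ne_zero_iff.2 fun l hl => ?_
  have hl' := Finset.mem_range.1 hl
  have hn0 : (n : ℝ) ≠ 0 := NeZero.ne _
  rw [Ne, theta_eq_zero_iff hτ, show ((l + 1 : ℕ) : ℂ) / n = (((l + 1 : ℕ) : ℝ) / (n : ℝ) : ℝ) by
    push_cast; rfl]
  refine not_mem_lattice_of_real hτ fun i hi => ?_
  rw [div_eq_iff hn0] at hi
  have hi' : ((l + 1 : ℕ) : ℤ) = i * n := by exact_mod_cast hi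
  have h1 : 0 < i := by by_contra hc; push_cast at hi'; nlinarith
  have h2 : ((l + 1 : ℕ) : ℤ) < n := by omega
  nlinarith

/-- In θ_0(-z) only the factor θ(-z) vanishes at 0, and the others tend to `torsionProd`. The two
values θ_β(η) cancel, so the limit does not depend on β. -/
lemma tendsto_relCoeff_zero (hτ : 0 < τ.im) [NeZero n] (hη : (n : ℂ) * η ∉ lattice τ) (β : ℤ) :
    Tendsto (fun z => z * relCoeff τ n η 0 β z) (𝓝[≠] 0)
      (𝓝 (-(1 / (deriv (theta τ) 0 * torsionProd τ n)))) := by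
  have hθ := continuous_theta hτ
  have hβ : thetaInt τ n β η ≠ 0 := thetaInt_ne_zero_of_notMem hτ β hη
  have hβc := (differentiable_thetaInt (n := n) hτ β).continuous
  have h1 := tendsto_div_theta hτ (s := -1) (by norm_num) 0
  let R : ℂ → ℂ := fun z => ∏ l ∈ Finset.range (n - 1), theta τ (-z + ((l + 1 : ℕ) : ℂ) / n)
  have hR : Continuous R := by fun_prop
  have hR0 : R 0 = torsionProd τ n := by simp [R, torsionProd]
  have h2 : ContinuousAt (fun z => thetaInt τ n β (η - z) / (thetaInt τ n β η * R z)) 0 := by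
    refine ContinuousAt.div (by fun_prop) (by fun_prop) ?_
    rw [hR0]
    exact mul_ne_zero hβ (torsionProd_ne_zero hτ)
  have h3 := (h2.tendsto.mono_left nhdsWithin_le_nhds).mul h1
  have h4 : thetaInt τ n β (η - 0) / (thetaInt τ n β η * R 0) * (1 / (-1 * deriv (theta τ) 0)) =
      -(1 / (deriv (theta τ) 0 * torsionProd τ n)) := by
    rw [hR0, sub_zero, div_mul_cancel_left₀ hβ]
    simp only [one_div, mul_inv, neg_mul, one_mul, inv_neg]
    ring
  rw [h4] at h3
  refine h3.congr fun z => ?_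
  have h5 : thetaInt τ n 0 (-z) = theta τ (-z) * R z := by
    obtain ⟨N, hN⟩ := Nat.exists_eq_succ_of_ne_zero (NeZero.ne n)
    simp only [thetaInt, R, Int.cast_zero, zero_div, zero_mul, add_zero, e_zero, mul_one]
    have h6 := Finset.prod_range_succ' (fun l : ℕ => theta τ (-z + (l : ℂ) / n)) N
    rw [← Nat.succ_eq_add_one, ← hN] at h6
    rw [h6, show n - 1 = N by omega, mul_comm]
    simp
  rw [relCoeff, zero_add, h5, sub_zero, neg_one_mul]
  ring

/-- The residue of the coefficient at a point of `Γ/n`. -/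
lemma tendsto_relCoeff (hτ : 0 < τ.im) [NeZero n] (hη : (n : ℂ) * η ∉ lattice τ) (α β : ℤ)
    {z₀ : ℂ} {i j : ℤ} (hz₀ : z₀ = (i + j * τ) / n) (hα : (α : ZMod n) = j) :
    Tendsto (fun z => (z - z₀) * relCoeff τ n η α β z) (𝓝[≠] z₀)
      (𝓝 (-(e (j * η - i * β / n) / (deriv (theta τ) 0 * torsionProd τ n)))) := by
  have hmap : Tendsto (fun w : ℂ => w - z₀) (𝓝[≠] z₀) (𝓝[≠] 0) := by
    refine tendsto_nhdsWithin_iff.2 ⟨?_, ?_⟩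
    · have : ContinuousAt (fun w : ℂ => w - z₀) z₀ := by fun_prop
      simpa [ContinuousAt] using this.mono_left nhdsWithin_le_nhds
    · filter_upwards [self_mem_nhdsWithin] with w hw
      simpa [sub_eq_zero] using hw
  have h := ((tendsto_relCoeff_zero hτ hη β).comp hmap).const_mul (e (j * η - i * β / n))
  rw [mul_neg, mul_one_div] at h
  refine h.congr fun z => ?_
  have h1 := relCoeff_add_int_div (τ := τ) (n := n) (η := η) α β (z - z₀ + j * τ / n) i
  have h2 := relCoeff_add_int_mul_tau_div (τ := τ) (n := n) (η := η) α β (z - z₀) j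
  rw [show z - z₀ + j * τ / n + i / n = z by rw [hz₀]; ring, h2, ← mul_assoc, ← e_add,
    relCoeff_congr (α := α - j) (α' := 0) (by push_cast; rw [hα, sub_self])] at h1
  rw [h1, show -((i : ℂ) * β / n) + j * η = j * η - i * β / n by ring]
  simp only [Function.comp]
  ring

lemma continuousAt_relCoeff (hτ : 0 < τ.im) [NeZero n] (hη : (n : ℂ) * η ∉ lattice τ) (α β : ℤ)
    {z₀ : ℂ} (h : ∀ i j : ℤ, (j : ZMod n) = α → n * z₀ ≠ i + j * τ) :
    ContinuousAt (relCoeff τ n η α β) z₀ := by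
  have h1 := (differentiable_thetaInt (n := n) hτ (α + β)).continuous
  have h2 := (differentiable_thetaInt (n := n) hτ α).continuous
  refine ContinuousAt.div (by fun_prop) (by fun_prop)
    (mul_ne_zero (thetaInt_ne_zero_of_notMem hτ β hη) (thetaInt_ne_zero hτ fun i s hs hz => ?_))
  refine h (-i) (-s) (by push_cast; rw [hs, neg_neg]) ?_
  push_cast
  linear_combination -hz

lemma meromorphicAt_relCoeff (hτ : 0 < τ.im) (α β : ℤ) (z : ℂ) :
    MeromorphicAt (relCoeff τ n η α β) z := by
  have h1 := differentiable_thetaInt (n := n) hτ (α + β)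
  have h2 := differentiable_thetaInt (n := n) hτ α
  have h3 : Differentiable ℂ fun z => thetaInt τ n (α + β) (η - z) := by fun_prop
  have h4 : Differentiable ℂ fun z => thetaInt τ n β η * thetaInt τ n α (-z) := by fun_prop
  exact (h3.analyticAt z).meromorphicAt.fun_div (h4.analyticAt z).meromorphicAt

end ThetaInt

/-! ### Arguments of the exchange relation with a spectral parameter -/

section Exchange

variable {p : ℕ}

lemma coord_add (x y : Fin (p + 1) → ℂ) (j : ℕ) : coord (x + y) j = coord x j + coord y j := by
  cases j with
  | zero => simp [coord]
  | succ j => simp only [coord, Pi.add_apply]; split_ifs <;> simp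

lemma coord_smul (c : ℂ) (x : Fin (p + 1) → ℂ) (j : ℕ) : coord (c • x) j = c * coord x j := by
  cases j with
  | zero => simp [coord]
  | succ j => simp only [coord, Pi.smul_apply, smul_eq_mul]; split_ifs <;> simp

lemma coord_sub (x y : Fin (p + 1) → ℂ) (j : ℕ) : coord (x - y) j = coord x j - coord y j := by
  have h := coord_add (x - y) y j
  rw [sub_add_cancel] at h
  rw [h, add_sub_cancel_right]

variable (m : Fin (p + 1) → ℕ)

lemma contBefore_last_succ : contBefore m (p + 2) = contAfter m 0 := by
  have h := casoratian m (p + 1) le_rfl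
  rwa [contAfter_last, contAfter_last_succ, one_mul, zero_mul, sub_zero] at h

lemma coord_beforeVec {j : ℕ} (hj : j ≤ p + 1) :
    coord (icast (beforeVec m)) j = contBefore m j := by
  cases j with
  | zero => simp [coord, contBefore]
  | succ j => exact coord_succ (icast (beforeVec m)) ⟨j, by omega⟩

/-- The vector of the continuants `A` cut off below position `t`. -/
noncomputable def tailVec (t : ℕ) : Fin (p + 1) → ℤ := fun i => if i.val < t then 0 else afterVec m i

lemma coord_tailVec {t j : ℕ} (hj : j ≤ p + 2) :
    coord (icast (tailVec m t)) j = if j ≤ t then 0 else (contAfter m j : ℂ) := by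
  cases j with
  | zero => simp [coord]
  | succ j =>
    by_cases h : j < p + 1
    · rw [show coord (icast (tailVec m t)) (j + 1) = icast (tailVec m t) ⟨j, h⟩ from
        coord_succ (icast (tailVec m t)) ⟨j, h⟩]
      simp only [icast, tailVec, afterVec, Nat.succ_le_iff]
      split_ifs <;> simp
    · obtain rfl : j = p + 1 := by omega
      rw [coord_last_succ, contAfter_last_succ, Int.cast_zero, ite_self]

/-- Away from the cut the recursion of A gives zero; only the one-based positions t and t + 1
adjacent to the cut survive. -/
lemma cfMatrix_mulVec_tailVec {t : ℕ} (i : Fin (p + 1)) :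
    (cfMatrix m *ᵥ icast (tailVec m t)) i =
      (if i.val + 1 = t + 1 then (contAfter m t : ℂ) else 0) -
        if i.val + 1 = t then (contAfter m (t + 1) : ℂ) else 0 := by
  have hi := i.2
  have h := congrArg (Int.cast : ℤ → ℂ) (contAfter_rec m i)
  push_cast at h
  rw [cfMatrix_mulVec, ← coord_succ (icast (tailVec m t)), coord_tailVec m (by omega), coord_tailVec m (by omega),
    coord_tailVec m (by omega)]
  rcases lt_trichotomy i.val t with h1 | h1 | h1
  · by_cases h2 : i.val + 1 = t
    · subst h2
      simp
    · rw [if_pos (by omega), if_pos (by omega), if_pos (by omega), if_neg (by omega),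
        if_neg (by omega)]
      simp
  · subst h1
    simp only [add_le_iff_nonpos_right, if_true, le_refl, h]
    simp
  · rw [if_neg (by omega), if_neg (by omega), if_neg (by omega), if_neg (by omega),
      if_neg (by omega), h]
    ring

lemma tailVec_dotProduct (t : ℕ) (w : Fin (p + 1) → ℂ) :
    icast (tailVec m t) ⬝ᵥ (cfMatrix m *ᵥ w) =
      contAfter m t * coord w (t + 1) - contAfter m (t + 1) * coord w t := by
  rw [dotProduct_mulVec, ← mulVec_transpose, cfMatrix_isSymm]
  simp only [dotProduct, cfMatrix_mulVec_tailVec, sub_mul, ite_mul, zero_mul]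
  rw [Finset.sum_sub_distrib, coord_eq_sum, coord_eq_sum, Finset.mul_sum, Finset.mul_sum]
  simp only [mul_ite, mul_zero]

/-- The vector `(x_1, …, x_t, y_{t+1}, …)`. -/
def spliceAt (t : ℕ) (x y : Fin (p + 1) → ℂ) : Fin (p + 1) → ℂ :=
  fun i => if i.val < t then x i else y i

lemma coord_spliceAt (t : ℕ) (x y : Fin (p + 1) → ℂ) (j : ℕ) :
    coord (spliceAt t x y) j = if j ≤ t then coord x j else coord y j := by
  cases j with
  | zero => simp [coord]
  | succ j => simp only [coord, spliceAt, Nat.succ_le_iff]; split_ifs <;> rfl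

variable (η : ℂ) (U v : Fin (p + 1) → ℂ)

/-- The arguments of the Kronecker functions in the exchange relation, as functions of the
spectral parameter. -/
noncomputable def xCoord (j : ℕ) (z : ℂ) : ℂ :=
  -- As A_{p+2} = 0, the exceptional value is constant, equal to -nη when A_0 = n, and produces no
  -- poles if nη ∉ Γ; at j = 0 what remains is -nz.
  (if j = p + 2 then -(contAfter m 0 * η) else coord (v - U) j) - z * contAfter m j

/-- With U = u - ηA and z = η the uncut coordinates return to u. The shift in `rightPt` is opposite,
so the sum of the two points depends on neither z nor t. -/
noncomputable def leftPt (t : ℕ) (z : ℂ) : Fin (p + 1) → ℂ :=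
  spliceAt t v U + z • icast (tailVec m t)

noncomputable def rightPt (t : ℕ) (z : ℂ) : Fin (p + 1) → ℂ :=
  spliceAt t U v + η • icast (beforeVec m) - z • icast (tailVec m t)

variable {m η U v}

lemma xCoord_add (j : ℕ) (z c : ℂ) :
    xCoord m η U v j (z + c) = xCoord m η U v j z - c * contAfter m j := by
  simp only [xCoord]; ring

lemma leftPt_add (t : ℕ) (z c : ℂ) :
    leftPt m U v t (z + c) = leftPt m U v t z + c • icast (tailVec m t) := by
  simp only [leftPt]; module

lemma rightPt_add (t : ℕ) (z c : ℂ) :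
    rightPt m η U v t (z + c) = rightPt m η U v t z + c • icast (-tailVec m t) := by
  simp only [rightPt, icast_neg]; module

lemma coord_rightPt_sub_leftPt_of_le {t j : ℕ} (hj : j ≤ t) (ht : t ≤ p + 1) (z : ℂ) :
    coord (rightPt m η U v t z - leftPt m U v t z) j =
      -xCoord m η U v j z - z * contAfter m j + η * contBefore m j := by
  simp only [rightPt, leftPt, coord_sub, coord_add, coord_smul, coord_spliceAt, if_pos hj,
    coord_tailVec m (show j ≤ p + 2 by omega), coord_beforeVec m (show j ≤ p + 1 by omega), xCoord,
    if_neg (show j ≠ p + 2 by omega)]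
  ring

/-- At j = p + 2 this reads 0 = -A_0 η + η B_{p+2}, which is why `xCoord` has its exceptional value
there. -/
lemma coord_rightPt_sub_leftPt_of_lt {t j : ℕ} (hj : t < j) (hj' : j ≤ p + 2) (z : ℂ) :
    coord (rightPt m η U v t z - leftPt m U v t z) j =
      xCoord m η U v j z - z * contAfter m j + η * contBefore m j := by
  by_cases h : j = p + 2
  · subst h
    simp only [coord_last_succ, xCoord, if_true, contAfter_last_succ, contBefore_last_succ]
    push_cast
    ring
  · simp only [rightPt, leftPt, coord_sub, coord_add, coord_smul, coord_spliceAt,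
      if_neg (not_le.2 hj), coord_tailVec m hj', coord_beforeVec m (show j ≤ p + 1 by omega), xCoord,
      if_neg h]
    ring

/-- Consecutive points differ in one coordinate, by exactly the quantity whose vanishing modulo Γ
gives the common pole. At the pole they differ by a lattice vector, so automorphy compares the two
summands. -/
lemma leftPt_succ (i : Fin (p + 1)) (z : ℂ) :
    leftPt m U v (i + 1) z =
      leftPt m U v i z + xCoord m η U v (i + 1) z • Pi.single i 1 := by
  ext s
  simp only [leftPt, Pi.add_apply, Pi.smul_apply, spliceAt, icast, tailVec, smul_eq_mul, xCoord,
    if_neg (show i.val + 1 ≠ p + 2 by omega), coord_succ, afterVec, Pi.sub_apply]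
  rcases lt_trichotomy s.val i.val with h | h | h
  · rw [if_pos (by omega), if_pos (by omega), if_pos (by omega), if_pos (by omega),
      Pi.single_eq_of_ne (fun hc => by subst hc; omega)]
    simp
  · obtain rfl : s = i := Fin.ext h
    simp
  · rw [if_neg (by omega), if_neg (by omega), if_neg (by omega), if_neg (by omega),
      Pi.single_eq_of_ne (fun hc => by subst hc; omega)]
    simp

lemma rightPt_eq_succ_add (i : Fin (p + 1)) (z : ℂ) :
    rightPt m η U v i z =
      rightPt m η U v (i + 1) z + xCoord m η U v (i + 1) z • Pi.single i 1 := by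
  have h1 := leftPt_succ (m := m) (η := η) (U := U) (v := v) i z
  have h2 : ∀ t, leftPt m U v t z + rightPt m η U v t z = U + v + η • icast (beforeVec m) := by
    intro t
    ext s
    simp only [leftPt, rightPt, Pi.add_apply, Pi.sub_apply, spliceAt]
    split_ifs <;> ring
  have h3 := h2 i
  rw [← h2 (i + 1), h1, add_right_comm, add_assoc] at h3
  exact add_left_cancel h3

end Exchange

/-! ### Quasi-periodicity and residues of the exchange summands -/

section Terms

variable {p : ℕ} (m : Fin (p + 1) → ℕ) (τ η : ℂ) (U v : Fin (p + 1) → ℂ)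
  (f g : (Fin (p + 1) → ℂ) → ℂ)

/-- The summands of the exchange relation evaluated on theta functions, as functions of the
spectral parameter. -/
noncomputable def exchangeTerm (t : ℕ) (z : ℂ) : ℂ :=
  kron τ (xCoord m η U v t z) (-xCoord m η U v (t + 1) z) *
    (f (leftPt m U v t z) * g (rightPt m η U v t z))

variable {m τ η U v f g}

lemma exchangeTerm_add_one (hf : f ∈ thetaSpace τ m) (hg : g ∈ thetaSpace τ m) (t : ℕ) (z : ℂ) :
    exchangeTerm m τ η U v f g t (z + 1) = exchangeTerm m τ η U v f g t z := by
  rw [mem_thetaSpace_iff] at hf hg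
  have h := kron_add_int (τ := τ) (xCoord m η U v t z) (-xCoord m η U v (t + 1) z)
    (-contAfter m t) (contAfter m (t + 1))
  rw [exchangeTerm, exchangeTerm, leftPt_add, rightPt_add, one_smul, one_smul, hf.2.add_int,
    hg.2.add_int, xCoord_add, xCoord_add, ← h]
  congr 2
  · push_cast; ring
  · ring

/-- The theta factors contribute T·M(right - left) - τ T·MT, with T the vector A cut at t. The
dependence on the coordinates cancels against the Kronecker factor, leaving η times the Casoratian,
the same for all t. -/
lemma exchangeTerm_add_tau (hf : f ∈ thetaSpace τ m) (hg : g ∈ thetaSpace τ m) {t : ℕ}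
    (ht : t ≤ p + 1) (z : ℂ) :
    exchangeTerm m τ η U v f g t (z + τ) =
      e (contAfter m 0 * η) * exchangeTerm m τ η U v f g t z := by
  rw [mem_thetaSpace_iff] at hf hg
  have h := kron_add_int_mul_tau (τ := τ) (xCoord m η U v t z) (-xCoord m η U v (t + 1) z)
    (-contAfter m t) (contAfter m (t + 1))
  have hc := congrArg (Int.cast : ℤ → ℂ) (casoratian m t ht)
  have h1 := tailVec_dotProduct m t (rightPt m η U v t z - leftPt m U v t z)
  rw [coord_rightPt_sub_leftPt_of_lt (Nat.lt_succ_self t) (by omega),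
    coord_rightPt_sub_leftPt_of_le le_rfl ht, mulVec_sub, dotProduct_sub] at h1
  have h2 := tailVec_dotProduct m t (icast (tailVec m t))
  rw [coord_tailVec m (by omega), coord_tailVec m (by omega), if_pos le_rfl,
    if_neg (by omega)] at h2
  rw [exchangeTerm, exchangeTerm, leftPt_add, rightPt_add, hf.2.add_tau,
    hg.2.add_tau, xCoord_add, xCoord_add,
    show xCoord m η U v t z - τ * contAfter m t =
      xCoord m η U v t z + ((-contAfter m t : ℤ) : ℂ) * τ by push_cast; ring,
    show -(xCoord m η U v (t + 1) z - τ * contAfter m (t + 1)) =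
      -xCoord m η U v (t + 1) z + contAfter m (t + 1) * τ by ring, h]
  rw [mul_mul_mul_comm (e _) _ (e _), mul_mul_mul_comm (e _) _ (_ * _), ← e_add, ← e_add]
  congr 2
  simp only [autExp, icast_neg, neg_dotProduct, mulVec_neg, dotProduct_neg, neg_neg]
  push_cast at hc ⊢
  linear_combination h1 - τ * h2 + η * hc

lemma continuousAt_xCoord (t : ℕ) (z : ℂ) : ContinuousAt (xCoord m η U v t) z := by
  unfold xCoord
  fun_prop

lemma differentiable_leftPt (t : ℕ) : Differentiable ℂ (leftPt m U v t) := by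
  unfold leftPt
  fun_prop

lemma differentiable_rightPt (t : ℕ) : Differentiable ℂ (rightPt m η U v t) := by
  unfold rightPt
  fun_prop

lemma differentiable_mul_leftPt_rightPt (hf : Differentiable ℂ f) (hg : Differentiable ℂ g) (t : ℕ) :
    Differentiable ℂ fun z => f (leftPt m U v t z) * g (rightPt m η U v t z) :=
  (hf.comp (differentiable_leftPt t)).mul (hg.comp (differentiable_rightPt t))

lemma meromorphicAt_exchangeTerm (hτ : 0 < τ.im) (hf : Differentiable ℂ f)
    (hg : Differentiable ℂ g) (t : ℕ) (z : ℂ) :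
    MeromorphicAt (exchangeTerm m τ η U v f g t) z := by
  have hx : ∀ t, Differentiable ℂ (xCoord m η U v t) := fun t => by unfold xCoord; fun_prop
  have hθ := differentiable_theta hτ
  have h1 := hx t
  have h2 := hx (t + 1)
  have h3 : Differentiable ℂ fun z => theta τ (xCoord m η U v t z + -xCoord m η U v (t + 1) z) := by
    fun_prop
  have h4 : Differentiable ℂ fun z => theta τ (xCoord m η U v t z) *
    theta τ (-xCoord m η U v (t + 1) z) := by fun_prop
  exact ((h3.analyticAt z).meromorphicAt.fun_div (h4.analyticAt z).meromorphicAt).fun_mul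
    ((differentiable_mul_leftPt_rightPt hf hg t).analyticAt z).meromorphicAt

lemma theta_neg_ne_zero {x : ℂ} (h : theta τ x ≠ 0) : theta τ (-x) ≠ 0 := by
  rw [theta_neg]
  exact mul_ne_zero (neg_ne_zero.2 (e_ne_zero _)) h

lemma continuousAt_exchangeTerm (hτ : 0 < τ.im) (hf : Differentiable ℂ f)
    (hg : Differentiable ℂ g) {t : ℕ} {z : ℂ} (h1 : theta τ (xCoord m η U v t z) ≠ 0)
    (h2 : theta τ (xCoord m η U v (t + 1) z) ≠ 0) :
    ContinuousAt (exchangeTerm m τ η U v f g t) z :=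
  (continuousAt_kron hτ (continuousAt_xCoord _ _) (continuousAt_xCoord _ _).neg h1
    (theta_neg_ne_zero h2)).mul (differentiable_mul_leftPt_rightPt hf hg t).continuous.continuousAt

/-- The residues of consecutive terms cancel. -/
lemma exists_tendsto_exchangeTerm (hτ : 0 < τ.im) (hm : ∀ i, 2 ≤ m i) (hf : f ∈ thetaSpace τ m)
    (hg : g ∈ thetaSpace τ m) {i : Fin (p + 1)} {z₀ : ℂ}
    (h : xCoord m η U v (i + 1) z₀ ∈ lattice τ) (h1 : theta τ (xCoord m η U v i z₀) ≠ 0)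
    (h2 : theta τ (xCoord m η U v (i + 2) z₀) ≠ 0) :
    ∃ c, Tendsto (fun z => (z - z₀) * exchangeTerm m τ η U v f g i z) (𝓝[≠] z₀) (𝓝 c) ∧
      Tendsto (fun z => (z - z₀) * exchangeTerm m τ η U v f g (i + 1) z) (𝓝[≠] z₀) (𝓝 (-c)) := by
  rw [mem_thetaSpace_iff] at hf hg
  obtain ⟨a, b, hab⟩ := mem_lattice.1 h
  have hA : (contAfter m (i + 1) : ℂ) ≠ 0 := by
    exact_mod_cast (contAfter_pos hm (show i.val + 1 ≤ p + 1 by omega)).ne'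
  have hx : ∀ z, xCoord m η U v (i + 1) z = a + b * τ + -(contAfter m (i + 1) : ℂ) * (z - z₀) := by
    intro z
    rw [← hab, show z = z₀ + (z - z₀) by ring, xCoord_add]
    ring
  have hx' : ∀ z, -xCoord m η U v (i + 1) z =
      ((-a : ℤ) : ℂ) + ((-b : ℤ) : ℂ) * τ + contAfter m (i + 1) * (z - z₀) := by
    intro z
    rw [hx]
    push_cast
    ring
  have hF : ∀ t, Tendsto (fun z => f (leftPt m U v t z) * g (rightPt m η U v t z)) (𝓝[≠] z₀)
      (𝓝 (f (leftPt m U v t z₀) * g (rightPt m η U v t z₀))) := fun t =>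
    ((differentiable_mul_leftPt_rightPt hf.1 hg.1 t).continuous.continuousAt.tendsto).mono_left
      nhdsWithin_le_nhds
  have t1 := (tendsto_kron_right hτ hA hx' (continuousAt_xCoord i z₀) h1).mul (hF i)
  have t2 := (tendsto_kron_left hτ (neg_ne_zero.2 hA) hx (continuousAt_xCoord (i + 2) z₀).neg
    (theta_neg_ne_zero h2)).mul (hF (i + 1))
  refine ⟨_, t1.congr fun z => by rw [exchangeTerm]; ring,
    (t2.congr fun z => by rw [exchangeTerm, Pi.neg_apply]; ring).trans (le_of_eq (congrArg 𝓝 ?_))⟩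
  have hs : ∀ w : Fin (p + 1) → ℂ, w + xCoord m η U v (i + 1) z₀ • Pi.single i 1 =
      w + τ • icast (Pi.single i b) + icast (Pi.single i a) := by
    intro w
    ext s
    by_cases hsi : s = i
    · subst hsi
      simp only [Pi.add_apply, Pi.smul_apply, icast, Pi.single_eq_same, smul_eq_mul, hab]
      ring
    · simp [icast, Pi.single_eq_of_ne hsi]
  have hl := leftPt_succ (m := m) (η := η) (U := U) (v := v) i z₀
  have hr := rightPt_eq_succ_add (m := m) (η := η) (U := U) (v := v) i z₀
  rw [hs] at hl hr
  have e1 := congrArg f hl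
  have e2 := congrArg g hr
  rw [hf.2.add_int, hf.2.add_tau] at e1
  rw [hg.2.add_int, hg.2.add_tau] at e2
  have hA0 := congrArg (Int.cast : ℤ → ℂ) (contAfter_rec m i)
  have hB0 := congrArg (Int.cast : ℤ → ℂ) (contBefore_rec m i)
  -- The multipliers of f and g under the lattice shift differ by this row of M, and the residues of
  -- the Kronecker factors differ by e(b x_i) against e(b x_{i+2}). The recursions of A and B make
  -- the two discrepancies equal.
  have c1 : (cfMatrix m *ᵥ (rightPt m η U v (i + 1) z₀ - leftPt m U v i z₀)) i =
      xCoord m η U v i z₀ - xCoord m η U v (i + 2) z₀ := by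
    rw [show rightPt m η U v (i + 1) z₀ - leftPt m U v i z₀ =
        rightPt m η U v i z₀ - leftPt m U v i z₀ - xCoord m η U v (i + 1) z₀ • Pi.single i 1 by
      rw [rightPt_eq_succ_add (m := m) (η := η) (U := U) (v := v) i z₀]; abel, mulVec_sub,
      mulVec_smul, mulVec_single_one, Pi.sub_apply, cfMatrix_mulVec,
      ← coord_succ (rightPt m η U v i z₀ - leftPt m U v i z₀),
      coord_rightPt_sub_leftPt_of_lt (j := i.val + 1) (by omega) (by omega),
      coord_rightPt_sub_leftPt_of_lt (j := i.val + 2) (by omega) (by omega),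
      coord_rightPt_sub_leftPt_of_le le_rfl (by omega)]
    simp only [cfMatrix, Pi.smul_apply, col_apply, of_apply, if_true, smul_eq_mul]
    push_cast at hA0 hB0
    linear_combination z₀ * hA0 - η * hB0
  have c2 : icast (Pi.single i b) ⬝ᵥ
      (cfMatrix m *ᵥ (rightPt m η U v (i + 1) z₀ - leftPt m U v i z₀)) =
      b * (xCoord m η U v i z₀ - xCoord m η U v (i + 2) z₀) := by
    rw [← c1, show icast (Pi.single i b) = (Pi.single i (b : ℂ) : Fin (p + 1) → ℂ) by
      ext s
      by_cases hsi : s = i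
      · subst hsi; simp [icast]
      · simp [icast, Pi.single_eq_of_ne hsi], single_dotProduct]
  rw [mulVec_sub, dotProduct_sub] at c2
  have c3 : e (b * xCoord m η U v (i + 2) z₀) *
      e (autExp τ (cfMatrix m) (thetaGamma m τ) (Pi.single i b) (leftPt m U v i z₀)) =
      e (b * xCoord m η U v i z₀) *
      e (autExp τ (cfMatrix m) (thetaGamma m τ) (Pi.single i b) (rightPt m η U v (i + 1) z₀)) := by
    rw [← e_add, ← e_add]
    congr 1
    simp only [autExp]
    linear_combination c2
  rw [e1, e2]
  simp only [Pi.neg_apply, Int.cast_neg, neg_mul, mul_neg, neg_neg]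
  have hd := deriv_theta_zero_ne_zero hτ
  field_simp
  linear_combination (-(f (leftPt m U v i z₀) * g (rightPt m η U v (i + 1) z₀))) * c3

end Terms

/-! ### Heisenberg translations of the basis and the residue of the first summand -/

section Heisenberg

variable {p : ℕ} {m : Fin (p + 1) → ℕ} {τ φ : ℂ} {n κ : ℕ} {w : ZMod n → (Fin (p + 1) → ℂ) → ℂ}

lemma IsThetaBasis.mem (hw : IsThetaBasis τ n κ m φ w) (a : ZMod n) : w a ∈ thetaSpace τ m :=
  hw.span_eq ▸ Submodule.subset_span ⟨a, rfl⟩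

lemma IsThetaBasis.differentiable (hw : IsThetaBasis τ n κ m φ w) (a : ZMod n) :
    Differentiable ℂ (w a) :=
  (hw.mem a).1

lemma IsThetaBasis.apply_add_int_smul (hw : IsThetaBasis τ n κ m φ w) (a : ZMod n)
    (z : Fin (p + 1) → ℂ) (i : ℤ) :
    w a (z + (i : ℂ) • shiftVec n m) = e (i * (κ / n * a.val)) * w a z := by
  have h1 : ∀ z, w a (z + shiftVec n m) = e (κ / n * a.val) * w a z := fun z => by
    rw [← opT_apply (w a), hw.opT_eq, Pi.smul_apply, smul_eq_mul]
  induction i using Int.induction_on with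
  | zero => simp
  | succ i ih =>
    rw [show z + (((i : ℤ) + 1 : ℤ) : ℂ) • shiftVec n m =
      z + ((i : ℤ) : ℂ) • shiftVec n m + shiftVec n m by push_cast; module, h1, ih, ← mul_assoc,
      ← e_add]
    congr 2
    push_cast
    ring
  | pred i ih =>
    have h := h1 (z + ((-(i : ℤ) - 1 : ℤ) : ℂ) • shiftVec n m)
    rw [show z + ((-(i : ℤ) - 1 : ℤ) : ℂ) • shiftVec n m + shiftVec n m =
      z + ((-(i : ℤ) : ℤ) : ℂ) • shiftVec n m by push_cast; module, ih] at h
    rw [← mul_right_inj' (e_ne_zero ((κ : ℂ) / n * a.val)), ← h, ← mul_assoc (e _), ← e_add]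
    congr 2
    push_cast
    ring

lemma IsThetaBasis.apply_add_tau_smul (hw : IsThetaBasis τ n κ m φ w) (a : ZMod n)
    (z : Fin (p + 1) → ℂ) (j : ℤ) :
    w a (z + (j * τ) • shiftVec n m) =
      e (-(j * (z 0 + φ)) - j * (j - 1) / 2 * shiftVec n m 0 * τ) * w (a + j) z := by
  have h1 : ∀ a z, w (a + 1) z = e (z 0 + φ) * w a (z + τ • shiftVec n m) := fun a z => by
    rw [← hw.opTτ_eq, opTτ_apply]
  induction j using Int.induction_on generalizing a with
  | zero => simp
  | succ j ih =>
    have h2 := h1 a (z + (((j : ℤ) : ℂ) * τ) • shiftVec n m)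
    rw [show z + (((j : ℤ) : ℂ) * τ) • shiftVec n m + τ • shiftVec n m =
      z + ((((j : ℤ) + 1 : ℤ) : ℂ) * τ) • shiftVec n m by push_cast; module, ih] at h2
    rw [← mul_right_inj' (e_ne_zero _), ← h2, ← mul_assoc, ← e_add,
      show a + ((j + 1 : ℤ) : ZMod n) = a + 1 + (j : ℤ) by push_cast; ring]
    congr 2
    simp only [Pi.add_apply, Pi.smul_apply, smul_eq_mul]
    push_cast
    ring
  | pred j ih =>
    have h2 := h1 (a - 1) (z + (((-(j : ℤ) - 1 : ℤ) : ℂ) * τ) • shiftVec n m)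
    have h3 := ih (a - 1)
    rw [show z + (((-(j : ℤ) - 1 : ℤ) : ℂ) * τ) • shiftVec n m + τ • shiftVec n m =
      z + (((-(j : ℤ) : ℤ) : ℂ) * τ) • shiftVec n m by push_cast; module, h3, sub_add_cancel] at h2
    rw [h2, ← mul_assoc, ← e_add,
      show a + ((-(j : ℤ) - 1 : ℤ) : ZMod n) = a - 1 + ((-(j : ℤ) : ℤ) : ZMod n) by push_cast; ring]
    congr 2
    simp only [Pi.add_apply, Pi.smul_apply, smul_eq_mul]
    push_cast
    ring

/-- The residue of the first term of the exchange relation. -/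
lemma IsThetaBasis.tendsto_exchangeTerm_zero [NeZero n] {η : ℂ} {U v : Fin (p + 1) → ℂ}
    (hτ : 0 < τ.im) (hn : contAfter m 0 = n) (h1 : contAfter m 1 = κ)
    (hw : IsThetaBasis τ n κ m φ w) (a b : ZMod n) {z₀ : ℂ} {i j : ℤ}
    (hz₀ : n * z₀ = i + j * τ) (hx : theta τ (xCoord m η U v 1 z₀) ≠ 0) :
    Tendsto (fun z => (z - z₀) * exchangeTerm m τ η U v (w a) (w b) 0 z) (𝓝[≠] z₀)
      (𝓝 (-(e (j * η + κ / n * (i * (a - b + j).val : ℤ)) / (n * deriv (theta τ) 0)) *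
        (w (a + j) U * w (b - j) (v + η • icast (beforeVec m))))) := by
  have hn0 : (n : ℂ) ≠ 0 := NeZero.ne _
  have hx0 : ∀ z, xCoord m η U v 0 z =
      ((-i : ℤ) : ℂ) + ((-j : ℤ) : ℂ) * τ + -(n : ℂ) * (z - z₀) := by
    intro z
    simp only [xCoord, if_neg (show 0 ≠ p + 2 by omega), coord_zero, hn]
    push_cast
    linear_combination -hz₀
  have t1 := (tendsto_kron_left hτ (neg_ne_zero.2 hn0) hx0 (continuousAt_xCoord 1 z₀).neg
    (theta_neg_ne_zero hx)).mul (((differentiable_mul_leftPt_rightPt (η := η) (U := U) (v := v)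
      (m := m) (hw.differentiable a)
      (hw.differentiable b) 0).continuous.continuousAt.tendsto).mono_left nhdsWithin_le_nhds)
  refine (t1.congr fun z => by rw [exchangeTerm, Pi.neg_apply, zero_add]; ring).trans
    (le_of_eq (congrArg 𝓝 ?_))
  -- At a point of Γ/n the shift z₀A = (i + jτ)r is a Heisenberg translation, so w_a and w_b turn
  -- into w_{a+j}(U) and w_{b-j}(V).
  have hr : z₀ • icast (afterVec m) = ((j : ℂ) * τ) • shiftVec n m + (i : ℂ) • shiftVec n m := by
    rw [← nat_smul_shiftVec (n := n), smul_smul, mul_comm, hz₀]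
    module
  have ht : tailVec m 0 = afterVec m := by ext s; simp [tailVec]
  have hs : ∀ x y : Fin (p + 1) → ℂ, spliceAt 0 x y = y := fun x y => by ext s; simp [spliceAt]
  have hl : leftPt m U v 0 z₀ = U + ((j : ℂ) * τ) • shiftVec n m + (i : ℂ) • shiftVec n m := by
    rw [leftPt, hs, ht, hr, add_assoc]
  have hr' : rightPt m η U v 0 z₀ = v + η • icast (beforeVec m) +
      (((-j : ℤ) : ℂ) * τ) • shiftVec n m + ((-i : ℤ) : ℂ) • shiftVec n m := by
    rw [rightPt, hs, ht, hr]
    push_cast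
    module
  have hr0 : shiftVec n m 0 = κ / n := by
    simp only [shiftVec_eq, Pi.smul_apply, icast, afterVec, smul_eq_mul, Fin.val_zero, zero_add, h1]
    push_cast
    ring
  have hB : (v + η • icast (beforeVec m)) 0 = v 0 + η := by
    simp [icast, beforeVec, contBefore_one]
  have hx1 : xCoord m η U v 1 z₀ = v 0 - U 0 - (i + j * τ) * (κ / n) := by
    have h2 : coord (v - U) 1 = v 0 - U 0 := coord_succ (v - U) 0
    rw [xCoord, if_neg (by omega), h2, h1, ← hz₀]
    push_cast
    field_simp
  -- The chosen representative of a - b + j is irrelevant: e(κ·/n) depends only on the class modulo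
  -- n.
  have hval : e (κ / n * (i * (a - b + j).val : ℤ)) =
      e (κ / n * (i * (a.val - b.val + j) : ℤ)) := by
    refine e_div_mul_congr κ ?_
    push_cast
    simp
  have he : e (-(((-j : ℤ) : ℂ) * (-xCoord m η U v 1) z₀)) * (e (i * (κ / n * a.val)) *
      e (-(j * (U 0 + φ)) - j * (j - 1) / 2 * shiftVec n m 0 * τ) *
      (e (((-i : ℤ) : ℂ) * (κ / n * b.val)) * e (-(((-j : ℤ) : ℂ) * ((v + η • icast (beforeVec m)) 0 + φ)) -
        ((-j : ℤ) : ℂ) * (((-j : ℤ) : ℂ) - 1) / 2 * shiftVec n m 0 * τ))) =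
      e (j * η + κ / n * (i * (a - b + j).val : ℤ)) := by
    rw [e_add (j * η), hval]
    simp only [← e_add]
    congr 1
    rw [hr0, hB, Pi.neg_apply, hx1]
    push_cast
    ring
  rw [hl, hr', hw.apply_add_int_smul, hw.apply_add_tau_smul, hw.apply_add_int_smul,
    hw.apply_add_tau_smul, ← he, Int.cast_neg (R := ZMod n), ← sub_eq_add_neg, neg_mul (n : ℂ), div_neg]
  ring

end Heisenberg

/-! ### The exchange identity for generic parameters -/

section Identity

variable {p : ℕ} {m : Fin (p + 1) → ℕ} {τ φ η : ℂ} {n κ k : ℕ}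
  {w : ZMod n → (Fin (p + 1) → ℂ) → ℂ} {U v : Fin (p + 1) → ℂ}

/-- The combination of products `w_c(U) w_d(V)` whose coefficients are those of the relations of
the elliptic algebra. -/
noncomputable def relSum (τ η : ℂ) (n k : ℕ) [NeZero n] (w : ZMod n → (Fin (p + 1) → ℂ) → ℂ)
    (a b : ZMod n) (U V : Fin (p + 1) → ℂ) (z : ℂ) : ℂ :=
  ∑ r : ZMod n, relCoeff τ n η ((b - a + r).val : ℤ) ((k * r).val : ℤ) z *
    (w (b + r) U * w (a - r) V)

lemma relSum_add_one [NeZero n] (a b : ZMod n) (U V : Fin (p + 1) → ℂ) (z : ℂ) :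
    relSum τ η n k w a b U V (z + 1) = relSum τ η n k w a b U V z := by
  simp only [relSum, relCoeff_add_one]

lemma relSum_add_tau [NeZero n] (a b : ZMod n) (U V : Fin (p + 1) → ℂ) (z : ℂ) :
    relSum τ η n k w a b U V (z + τ) = e (n * η) * relSum τ η n k w a b U V z := by
  simp only [relSum, relCoeff_add_tau, Finset.mul_sum, mul_assoc]

lemma meromorphicAt_relSum [NeZero n] (hτ : 0 < τ.im) (a b : ZMod n) (U V : Fin (p + 1) → ℂ)
    (z : ℂ) : MeromorphicAt (relSum τ η n k w a b U V) z := by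
  unfold relSum
  exact MeromorphicAt.fun_sum fun r _ =>
    (meromorphicAt_relCoeff hτ _ _ z).fun_mul (MeromorphicAt.const _ z)

lemma continuousAt_relSum [NeZero n] (hτ : 0 < τ.im) (hη : (n : ℂ) * η ∉ lattice τ) (a b : ZMod n)
    (U V : Fin (p + 1) → ℂ) {z : ℂ} (hz : n * z ∉ lattice τ) :
    ContinuousAt (relSum τ η n k w a b U V) z := by
  unfold relSum
  exact tendsto_finsetSum _ fun r _ =>
    (continuousAt_relCoeff hτ hη _ _ fun i j _ h => hz (mem_lattice.2 ⟨i, j, h⟩)).mul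
      continuousAt_const

/-- The coefficient with α = b - a + r has a pole at z₀ only if α ≡ j, so r = a - b + j alone
contributes, with w_{a+j}(U) w_{b-j}(V): the product in the residue of the first exchange summand.
-/
lemma tendsto_relSum [NeZero n] (hτ : 0 < τ.im) (hη : (n : ℂ) * η ∉ lattice τ) (hκ : κ + k = n)
    (a b : ZMod n) (U V : Fin (p + 1) → ℂ) {z₀ : ℂ} {i j : ℤ} (hz₀ : n * z₀ = i + j * τ) :
    Tendsto (fun z => (z - z₀) * relSum τ η n k w a b U V z) (𝓝[≠] z₀)
      (𝓝 (-(e (j * η + κ / n * (i * (a - b + j).val : ℤ)) / (deriv (theta τ) 0 * torsionProd τ n)) *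
        (w (a + j) U * w (b - j) V))) := by
  have hn0 : (n : ℂ) ≠ 0 := NeZero.ne _
  have hzv : ∀ x : ZMod n, ((x.val : ℤ) : ZMod n) = x := fun x => by simp
  have hz₁ : z₀ = (i + j * τ) / n := by rw [← hz₀]; field_simp
  have h : ∀ r : ZMod n, Tendsto (fun z => (z - z₀) *
      (relCoeff τ n η ((b - a + r).val : ℤ) ((k * r).val : ℤ) z * (w (b + r) U * w (a - r) V)))
      (𝓝[≠] z₀) (𝓝 (if r = a - b + j then
        -(e (j * η + κ / n * (i * (a - b + j).val : ℤ)) / (deriv (theta τ) 0 * torsionProd τ n)) *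
        (w (a + j) U * w (b - j) V) else 0)) := by
    intro r
    by_cases hr : r = a - b + j
    · rw [if_pos hr]
      have h1 := (tendsto_relCoeff hτ hη ((b - a + r).val : ℤ) ((k * r).val : ℤ) hz₁
        (by rw [hzv, hr]; ring)).mul_const (w (b + r) U * w (a - r) V)
      refine (h1.congr fun z => by ring).trans (le_of_eq (congrArg 𝓝 ?_))
      rw [show b + r = a + j by rw [hr]; ring, show a - r = b - j by rw [hr]; ring]
      -- Here κ ≡ -k modulo n converts the label kr of the elliptic relations into the eigenvalue
      -- exponent of Θ. It is the reason for using the expansion of n/(n-k).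
      have h2 := e_div_mul_congr (n := n) 1 (a := -(i * (k * r).val : ℤ))
        (b := κ * (i * r.val : ℤ)) (by
          have h3 : (κ : ZMod n) = -k := by
            rw [eq_neg_iff_add_eq_zero, ← Nat.cast_add, hκ, ZMod.natCast_self]
          push_cast
          rw [h3]
          simp only [ZMod.natCast_val, ZMod.cast_id', id]
          ring)
      have h4 : e (j * η - i * ((k * r).val : ℤ) / n) = e (j * η + κ / n * (i * r.val : ℤ)) := by
        rw [sub_eq_add_neg, e_add, e_add]
        congr 1
        convert h2 using 2 <;> push_cast <;> ring
      rw [h4, hr]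
    · rw [if_neg hr]
      refine tendsto_sub_mul_zero ((continuousAt_relCoeff hτ hη _ _ fun i' j' hj' h => hr ?_).mul
        continuousAt_const)
      rw [hz₀] at h
      have h2 : j = j' := by
        have := congrArg Complex.im h
        simp only [Complex.add_im, Complex.intCast_im, Complex.mul_im, Complex.intCast_re, zero_add,
          zero_mul, add_zero] at this
        exact_mod_cast mul_right_cancel₀ hτ.ne' this
      rw [h2, hj', hzv]
      ring
  have h1 := tendsto_finsetSum Finset.univ fun r _ => h r
  rw [Finset.sum_ite_eq' Finset.univ, if_pos (Finset.mem_univ _)] at h1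
  refine h1.congr fun z => ?_
  rw [relSum, Finset.mul_sum]

/-- The exchange identity for generic parameters. -/
lemma IsThetaBasis.sum_exchangeTerm_of_generic [NeZero n] (hτ : 0 < τ.im) (hm : ∀ i, 2 ≤ m i)
    (hn : contAfter m 0 = n) (h1 : contAfter m 1 = κ) (hκ : κ + k = n)
    (hη : (n : ℂ) * η ∉ lattice τ) (hw : IsThetaBasis τ n κ m φ w) (a b : ZMod n)
    (hgen : ∀ z, ∀ s ≤ p + 1, ∀ t ≤ p + 1, xCoord m η U v s z ∈ lattice τ →
      xCoord m η U v t z ∈ lattice τ → s = t)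
    {z : ℂ} (hz : ∀ t ≤ p + 1, xCoord m η U v t z ∉ lattice τ) :
    ∑ t ∈ Finset.range (p + 2), exchangeTerm m τ η U v (w a) (w b) t z =
      torsionProd τ n / n * relSum τ η n k w a b U (v + η • icast (beforeVec m)) z := by
  have hn0 : (n : ℂ) ≠ 0 := NeZero.ne _
  have hlast : ∀ z, xCoord m η U v (p + 2) z ∉ lattice τ := by
    intro z
    rw [xCoord, if_pos rfl, contAfter_last_succ, hn]
    simpa using hη
  have hx0 : ∀ z, xCoord m η U v 0 z = -(n * z) := by
    intro z
    simp only [xCoord, if_neg (show 0 ≠ p + 2 by omega), coord_zero, hn]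
    push_cast
    ring
  have hθ : ∀ {x}, x ∉ lattice τ → theta τ x ≠ 0 := fun h hc => h ((theta_eq_zero_iff hτ).1 hc)
  set V := v + η • icast (beforeVec m) with hV
  have hcont : ∀ t, ∀ z₀, xCoord m η U v t z₀ ∉ lattice τ → xCoord m η U v (t + 1) z₀ ∉ lattice τ →
      ContinuousAt (exchangeTerm m τ η U v (w a) (w b) t) z₀ := fun t z₀ h h' =>
    continuousAt_exchangeTerm hτ (hw.differentiable a) (hw.differentiable b) (hθ h) (hθ h')
  have hcont' : ∀ z₀, (∀ t ≤ p + 1, xCoord m η U v t z₀ ∉ lattice τ) →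
      ContinuousAt (fun z => ∑ t ∈ Finset.range (p + 2), exchangeTerm m τ η U v (w a) (w b) t z -
        torsionProd τ n / n * relSum τ η n k w a b U V z) z₀ := by
    intro z₀ h
    have h' : ∀ t ≤ p + 2, xCoord m η U v t z₀ ∉ lattice τ := by
      intro t ht
      rcases Nat.lt_or_ge (p + 1) t with h3 | h3
      · obtain rfl : t = p + 2 := by omega
        exact hlast z₀
      · exact h t h3
    refine ContinuousAt.sub (tendsto_finsetSum _ fun t ht => ?_)
      (continuousAt_const.mul (continuousAt_relSum hτ hη a b U V ?_))
    · have := Finset.mem_range.1 ht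
      exact hcont t z₀ (h' t (by omega)) (h' (t + 1) (by omega))
    · have := h 0 (by omega)
      rwa [hx0, neg_mem_iff] at this
  rw [← sub_eq_zero]
  refine meromorphic_eq_zero_of_periodic (f := fun z => ∑ t ∈ Finset.range (p + 2),
    exchangeTerm m τ η U v (w a) (w b) t z - torsionProd τ n / n * relSum τ η n k w a b U V z) hτ hη
    (fun z => ?_) (fun z₀ => ?_) (fun z => ?_) (fun z => ?_) (hcont' z hz)
  · exact (MeromorphicAt.fun_sum fun t _ => meromorphicAt_exchangeTerm hτ (hw.differentiable a)
      (hw.differentiable b) t z).fun_sub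
        ((MeromorphicAt.const _ z).fun_mul (meromorphicAt_relSum hτ a b U V z))
  · by_cases hreg : ∀ t ≤ p + 1, xCoord m η U v t z₀ ∉ lattice τ
    · exact tendsto_sub_mul_zero (hcont' z₀ hreg)
    push Not at hreg
    obtain ⟨t₀, ht₀, hmem⟩ := hreg
    have hne : ∀ t ≤ p + 2, t ≠ t₀ → xCoord m η U v t z₀ ∉ lattice τ := by
      intro t ht htt h
      rcases Nat.lt_or_ge (p + 1) t with h3 | h3
      · obtain rfl : t = p + 2 := by omega
        exact hlast z₀ h
      · exact htt (hgen z₀ t h3 t₀ ht₀ h hmem)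
    -- Genericity leaves one index in Γ. Index 0 means z₀ ∈ Γ/n and pairs the first summand with
    -- `relSum`; an index i + 1 is a pole shared by the summands i and i + 1.
    cases t₀ with
    | zero =>
      have hmem' := hmem
      rw [hx0, neg_mem_iff] at hmem'
      obtain ⟨i, j, hij⟩ := mem_lattice.1 hmem'
      have r1 := hw.tendsto_exchangeTerm_zero hτ hn h1 a b hij (hθ (hne 1 (by omega) (by omega)))
      have r2 := (tendsto_relSum (w := w) hτ hη hκ a b U V hij).const_mul (torsionProd τ n / n)
      have r3 : Tendsto (fun z => ∑ t ∈ Finset.range (p + 1),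
          (z - z₀) * exchangeTerm m τ η U v (w a) (w b) (t + 1) z) (𝓝[≠] z₀)
          (𝓝 (∑ t ∈ Finset.range (p + 1), 0)) :=
        tendsto_finsetSum _ fun t ht => tendsto_sub_mul_zero
          (hcont (t + 1) z₀ (hne (t + 1) (by have := Finset.mem_range.1 ht; omega) (by omega))
            (hne (t + 2) (by have := Finset.mem_range.1 ht; omega) (by omega)))
      have r4 := (r3.add r1).sub r2
      refine Tendsto.congr (fun z => ?_) (r4.trans (le_of_eq (congrArg 𝓝 ?_)))
      · rw [Finset.sum_range_succ' _ (p + 1), mul_sub, mul_add, Finset.mul_sum]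
        ring
      · have hP := torsionProd_ne_zero (n := n) hτ
        have hd := deriv_theta_zero_ne_zero hτ
        rw [Finset.sum_const_zero]
        field_simp
        ring
    | succ i =>
      obtain ⟨c, c1, c2⟩ := exists_tendsto_exchangeTerm hτ hm (hw.mem a) (hw.mem b)
        (i := ⟨i, by omega⟩) hmem (hθ (hne i (by omega) (by omega)))
        (hθ (hne (i + 2) (by omega) (by omega)))
      have r : ∀ t ∈ Finset.range (p + 2), Tendsto
          (fun z => (z - z₀) * exchangeTerm m τ η U v (w a) (w b) t z) (𝓝[≠] z₀)
          (𝓝 ((if t = i then c else 0) - if t = i + 1 then c else 0)) := by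
        intro t ht
        have := Finset.mem_range.1 ht
        by_cases e1 : t = i
        · subst e1; simpa using c1
        · by_cases e2 : t = i + 1
          · subst e2; simpa using c2
          · rw [if_neg e1, if_neg e2, sub_zero]
            exact tendsto_sub_mul_zero (hcont t z₀ (hne t (by omega) e2)
              (hne (t + 1) (by omega) (by omega)))
      have r1 := tendsto_finsetSum _ r
      have r2 := tendsto_sub_mul_zero (continuousAt_relSum (k := k) (w := w) hτ hη a b U V (z := z₀) (by
        have := hne 0 (by omega) (by omega)
        rwa [hx0, neg_mem_iff] at this))
      refine Tendsto.congr (fun z => ?_) ((r1.sub (r2.const_mul (torsionProd τ n / n))).trans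
        (le_of_eq (congrArg 𝓝 ?_)))
      · rw [mul_sub, Finset.mul_sum]
        ring
      · rw [Finset.sum_sub_distrib, Finset.sum_ite_eq', Finset.sum_ite_eq',
          if_pos (Finset.mem_range.2 (by omega)), if_pos (Finset.mem_range.2 (by omega))]
        ring
  · rw [relSum_add_one, Finset.sum_congr rfl fun t _ => exchangeTerm_add_one (hw.mem a) (hw.mem b) t z]
  · rw [relSum_add_tau, Finset.sum_congr rfl fun t ht => exchangeTerm_add_tau (hw.mem a) (hw.mem b)
      (show t ≤ p + 1 by have := Finset.mem_range.1 ht; omega) z, ← Finset.mul_sum, hn]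
    push_cast
    ring

end Identity

/-! ### Removing the genericity assumption -/

section Perturbation

variable {p : ℕ} {m : Fin (p + 1) → ℕ} {τ φ η : ℂ} {n κ k : ℕ}
  {w : ZMod n → (Fin (p + 1) → ℂ) → ℂ} {U v : Fin (p + 1) → ℂ}

/-- A direction in which the parameters of the exchange relation become generic. -/
noncomputable def genericDir (m : Fin (p + 1) → ℕ) : Fin (p + 1) → ℂ :=
  fun i => (i.val + 1) * contAfter m (i + 1)

lemma xCoord_add_genericDir {j : ℕ} (hj : j ≤ p + 1) (ε z : ℂ) :
    xCoord m η U (v + ε • genericDir m) j z = xCoord m η U v j z + ε * (j * contAfter m j) := by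
  have h : coord (genericDir m) j = j * contAfter m j := by
    cases j with
    | zero => simp [coord]
    | succ j =>
      rw [show coord (genericDir m) (j + 1) = genericDir m ⟨j, by omega⟩ from
        coord_succ (genericDir m) ⟨j, by omega⟩]
      simp [genericDir]
  simp only [xCoord, if_neg (show j ≠ p + 2 by omega), coord_sub, coord_add, coord_smul, h]
  ring

/-- Eliminating z from the conditions on x_s and x_t leaves a linear equation for ε with leading
coefficient A_s A_t (s - t) ≠ 0. Each pair of indices and lattice points thus excludes one value of
ε. -/
lemma exists_countable_generic (hm : ∀ i, 2 ≤ m i) (η : ℂ) (U v : Fin (p + 1) → ℂ) :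
    ∃ S : Set ℂ, S.Countable ∧ ∀ ε ∉ S, ∀ z, ∀ s ≤ p + 1, ∀ t ≤ p + 1,
      xCoord m η U (v + ε • genericDir m) s z ∈ lattice τ →
      xCoord m η U (v + ε • genericDir m) t z ∈ lattice τ → s = t := by
  refine ⟨Set.range fun q : (ℕ × ℕ) × (ℤ × ℤ) × (ℤ × ℤ) =>
    (contAfter m q.1.1 * (xCoord m η U v q.1.2 0 - (q.2.2.1 + q.2.2.2 * τ)) -
      contAfter m q.1.2 * (xCoord m η U v q.1.1 0 - (q.2.1.1 + q.2.1.2 * τ))) /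
      (contAfter m q.1.1 * contAfter m q.1.2 * ((q.1.1 : ℂ) - q.1.2)),
    Set.countable_range _, fun ε hε z s hs t ht h1 h2 => ?_⟩
  by_contra hst
  obtain ⟨i, j, hij⟩ := mem_lattice.1 h1
  obtain ⟨i', j', hij'⟩ := mem_lattice.1 h2
  refine hε ⟨((s, t), (i, j), (i', j')), ?_⟩
  have hA : (contAfter m s : ℂ) ≠ 0 := by exact_mod_cast (contAfter_pos hm hs).ne'
  have hA' : (contAfter m t : ℂ) ≠ 0 := by exact_mod_cast (contAfter_pos hm ht).ne'
  have hd : (s : ℂ) - t ≠ 0 := sub_ne_zero.2 (by exact_mod_cast hst)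
  rw [xCoord_add_genericDir hs, ← zero_add z, xCoord_add] at hij
  rw [xCoord_add_genericDir ht, ← zero_add z, xCoord_add] at hij'
  rw [div_eq_iff (mul_ne_zero (mul_ne_zero hA hA') hd)]
  linear_combination contAfter m s * hij' - contAfter m t * hij

lemma continuous_spliceAt {X : Type*} [TopologicalSpace X] {x y : X → Fin (p + 1) → ℂ}
    (hx : Continuous x) (hy : Continuous y) (t : ℕ) :
    Continuous fun ε => spliceAt t (x ε) (y ε) := by
  refine continuous_pi fun i => ?_
  simp only [spliceAt]
  split_ifs <;> fun_prop

/-- The exchange identity, without genericity assumption. -/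
lemma IsThetaBasis.sum_exchangeTerm [NeZero n] (hτ : 0 < τ.im) (hm : ∀ i, 2 ≤ m i)
    (hn : contAfter m 0 = n) (h1 : contAfter m 1 = κ) (hκ : κ + k = n)
    (hη : (n : ℂ) * η ∉ lattice τ) (hw : IsThetaBasis τ n κ m φ w) (a b : ZMod n)
    {z : ℂ} (hz : ∀ t ≤ p + 1, xCoord m η U v t z ∉ lattice τ) :
    ∑ t ∈ Finset.range (p + 2), exchangeTerm m τ η U v (w a) (w b) t z =
      torsionProd τ n / n * relSum τ η n k w a b U (v + η • icast (beforeVec m)) z := by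
  have hθ := continuous_theta hτ
  obtain ⟨S, hS, hgen⟩ := exists_countable_generic (τ := τ) hm η U v
  have hxc : ∀ t, Continuous fun ε : ℂ => xCoord m η U (v + ε • genericDir m) t z := by
    intro t
    simp only [xCoord, coord_sub, coord_add, coord_smul]
    split_ifs <;> fun_prop
  have hx0 : ∀ t, xCoord m η U (v + (0 : ℂ) • genericDir m) t z = xCoord m η U v t z := fun t => by
    rw [zero_smul, add_zero]
  have hreg : ∀ t ≤ p + 2, theta τ (xCoord m η U v t z) ≠ 0 := by
    intro t ht
    rw [Ne, theta_eq_zero_iff hτ]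
    rcases Nat.lt_or_ge (p + 1) t with h3 | h3
    · obtain rfl : t = p + 2 := by omega
      rw [xCoord, if_pos rfl, contAfter_last_succ, hn]
      simpa using hη
    · exact hz t h3
  have hev : ∀ᶠ ε in 𝓝 (0 : ℂ), ∀ t ∈ Finset.range (p + 2),
      xCoord m η U (v + ε • genericDir m) t z ∉ lattice τ := by
    refine (Filter.eventually_all_finset _).2 fun t ht => ?_
    have h2 := (hθ.comp (hxc t)).continuousAt (x := (0 : ℂ))
    have h3 := h2.eventually_ne (by
      simp only [Function.comp, hx0]
      exact hreg t (by have := Finset.mem_range.1 ht; omega))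
    filter_upwards [h3] with ε hε hc
    exact hε ((theta_eq_zero_iff hτ).2 hc)
  have hc : ContinuousAt (fun ε : ℂ => ∑ t ∈ Finset.range (p + 2),
      exchangeTerm m τ η U (v + ε • genericDir m) (w a) (w b) t z - torsionProd τ n / n *
        relSum τ η n k w a b U (v + ε • genericDir m + η • icast (beforeVec m)) z) 0 := by
    refine ContinuousAt.sub (tendsto_finsetSum _ fun t ht => ?_) (Continuous.continuousAt ?_)
    · have := Finset.mem_range.1 ht
      refine ContinuousAt.mul (continuousAt_kron hτ (hxc t).continuousAt (hxc (t + 1)).neg.continuousAt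
        ?_ (theta_neg_ne_zero ?_)) (Continuous.continuousAt (Continuous.mul
          ((hw.differentiable a).continuous.comp ?_) ((hw.differentiable b).continuous.comp ?_)))
      · rw [hx0]; exact hreg t (by omega)
      · rw [hx0]; exact hreg (t + 1) (by omega)
      · exact (continuous_spliceAt (by fun_prop) continuous_const t).add continuous_const
      · exact ((continuous_spliceAt continuous_const (by fun_prop) t).add continuous_const).sub
          continuous_const
    · refine continuous_const.mul (continuous_finsetSum _ fun r _ => continuous_const.mul
        (continuous_const.mul ((hw.differentiable _).continuous.comp (by fun_prop))))
  rw [← sub_eq_zero]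
  -- The difference of the two sides is continuous in ε at 0, and generic ε are dense as the
  -- complement of a countable set; a nonzero value at ε = 0 would persist at some generic ε.
  by_contra hne
  have hne' := hc.eventually_ne (y := 0) (by simpa only [zero_smul, add_zero] using hne)
  obtain ⟨ε, hε, h2, h3⟩ := (hS.dense_compl ℂ).inter_nhds_nonempty (hne'.and hev)
  exact h2 (sub_eq_zero.2 (hw.sum_exchangeTerm_of_generic hτ hm hn h1 hκ hη a b (hgen ε hε)
    fun t ht => h3 t (Finset.mem_range.2 (by omega))))

end Perturbation

/-! ### Specialization of the spectral parameter to z = η -/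

section Specialization

variable {p : ℕ} {m : Fin (p + 1) → ℕ} {τ φ η : ℂ} {n κ k : ℕ} {u v : Fin (p + 1) → ℂ}

lemma xCoord_apply_self {j : ℕ} (h0 : j ≠ 0) (hj : j ≤ p + 1) :
    xCoord m η (u - η • icast (afterVec m)) v j η = coord (v - u) j := by
  simp only [xCoord, if_neg (show j ≠ p + 2 by omega), coord_sub, coord_smul,
    coord_afterVec h0 (show j ≤ p + 2 by omega)]
  ring

lemma leftPt_apply_self (t : ℕ) :
    leftPt m (u - η • icast (afterVec m)) v t η = spliceAt t v u := by
  ext i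
  simp only [leftPt, spliceAt, icast, tailVec, Pi.add_apply, Pi.smul_apply, Pi.sub_apply, smul_eq_mul]
  split_ifs <;> simp

lemma rightPt_apply_self (t : ℕ) :
    rightPt m η (u - η • icast (afterVec m)) v t η =
      spliceAt t (u + exchangeShift m η) (v + exchangeShift m η) := by
  ext i
  simp only [rightPt, spliceAt, icast, tailVec, beforeVec, afterVec, Pi.add_apply, Pi.smul_apply,
    Pi.sub_apply, smul_eq_mul, exchangeShift, dBefore_eq, dAfter_eq]
  split_ifs
  · push_cast; ring
  · ring

lemma splice_eq_spliceAt (s : Fin p) (x y : Fin (p + 1) → ℂ) :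
    splice s x y = spliceAt (s + 1) x y := by
  ext i
  simp only [splice, spliceAt, Fin.le_def, Fin.val_castSucc, Nat.lt_succ_iff]

/-- The exchange relation, evaluated on a product of two functions, in terms of Kronecker
functions. -/
lemma exchange_eq_sum_exchangeTerm (hτ : 0 < τ.im) (hn : contAfter m 0 = n)
    (hη : (n : ℂ) * η ∉ lattice τ) (f g : (Fin (p + 1) → ℂ) → ℂ) :
    theta τ (v 0 - u 0 + n * η) / theta τ (v 0 - u 0) * (f u * g (v + exchangeShift m η)) -
      (∑ s : Fin p, theta τ (n * η) * theta τ (v s.castSucc - u s.castSucc + u s.succ - v s.succ) /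
          (theta τ (v s.castSucc - u s.castSucc) * theta τ (u s.succ - v s.succ)) *
          (f (splice s v u) * g (splice s (u + exchangeShift m η) (v + exchangeShift m η))) +
        theta τ (v (Fin.last p) - u (Fin.last p) + n * η) /
          theta τ (v (Fin.last p) - u (Fin.last p)) * (f v * g (u + exchangeShift m η))) =
      -theta τ (n * η) * ∑ t ∈ Finset.range (p + 2),
        exchangeTerm m τ η (u - η • icast (afterVec m)) v f g t η := by
  have hθ : theta τ (n * η) ≠ 0 := fun h => hη ((theta_eq_zero_iff hτ).1 h)
  have hs0 : ∀ x y : Fin (p + 1) → ℂ, spliceAt 0 x y = y := fun x y => by ext s; simp [spliceAt]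
  have hs1 : ∀ x y : Fin (p + 1) → ℂ, spliceAt (p + 1) x y = x := fun x y => by
    ext s; simp only [spliceAt, if_pos s.2]
  have hc : ∀ i : Fin (p + 1), coord (v - u) (i + 1) = v i - u i := fun i => coord_succ (v - u) i
  rw [Finset.sum_range_succ, Finset.sum_range_succ', Finset.sum_range]
  -- Both Kronecker arguments are negated here, which supplies the sign that puts the first summand
  -- on the other side of the relation from the rest.
  have e0 : exchangeTerm m τ η (u - η • icast (afterVec m)) v f g 0 η =
      -(theta τ (v 0 - u 0 + n * η) / (theta τ (n * η) * theta τ (v 0 - u 0))) *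
        (f u * g (v + exchangeShift m η)) := by
    have h0 : xCoord m η (u - η • icast (afterVec m)) v 0 η = -(n * η) := by
      rw [xCoord, if_neg (by omega), coord_zero, hn]
      push_cast
      ring
    rw [exchangeTerm, leftPt_apply_self, rightPt_apply_self, hs0, hs0, h0,
      xCoord_apply_self (by omega) (by omega), zero_add, kron_neg, kron,
      show coord (v - u) 1 = v 0 - u 0 from hc 0, add_comm (n * η)]
  have e1 : exchangeTerm m τ η (u - η • icast (afterVec m)) v f g (p + 1) η =
      theta τ (v (Fin.last p) - u (Fin.last p) + n * η) /
        (theta τ (v (Fin.last p) - u (Fin.last p)) * theta τ (n * η)) *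
        (f v * g (u + exchangeShift m η)) := by
    have h0 : xCoord m η (u - η • icast (afterVec m)) v (p + 2) η = -(n * η) := by
      rw [xCoord, if_pos rfl, contAfter_last_succ, hn]
      push_cast
      ring
    rw [exchangeTerm, leftPt_apply_self, rightPt_apply_self, hs1, hs1, h0,
      xCoord_apply_self (by omega) (by omega), neg_neg, kron,
      show coord (v - u) (p + 1) = v (Fin.last p) - u (Fin.last p) from hc (Fin.last p)]
  have e2 : ∀ s : Fin p, theta τ (n * η) *
        theta τ (v s.castSucc - u s.castSucc + u s.succ - v s.succ) /
          (theta τ (v s.castSucc - u s.castSucc) * theta τ (u s.succ - v s.succ)) *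
          (f (splice s v u) * g (splice s (u + exchangeShift m η) (v + exchangeShift m η))) =
      theta τ (n * η) * exchangeTerm m τ η (u - η • icast (afterVec m)) v f g (s + 1) η := by
    intro s
    have := s.2
    rw [exchangeTerm, leftPt_apply_self, rightPt_apply_self,
      xCoord_apply_self (by omega) (by omega), xCoord_apply_self (by omega) (by omega), kron,
      splice_eq_spliceAt, splice_eq_spliceAt,
      show coord (v - u) (s + 1) = v s.castSucc - u s.castSucc from hc s.castSucc,
      show coord (v - u) (s + 1 + 1) = v s.succ - u s.succ from hc s.succ,
      show v s.castSucc - u s.castSucc + -(v s.succ - u s.succ) =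
        v s.castSucc - u s.castSucc + u s.succ - v s.succ by ring,
      show -(v s.succ - u s.succ) = u s.succ - v s.succ by ring]
    ring
  rw [Finset.sum_congr rfl fun s _ => e2 s, ← Finset.mul_sum, e0, e1]
  field_simp
  ring

end Specialization

/-! ### Compatibility with the relations of the elliptic algebra -/

section Homomorphism

variable {p : ℕ} {m : Fin (p + 1) → ℕ} {τ φ η : ℂ} {n κ k : ℕ}
  {w : ZMod n → (Fin (p + 1) → ℂ) → ℂ}

lemma ellipticGen_relation (τ : ℂ) (n k : ℕ) [NeZero n] (η : ℂ) (i j : ZMod n) :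
    ∑ r : ZMod n, (thetaOrder τ n (j - i + r * ((k : ZMod n) - 1)) 0 /
      (thetaOrder τ n ((k : ZMod n) * r) η * thetaOrder τ n (j - i - r) (-η))) •
      (ellipticGen τ n k η (j - r) * ellipticGen τ n k η (i + r)) = 0 := by
  have h := RingQuot.mkAlgHom_rel ℂ (EllipticRel.rel (τ := τ) (n := n) (k := k) (η := η) i j)
  rw [map_zero, ellipticRelator, map_sum] at h
  simpa only [map_smul, map_mul, ellipticGen] using h

lemma relCoeff_apply_self [NeZero n] (α : ZMod n) (r : ZMod n) :
    relCoeff τ n η (α.val : ℤ) ((k * r).val : ℤ) η =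
      thetaOrder τ n (α + k * r) 0 / (thetaOrder τ n (k * r) η * thetaOrder τ n α (-η)) := by
  have hzv : ∀ x : ZMod n, ((x.val : ℤ) : ZMod n) = x := fun x => by simp
  rw [relCoeff, sub_self, thetaOrder_eq_thetaInt (hzv α), thetaOrder_eq_thetaInt (hzv (k * r)),
    thetaOrder_eq_thetaInt (j := (α.val : ℤ) + ((k * r).val : ℤ)) (by rw [Int.cast_add, hzv, hzv])]

/-- The relations of the elliptic algebra kill the relation sums. -/
lemma sum_relSum_smul_ellipticGen [NeZero n] (w : ZMod n → (Fin (p + 1) → ℂ) → ℂ)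
    (U V : Fin (p + 1) → ℂ) :
    ∑ a : ZMod n, ∑ b : ZMod n, relSum τ η n k w a b U V η •
      (ellipticGen τ n k η (1 - a) * ellipticGen τ n k η (1 - b)) = 0 := by
  simp only [relSum, relCoeff_apply_self, Finset.sum_smul]
  have h1 : ∀ r : ZMod n, ∑ a : ZMod n, ∑ b : ZMod n,
      (thetaOrder τ n (b - a + r + k * r) 0 /
        (thetaOrder τ n (k * r) η * thetaOrder τ n (b - a + r) (-η)) *
        (w (b + r) U * w (a - r) V)) •
        (ellipticGen τ n k η (1 - a) * ellipticGen τ n k η (1 - b)) =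
      ∑ j : ZMod n, ∑ i : ZMod n, (w (1 - i) U * w (1 - j) V) •
        ((thetaOrder τ n (j - i + r * ((k : ZMod n) - 1)) 0 /
          (thetaOrder τ n ((k : ZMod n) * r) η * thetaOrder τ n (j - i - r) (-η))) •
        (ellipticGen τ n k η (j - r) * ellipticGen τ n k η (i + r))) := by
    intro r
    -- For fixed r the substitution j = 1 + r - a, i = 1 - r - b turns x_{1-a} x_{1-b} into x_{j-r}
    -- x_{i+r}, while the theta factors become w_{1-i}(U) w_{1-j}(V), free of r. The sum over r is
    -- then a defining relation.
    refine Fintype.sum_equiv (Equiv.subLeft (1 + r)) _ _ fun a => ?_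
    refine Fintype.sum_equiv (Equiv.subLeft (1 - r)) _ _ fun b => ?_
    simp only [Equiv.subLeft_apply]
    rw [smul_smul, mul_comm (w _ _ * _),
      show 1 + r - a - (1 - r - b) + r * ((k : ZMod n) - 1) = b - a + r + k * r by ring,
      show 1 + r - a - (1 - r - b) - r = b - a + r by ring, show 1 + r - a - r = 1 - a by ring,
      show 1 - r - b + r = 1 - b by ring, show 1 - (1 - r - b) = b + r by ring,
      show 1 - (1 + r - a) = a - r by ring]
  rw [Finset.sum_congr rfl fun a _ => Finset.sum_comm, Finset.sum_comm,
    Finset.sum_congr rfl fun r _ => h1 r, Finset.sum_comm]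
  refine Finset.sum_eq_zero fun j _ => ?_
  rw [Finset.sum_comm]
  refine Finset.sum_eq_zero fun i _ => ?_
  rw [← Finset.smul_sum, ellipticGen_relation, smul_zero]

/-- The image of the generator `e(u)`. -/
noncomputable def thetaGen (τ : ℂ) (n k : ℕ) [NeZero n] (η : ℂ)
    (w : ZMod n → (Fin (p + 1) → ℂ) → ℂ) (u : Fin (p + 1) → ℂ) : EllipticAlgebra τ n k η :=
  ∑ a : ZMod n, w a u • ellipticGen τ n k η (1 - a)

lemma thetaGen_mul [NeZero n] (x y : Fin (p + 1) → ℂ) :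
    thetaGen τ n k η w x * thetaGen τ n k η w y =
      ∑ a : ZMod n, ∑ b : ZMod n, (w a x * w b y) •
        (ellipticGen τ n k η (1 - a) * ellipticGen τ n k η (1 - b)) := by
  simp only [thetaGen, Finset.sum_mul_sum, smul_mul_smul_comm]

lemma IsThetaBasis.exchange_relation [NeZero n] (hτ : 0 < τ.im) (hm : ∀ i, 2 ≤ m i)
    (hn : contAfter m 0 = n) (h1 : contAfter m 1 = κ) (hκ : κ + k = n)
    (hη : (n : ℂ) * η ∉ lattice τ) (hw : IsThetaBasis τ n κ m φ w) {u v : Fin (p + 1) → ℂ}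
    (huv : ∀ t, theta τ (v t - u t) ≠ 0) :
    FreeAlgebra.lift ℂ (thetaGen τ n k η w) (exchangeLHS τ (n * η) (exchangeShift m η) u v) =
      FreeAlgebra.lift ℂ (thetaGen τ n k η w) (exchangeRHS τ (n * η) (exchangeShift m η) u v) := by
  have hgen : ∀ t ≤ p + 1, xCoord m η (u - η • icast (afterVec m)) v t η ∉ lattice τ := by
    intro t ht
    cases t with
    | zero =>
      rw [xCoord, if_neg (by omega), coord_zero, hn, zero_sub, neg_mem_iff, mul_comm]
      exact_mod_cast hη
    | succ t =>
      rw [xCoord_apply_self (by omega) ht, ← theta_eq_zero_iff hτ]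
      have h2 : coord (v - u) (t + 1) = v ⟨t, by omega⟩ - u ⟨t, by omega⟩ :=
        coord_succ (v - u) ⟨t, by omega⟩
      rw [h2]
      exact huv _
  rw [← sub_eq_zero]
  simp only [exchangeLHS, exchangeRHS, eFree, map_add, map_sum, map_smul, map_mul,
    FreeAlgebra.lift_ι_apply, thetaGen_mul]
  -- For each pair (a, b) the exchange combination becomes -θ(nη) times `torsionProd`/n times
  -- `relSum` at z = η. The constant does not depend on a or b, so the elliptic relations annihilate
  -- the total.
  have key : ∀ a b : ZMod n, _ := fun a b =>
    exchange_eq_sum_exchangeTerm (u := u) (v := v) hτ hn hη (w a) (w b)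
  simp only [hw.sum_exchangeTerm hτ hm hn h1 hκ hη _ _ hgen, ← mul_assoc (-theta τ (n * η))] at key
  have hsum := sum_relSum_smul_ellipticGen (k := k) (η := η) (τ := τ) w
    (u - η • icast (afterVec m)) (v + η • icast (beforeVec m))
  have hsum' := congrArg (fun x => (-theta τ (n * η) * (torsionProd τ n / n)) • x) hsum
  simp only [Finset.smul_sum, smul_smul, ← key, smul_zero] at hsum'
  rw [← hsum']
  simp only [sub_smul, add_smul, Finset.sum_smul, Finset.sum_sub_distrib, Finset.sum_add_distrib,
    Finset.smul_sum, smul_smul]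
  congr 2
  rw [Finset.sum_comm]
  refine Finset.sum_congr rfl fun a _ => ?_
  rw [Finset.sum_comm]

end Homomorphism

end EllipticAlg

theorem proposition14 (τ : ℂ) (hτ : 0 < τ.im) (n k : ℕ) [NeZero n] (hk : 1 ≤ k) (hkn : k < n)
    (hcop : Nat.Coprime n k) (η : ℂ) (hη : (n : ℂ) * η ∉ EllipticAlg.lattice τ)
    (p : ℕ) (m : Fin (p + 1) → ℕ)
    (hm : EllipticAlg.IsCFExpansion ((n : ℚ) / ((n : ℚ) - (k : ℚ))) m) :
    (∃ (φ : ℂ) (w : ZMod n → (Fin (p + 1) → ℂ) → ℂ),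
      EllipticAlg.IsThetaBasis τ n (n - k) m φ w) ∧
    ∀ (φ : ℂ) (w : ZMod n → (Fin (p + 1) → ℂ) → ℂ),
      EllipticAlg.IsThetaBasis τ n (n - k) m φ w →
      ∃ ψ : EllipticAlg.ExchangeAlgebra τ ((n : ℂ) * η) (EllipticAlg.exchangeShift m η) →ₐ[ℂ]
          EllipticAlg.EllipticAlgebra τ n k η,
        ∀ u : Fin (p + 1) → ℂ,
          ψ (EllipticAlg.exchangeGen τ ((n : ℂ) * η) (EllipticAlg.exchangeShift m η) u) =
            ∑ a : ZMod n, w a u • EllipticAlg.ellipticGen τ n k η (1 - a) := by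
  -- Besides m_i ≥ 2, the values A_0 = n and A_1 = n - k are all that is used of the continued
  -- fraction.
  have hA := EllipticAlg.contAfter_eq_of_isCFExpansion hkn hcop hm
  have hκ : Nat.Coprime (n - k) n := (Nat.coprime_self_sub_left hkn.le).2 hcop.symm
  refine ⟨EllipticAlg.exists_isThetaBasis hτ hm.1 hA.1 hA.2 hκ, fun φ w hw => ?_⟩
  refine ⟨RingQuot.liftAlgHom ℂ ⟨FreeAlgebra.lift ℂ (EllipticAlg.thetaGen τ n k η w), ?_⟩,
    fun u => ?_⟩
  · rintro _ _ ⟨u, v, huv⟩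
    exact hw.exchange_relation hτ hm.1 hA.1 hA.2 (Nat.sub_add_cancel hkn.le) hη huv
  · rw [EllipticAlg.exchangeGen, RingQuot.liftAlgHom_mkAlgHom_apply, EllipticAlg.eFree,
      FreeAlgebra.lift_ι_apply, EllipticAlg.thetaGen]
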